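/- Let $(X,\omega)$ be a connected symplectic manifold of dimension $2N$ (all manifolds are smooth, Hausdorff and second countable), and let $\pi : X\to B$ be a smooth submersion onto an $N$-dimensional manifold whose fibres $F_b=\pi^{-1}(b)$ are compact, connected and Lagrangian (an *integrable system*). A tangent vector $v\in T_bB$ defines the class in $H^1(F_b,\mathbb R)$ of the closed 1-form $u\mapsto\frac1{2\pi}\omega(u,\tilde v)$ on $F_b$, where $\tilde v$ is any lift of $v$ along $F_b$; this gives an isomorphism $TB\simeq R^1\pi_*\mathbb R\otimes C^\infty_B$. Let $\nabla$ be the (flat, torsion-free) Gauss–Manin connection on $TB$, i.e. the connection for which $d\langle v,\gamma\rangle=\langle\nabla v,\gamma\rangle$ for every vector field $v$ and every locally constant section $\gamma$ of the local system $b\mapsto H_1(F_b,\mathbb Z)$. Let $\hat X=R^1\pi_*\mathbb R/R^1\pi_*\mathbb Z$ be the dual fibration, that is, the quotient $\hat\pi:\hat X\to B$ of $TB$ obtained by identifying $v,v'\in T_bB$ whenever their classes differ by an element of $H^1(F_b,\mathbb Z)$. Let $\Omega$ be a symplectic form on $B$ with $\nabla\Omega=0$. Then $\hat X$, with the quotient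 topology, has a smooth structure for which $TB\to\hat X$ is a local diffeomorphism; $N=2n$ is even; and every point of $B$ has an open neighbourhood $U$ with coordinates $(x,y)=(x_1,\dots,x_n,y_1,\dots,y_n)$ that are flat ($\nabla dx_i=\nabla dy_i=0$) and satisfy $\Omega=\sum_i dx_i\wedge dy_i$ on $U$, such that the following hold. 1. There are closed 1-forms $dp_i,dq_i$ on $\pi^{-1}(U)$ (differentials of multivalued functions $p_i,q_i$) with $\omega=\sum_i dp_i\wedge dx_i+dq_i\wedge dy_i$ there, and the forms $$\omega,\qquad \chi=\sum_i\left(-dp_i\wedge dq_i+dx_i\wedge dy_i\right),\qquad \sigma=\sum_i\left(dq_i\wedge dx_i+dy_i\wedge dp_i\right)$$ constitute a hyper-symplectic structure on $\pi^{-1}(U)$: they are symplectic, and for any two distinct members $\alpha,\beta$ of the triple the endomorphism $A=\alpha^{-1}\beta$, defined by $\alpha(Au,v)=\beta(u,v)$, satisfies $A^2=-\mathrm{Id}$. 2. Let $P_i,Q_i$ be the multivalued functions on $\hat\pi^{-1}(U)$ whose pull-backs to $TB|_U$ are $v\mapsto dx_i(v)$ and $v\mapsto dy_i(v)$; their differentials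 are well defined. Then the endomorphisms $$J_\omega=\sum_i\left(dx_i\otimes\tfrac{\partial}{\partial P_i}-dP_i\otimes\tfrac{\partial}{\partial x_i}+dy_i\otimes\tfrac{\partial}{\partial Q_i}-dQ_i\otimes\tfrac{\partial}{\partial y_i}\right),$$ $$J_\chi=\sum_i\left(-dP_i\otimes\tfrac{\partial}{\partial Q_i}+dQ_i\otimes\tfrac{\partial}{\partial P_i}+dx_i\otimes\tfrac{\partial}{\partial y_i}-dy_i\otimes\tfrac{\partial}{\partial x_i}\right),\qquad J_\sigma=J_\omega\circ J_\chi$$ form a hypercomplex structure on $\hat\pi^{-1}(U)$: they are integrable complex structures and $J_\omega J_\chi=J_\sigma=-J_\chi J_\omega$. -/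

import Mathlib

open scoped Manifold ContDiff

noncomputable section

namespace IntegrableSystem

/-! ### Differential forms and tensors on manifolds -/

section Forms

variable {E : Type*} [NormedAddCommGroup E] [NormedSpace ℝ E]
  {H : Type*} [TopologicalSpace H] (I : ModelWithCorners ℝ E H)
  (M : Type*) [TopologicalSpace M] [ChartedSpace H M]

/-- Fields of covectors on `M`. -/
abbrev OneForm : Type _ := (x : M) → TangentSpace I x →L[ℝ] ℝ

/-- Fields of alternating bilinear forms on `M`. -/
abbrev TwoForm : Type _ := (x : M) → TangentSpace I x [⋀^Fin 2]→L[ℝ] ℝ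

/-- Fields of endomorphisms of the tangent spaces of `M`. -/
abbrev EndField : Type _ := (x : M) → TangentSpace I x →L[ℝ] TangentSpace I x

/-- The wedge product of two covectors: `(α ∧ β)(u, v) = α u * β v - α v * β u`. -/
def wedge {V : Type*} [AddCommGroup V] [Module ℝ V] [TopologicalSpace V]
    (α β : V →L[ℝ] ℝ) : V [⋀^Fin 2]→L[ℝ] ℝ :=
  ContinuousMultilinearMap.alternatization
    ((ContinuousMultilinearMap.mkPiAlgebra ℝ (Fin 2) ℝ).compContinuousLinearMap ![α, β])

theorem wedge_apply {V : Type*} [AddCommGroup V] [Module ℝ V] [TopologicalSpace V]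
    (α β : V →L[ℝ] ℝ) (v : Fin 2 → V) :
    wedge α β v = α (v 0) * β (v 1) - α (v 1) * β (v 0) := by
  rw [wedge, ContinuousMultilinearMap.alternatization_apply_apply,
    show (Finset.univ : Finset (Equiv.Perm (Fin 2))) = {1, Equiv.swap 0 1} by decide,
    Finset.sum_pair (by decide)]
  simp [Fin.prod_univ_two, sub_eq_add_neg]

variable {I M}

/-- The expression of a 2-form in the preferred chart at `x₀`. -/
def TwoForm.chartRep (ωX : TwoForm I M) (x₀ : M) : E → E [⋀^Fin 2]→L[ℝ] ℝ := fun y =>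
  (ωX ((extChartAt I x₀).symm y)).compContinuousLinearMap
    (mfderiv 𝓘(ℝ, E) I (extChartAt I x₀).symm y)

/-- The part of the image of the preferred chart at `x₀` that parametrizes points of `W`. -/
def chartDomain (I : ModelWithCorners ℝ E H) (W : Set M) (x₀ : M) : Set E :=
  (extChartAt I x₀).target ∩ (extChartAt I x₀).symm ⁻¹' W

/-- `ωX` is a symplectic form on the open subset `W` of the boundaryless manifold `M`: it is
smooth and closed (in charts) and nondegenerate at each point of `W`. -/
structure TwoForm.IsSymplecticOn (ωX : TwoForm I M) (W : Set M) : Prop where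
  smooth : ∀ x₀ : M, ContDiffOn ℝ ∞ (ωX.chartRep x₀) (chartDomain I W x₀)
  closed : ∀ x₀ : M, ∀ y ∈ chartDomain I W x₀, extDeriv (ωX.chartRep x₀) y = 0
  nondegenerate : ∀ x ∈ W, ∀ u : TangentSpace I x,
    (∀ v : TangentSpace I x, ωX x ![u, v] = 0) → u = 0

/-- `α` is, near each point of the open set `W`, the differential of a smooth function. (These
are exactly the smooth closed 1-forms on `W`; a multivalued coordinate `p` on `W` whose
branches differ by constants is recorded by its differential `dp`.) -/
def OneForm.IsLocallyExactOn (α : OneForm I M) (W : Set M) : Prop :=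
  ∀ x ∈ W, ∃ O : Set M, IsOpen O ∧ x ∈ O ∧ ∃ f : M → ℝ,
    ContMDiffOn I 𝓘(ℝ, ℝ) ∞ f O ∧ ∀ x' ∈ O, α x' = mvfderiv I f x'

/-- A hyper-symplectic structure on the open set `W`: three symplectic forms such that for
`i ≠ j` the recursion operator `A = ωᵢ⁻¹ ωⱼ`, i.e. the endomorphism determined by
`ωᵢ (A u, v) = ωⱼ (u, v)`, satisfies `A² = -1`. -/
structure IsHyperSymplecticOn (ωX : Fin 3 → TwoForm I M) (W : Set M) : Prop where
  symplectic : ∀ i, (ωX i).IsSymplecticOn W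
  recursion : ∀ i j, i ≠ j → ∀ x ∈ W, ∃ A : TangentSpace I x →L[ℝ] TangentSpace I x,
    (∀ u v, ωX i x ![A u, v] = ωX j x ![u, v]) ∧ ∀ u, A (A u) = -u

/-- `J` is an (integrable) complex structure on the open set `W`: `J² = -1`, and near each
point of `W` there is a system `z` of smooth complex-valued local coordinates which is
holomorphic for `J`, i.e. `dz ∘ J = i dz`. (In particular `J = (dz)⁻¹ i dz` is smooth.) -/
structure EndField.IsComplexStructureOn (J : EndField I M) (W : Set M) : Prop where
  sq : ∀ x ∈ W, ∀ u, J x (J x u) = -u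
  integrable : ∀ x ∈ W, ∃ O : Set M, IsOpen O ∧ x ∈ O ∧ ∃ (m : ℕ) (z : M → (Fin m → ℂ)),
    ContMDiffOn I 𝓘(ℝ, Fin m → ℂ) ∞ z O ∧ ∀ x' ∈ O,
      Function.Bijective (mvfderiv I z x') ∧
      ∀ u, mvfderiv I z x' (J x' u) = Complex.I • mvfderiv I z x' u

/-- `(J₁, J₂, J₃)` is a hypercomplex structure on the open set `W`: three complex structures
with `J₁ J₂ = J₃ = -J₂ J₁`. -/
structure IsHypercomplexOn (J₁ J₂ J₃ : EndField I M) (W : Set M) : Prop where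
  complex₁ : J₁.IsComplexStructureOn W
  complex₂ : J₂.IsComplexStructureOn W
  complex₃ : J₃.IsComplexStructureOn W
  mul : ∀ x ∈ W, ∀ u, J₁ x (J₂ x u) = J₃ x u
  anticomm : ∀ x ∈ W, ∀ u, J₂ x (J₁ x u) = -J₃ x u

end Forms

/-! ### Integrable systems, the Gauss–Manin connection and the dual fibration -/

section Fibration

variable {N : ℕ}
  {X : Type*} [TopologicalSpace X] [ChartedSpace (EuclideanSpace ℝ (Fin (2 * N))) X]
  {B : Type*} [TopologicalSpace B] [ChartedSpace (EuclideanSpace ℝ (Fin N)) B]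
  [IsManifold (𝓡 N) ∞ B]

/-- An integrable system: a submersion `π` from a `2N`-dimensional symplectic manifold to an
`N`-dimensional manifold whose fibres are compact, connected (in particular nonempty) and
Lagrangian (isotropic, of dimension `2N - N = N`). -/
structure IsIntegrableSystem (ωX : TwoForm (𝓡 (2 * N)) X) (π : X → B) : Prop where
  symplectic : ωX.IsSymplecticOn Set.univ
  smooth : ContMDiff (𝓡 (2 * N)) (𝓡 N) ∞ π
  submersion : ∀ x, Function.Surjective (mfderiv (𝓡 (2 * N)) (𝓡 N) π x)
  compact_fibre : ∀ b, IsCompact (π ⁻¹' {b})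
  connected_fibre : ∀ b, IsConnected (π ⁻¹' {b})
  lagrangian : ∀ x (u v : TangentSpace (𝓡 (2 * N)) x),
    mfderiv (𝓡 (2 * N)) (𝓡 N) π x u = 0 → mfderiv (𝓡 (2 * N)) (𝓡 N) π x v = 0 →
      ωX x ![u, v] = 0

open Classical in
/-- A tangent vector at `x` which projects under `dπ` to the tangent vector `V` of `B`
(it is defined up to vertical vectors if `π` is a submersion and `V` sits at `π x`). -/
def liftAt (π : X → B) (V : TangentBundle (𝓡 N) B) (x : X) : TangentSpace (𝓡 (2 * N)) x :=
  if h : ∃ ξ : TangentSpace (𝓡 (2 * N)) x,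
      tangentMap (𝓡 (2 * N)) (𝓡 N) π (⟨x, ξ⟩ : TangentBundle (𝓡 (2 * N)) X) = V
  then h.choose else 0

/-- Smooth loops, parametrized by `ℝ / ℤ`, in the fibre of `π` over `b`. -/
structure IsFibreLoop (π : X → B) (b : B) (γ : ℝ → X) : Prop where
  smooth : ContMDiff 𝓘(ℝ, ℝ) (𝓡 (2 * N)) ∞ γ
  periodic : Function.Periodic γ 1
  vertical : ∀ s, π (γ s) = b

/-- The identification `TB ≃ R¹π_*ℝ ⊗ C^∞`. A tangent vector `V` at `b` gives the closed
1-form `u ↦ (1 / 2π) ω (u, Ṽ)` on the fibre over `b`, where `Ṽ` is any lift of `V`, and thereby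
a cohomology class, which is known through its pairing with loops `γ` in the fibre. If
`ω = ∑ dφᵢ ∧ dIᵢ` in action-angle coordinates, then `∂/∂Iᵢ` goes to the class of `dφᵢ / 2π`. -/
def period (ωX : TwoForm (𝓡 (2 * N)) X) (π : X → B) (V : TangentBundle (𝓡 N) B)
    (γ : ℝ → X) : ℝ :=
  (1 / (2 * Real.pi)) * ∫ s in (0 : ℝ)..1,
    ωX (γ s) ![mfderiv 𝓘(ℝ, ℝ) (𝓡 (2 * N)) γ s (1 : ℝ), liftAt π V (γ s)]

/-- A smooth one-parameter family `Γ t` of loops in the fibres of `π` over the points of the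
curve `t ↦ π (Γ t 0)`. The homology classes of the `Γ t` form a locally constant section, along
this curve, of the local system with stalks `H₁(F_b, ℤ)` (the period lattice). -/
structure IsFibreLoopFamily (π : X → B) (Γ : ℝ → ℝ → X) : Prop where
  smooth : ContMDiff 𝓘(ℝ, ℝ × ℝ) (𝓡 (2 * N)) ∞ (fun p : ℝ × ℝ => Γ p.1 p.2)
  periodic : ∀ t, Function.Periodic (Γ t) 1
  vertical : ∀ t s, π (Γ t s) = π (Γ t 0)

/-- `w` is the Gauss–Manin derivative at `b`, in the direction `u`, of the vector field `v`.
Vector fields are seen as sections of `R¹π_*ℝ ⊗ C^∞` (see `period`), and the connection is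
characterized by `d ⟨v, Γ⟩ = ⟨∇ v, Γ⟩` for the locally constant sections `Γ` of the dual local
system; so `∇` vanishes on the sections of `R¹π_*ℝ`. -/
def IsGaussManinDeriv (ωX : TwoForm (𝓡 (2 * N)) X) (π : X → B)
    (v : (b : B) → TangentSpace (𝓡 N) b) (b : B) (u w : TangentSpace (𝓡 N) b) : Prop :=
  ∀ Γ : ℝ → ℝ → X, IsFibreLoopFamily (N := N) π Γ →
    tangentMap 𝓘(ℝ, ℝ) (𝓡 N) (fun t => π (Γ t 0))
      (⟨0, (1 : ℝ)⟩ : TangentBundle 𝓘(ℝ, ℝ) ℝ) = (⟨b, u⟩ : TangentBundle (𝓡 N) B) →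
    HasDerivAt (fun t => period ωX π ⟨π (Γ t 0), v (π (Γ t 0))⟩ (Γ t))
      (period ωX π ⟨b, w⟩ (Γ 0)) 0

open Classical in
/-- The Gauss–Manin connection `(∇_u v)(b)` on `TB`, for vector fields `v` that are
differentiable at `b` (for such `v` the derivative exists and is unique when `π` is an
integrable system). -/
def gaussManin (ωX : TwoForm (𝓡 (2 * N)) X) (π : X → B)
    (v : (b : B) → TangentSpace (𝓡 N) b) (b : B) (u : TangentSpace (𝓡 N) b) :
    TangentSpace (𝓡 N) b :=
  if h : ∃ w, IsGaussManinDeriv ωX π v b u w then h.choose else 0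

/-- Vector fields on `B` that are smooth on a neighbourhood of `b`. -/
def IsSmoothNear (v : (b : B) → TangentSpace (𝓡 N) b) (b : B) : Prop :=
  ∃ O : Set B, IsOpen O ∧ b ∈ O ∧
    ContMDiffOn (𝓡 N) (𝓡 N).tangent ∞ (fun b' => (⟨b', v b'⟩ : TangentBundle (𝓡 N) B)) O

/-- `∇ α = 0` on `U` for the Gauss–Manin connection and a 1-form `α` on `B`. -/
def IsParallelOneFormOn (ωX : TwoForm (𝓡 (2 * N)) X) (π : X → B) (α : OneForm (𝓡 N) B)
    (U : Set B) : Prop :=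
  ∀ b ∈ U, ∀ v : (b : B) → TangentSpace (𝓡 N) b, IsSmoothNear v b →
    ∀ u : TangentSpace (𝓡 N) b,
      mvfderiv (𝓡 N) (fun b' => α b' (v b')) b u = α b (gaussManin ωX π v b u)

/-- `∇ Ω = 0` for the Gauss–Manin connection and a 2-form `Ω` on `B`. -/
def IsParallelTwoForm (ωX : TwoForm (𝓡 (2 * N)) X) (π : X → B) (Ω : TwoForm (𝓡 N) B) : Prop :=
  ∀ b, ∀ v w : (b : B) → TangentSpace (𝓡 N) b, IsSmoothNear v b → IsSmoothNear w b →
    ∀ u : TangentSpace (𝓡 N) b,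
      mvfderiv (𝓡 N) (fun b' => Ω b' ![v b', w b']) b u =
        Ω b ![gaussManin ωX π v b u, w b] + Ω b ![v b, gaussManin ωX π w b u]

/-- Two tangent vectors at the same point `b` are identified if their classes in
`H¹(F_b, ℝ)` (see `period`) differ by an integral class. -/
def integralSetoid (ωX : TwoForm (𝓡 (2 * N)) X) (π : X → B) :
    Setoid (TangentBundle (𝓡 N) B) where
  r V V' := V.proj = V'.proj ∧
    ∀ γ, IsFibreLoop (N := N) π V.proj γ → ∃ k : ℤ, period ωX π V γ - period ωX π V' γ = k
  iseqv :=
    { refl := fun V => ⟨rfl, fun γ _ => ⟨0, by simp⟩⟩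
      symm := fun {V V'} h => ⟨h.1.symm, fun γ hγ => by
        obtain ⟨k, hk⟩ := h.2 γ (h.1 ▸ hγ)
        exact ⟨-k, by push_cast; linarith⟩⟩
      trans := fun {V V' V''} h h' => ⟨h.1.trans h'.1, fun γ hγ => by
        obtain ⟨k, hk⟩ := h.2 γ hγ
        obtain ⟨l, hl⟩ := h'.2 γ (h.1 ▸ hγ)
        exact ⟨k + l, by push_cast; linarith⟩⟩ }

/-- The total space of the dual fibration `R¹π_*ℝ / R¹π_*ℤ`, as a quotient of
`TB ≃ R¹π_*ℝ ⊗ C^∞`; the fibre over `b` is `H¹(F_b, ℝ) / H¹(F_b, ℤ)`. -/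
def DualFibration (ωX : TwoForm (𝓡 (2 * N)) X) (π : X → B) : Type _ :=
  Quotient (integralSetoid ωX π)

instance (ωX : TwoForm (𝓡 (2 * N)) X) (π : X → B) : TopologicalSpace (DualFibration ωX π) :=
  inferInstanceAs (TopologicalSpace (Quotient (integralSetoid ωX π)))

/-- The quotient map `TB → X̂`. -/
def DualFibration.mk (ωX : TwoForm (𝓡 (2 * N)) X) (π : X → B) (V : TangentBundle (𝓡 N) B) :
    DualFibration ωX π :=
  Quotient.mk (integralSetoid ωX π) V

/-- The projection `X̂ → B`. -/
def DualFibration.proj (ωX : TwoForm (𝓡 (2 * N)) X) (π : X → B) : DualFibration ωX π → B :=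
  Quotient.lift (fun V : TangentBundle (𝓡 N) B => V.proj) (fun _ _ h => And.left h)

variable {n : ℕ}

/-- `(x, y)` are coordinates on the open set `U` which are flat for the Gauss–Manin connection
and in which `Ω = ∑ dxᵢ ∧ dyᵢ`. -/
structure IsFlatDarbouxOn (ωX : TwoForm (𝓡 (2 * N)) X) (π : X → B) (Ω : TwoForm (𝓡 N) B)
    (U : Set B) (x y : Fin n → B → ℝ) : Prop where
  smooth_x : ∀ i, ContMDiffOn (𝓡 N) 𝓘(ℝ, ℝ) ∞ (x i) U
  smooth_y : ∀ i, ContMDiffOn (𝓡 N) 𝓘(ℝ, ℝ) ∞ (y i) U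
  injOn : Set.InjOn (fun b => ((fun i => x i b), (fun i => y i b))) U
  flat_x : ∀ i, IsParallelOneFormOn ωX π (fun b => mvfderiv (𝓡 N) (x i) b) U
  flat_y : ∀ i, IsParallelOneFormOn ωX π (fun b => mvfderiv (𝓡 N) (y i) b) U
  darboux : ∀ b ∈ U, Ω b = ∑ i, wedge (mvfderiv (𝓡 N) (x i) b) (mvfderiv (𝓡 N) (y i) b)

/-- `dx` for the function `x ∘ π` on `X`. -/
abbrev pullbackX (π : X → B) (x : B → ℝ) : OneForm (𝓡 (2 * N)) X :=
  fun z => mvfderiv (𝓡 (2 * N)) (fun z => x (π z)) z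

/-- `ω = ∑ dpᵢ ∧ dxᵢ + dqᵢ ∧ dyᵢ` -/
def omegaForm (π : X → B) (x y : Fin n → B → ℝ) (dp dq : Fin n → OneForm (𝓡 (2 * N)) X) :
    TwoForm (𝓡 (2 * N)) X := fun z =>
  ∑ i, (wedge (dp i z) (pullbackX π (x i) z) + wedge (dq i z) (pullbackX π (y i) z))

/-- `χ = ∑ -dpᵢ ∧ dqᵢ + dxᵢ ∧ dyᵢ` -/
def chiForm (π : X → B) (x y : Fin n → B → ℝ) (dp dq : Fin n → OneForm (𝓡 (2 * N)) X) :
    TwoForm (𝓡 (2 * N)) X := fun z =>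
  ∑ i, (-wedge (dp i z) (dq i z) + wedge (pullbackX π (x i) z) (pullbackX π (y i) z))

/-- `σ = ∑ dqᵢ ∧ dxᵢ + dyᵢ ∧ dpᵢ` -/
def sigmaForm (π : X → B) (x y : Fin n → B → ℝ) (dp dq : Fin n → OneForm (𝓡 (2 * N)) X) :
    TwoForm (𝓡 (2 * N)) X := fun z =>
  ∑ i, (wedge (dq i z) (pullbackX π (x i) z) + wedge (pullbackX π (y i) z) (dp i z))

section Dual

variable (ωX : TwoForm (𝓡 (2 * N)) X) (π : X → B)
  [ChartedSpace (ModelProd (EuclideanSpace ℝ (Fin N)) (EuclideanSpace ℝ (Fin N)))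
    (DualFibration ωX π)]

/-- `dx` for the function `x ∘ π̂` on `X̂`. -/
abbrev pullbackDual (x : B → ℝ) : OneForm (𝓡 N).tangent (DualFibration ωX π) :=
  fun z => mvfderiv (𝓡 N).tangent (fun z => x (DualFibration.proj ωX π z)) z

/-- `dP` is, over `U`, the differential of the multivalued fibre coordinate `P` on `X̂` dual to
the flat coordinate `x`: its pull-back to `TB` is the differential of the function
`(b, v) ↦ dx_b v`. -/
def IsDualFibreDifferential (U : Set B) (x : B → ℝ)
    (dP : OneForm (𝓡 N).tangent (DualFibration ωX π)) : Prop :=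
  ∀ V : TangentBundle (𝓡 N) B, V.proj ∈ U →
    (dP (DualFibration.mk ωX π V)).comp
        (mfderiv (𝓡 N).tangent (𝓡 N).tangent (DualFibration.mk ωX π) V) =
      mvfderiv (𝓡 N).tangent (fun V' : TangentBundle (𝓡 N) B => mvfderiv (𝓡 N) x V'.proj V'.snd) V

/-- In the coordinates `(x, y, P, Q)`,
`J = ∑ dxᵢ ⊗ ∂/∂Pᵢ - dPᵢ ⊗ ∂/∂xᵢ + dyᵢ ⊗ ∂/∂Qᵢ - dQᵢ ⊗ ∂/∂yᵢ`. -/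
def IsJOmegaOn (U : Set B) (x y : Fin n → B → ℝ)
    (dP dQ : Fin n → OneForm (𝓡 N).tangent (DualFibration ωX π))
    (J : EndField (𝓡 N).tangent (DualFibration ωX π)) : Prop :=
  ∀ z, DualFibration.proj ωX π z ∈ U → ∀ i,
    (pullbackDual ωX π (x i) z).comp (J z) = -dP i z ∧
    (dP i z).comp (J z) = pullbackDual ωX π (x i) z ∧
    (pullbackDual ωX π (y i) z).comp (J z) = -dQ i z ∧
    (dQ i z).comp (J z) = pullbackDual ωX π (y i) z

/-- In the coordinates `(x, y, P, Q)`,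
`J = ∑ -dPᵢ ⊗ ∂/∂Qᵢ + dQᵢ ⊗ ∂/∂Pᵢ + dxᵢ ⊗ ∂/∂yᵢ - dyᵢ ⊗ ∂/∂xᵢ`. -/
def IsJChiOn (U : Set B) (x y : Fin n → B → ℝ)
    (dP dQ : Fin n → OneForm (𝓡 N).tangent (DualFibration ωX π))
    (J : EndField (𝓡 N).tangent (DualFibration ωX π)) : Prop :=
  ∀ z, DualFibration.proj ωX π z ∈ U → ∀ i,
    (dQ i z).comp (J z) = -dP i z ∧
    (dP i z).comp (J z) = dQ i z ∧
    (pullbackDual ωX π (y i) z).comp (J z) = pullbackDual ωX π (x i) z ∧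
    (pullbackDual ωX π (x i) z).comp (J z) = -pullbackDual ωX π (y i) z

end Dual

end Fibration

end IntegrableSystem

end

/-!
The proof rests on the Arnold-Liouville theorem, in a form which also describes the periods, and
on two comparisons with linear models.

*Momenta.* In coordinates `x` of the base, the Poincaré lemma with parameters shows that locally
`ω = ∑ dpᵢ ∧ dxᵢ` (`exists_momenta`, `exists_momentumChart`), because the fibres are Lagrangian. The
momenta `p` are coordinates on the fibres, and are unique up to the components of a closed 1-form
of the base (`IsMomentum.exists_gradient`). The translations in the momenta are the flows of the
Hamiltonian vector fields of the functions `xᵢ ∘ π`. Since the fibres are compact, there are momentum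
charts of uniform size near a fibre (`exists_momentumBoxes`), so these local translations generate
an action of a vector group along the fibres (`exists_isFibreAction`), without any recourse to the
theory of flows.

*Period lattices.* The action is transitive on the fibres as these are connected; the stabilizers are
discrete, and span because the fibres are compact (`IsFibreAction.span_lattice`). The periods of a
tangent vector over the loops in a fibre are its pairings with the elements of the lattice
(`IsFibreAction.period_orbit`, `IsFibreAction.exists_period_eq`). Elements of the lattice extend to
closed 1-forms with values in the lattices of the nearby fibres
(`IsFibreAction.exists_gradient_sub_mem`). The primitives of a basis of such forms are new
coordinates, for which the lattices contain the standard lattice; such lattices are locally constant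
(`IsFibreAction.eventually_lattice_eq`). This gives flat charts (`exists_isFlatChart`). It is not
necessary that the lattice be the standard one: only its constancy is used.

*Flat coordinates.* In a flat chart, the periods are pairings with constant vectors, so the
Gauss-Manin connection is the componentwise derivative (`IsFlatChart.baseDeriv_gaussManin`), a
parallel 2-form has constant coefficients, and a symplectic basis of the coordinate space gives flat
Darboux coordinates `(x, y)` (`IsFlatChart.exists_darboux`); in particular `N = 2n`.

*The hyper-symplectic structure.* The momenta near a point of a fibre are transported by the action
from a section over the chart. The choice of the element of the group is unique up to the lattice,
and as the lattice is constant, the differentials `dp`, `dq` do not depend on it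
(`IsFlatChart.exists_momentumForm`). In the coordinates `(x, y, p, q)` the three forms are constant,
and all assertions are linear algebra in the space `QuaternionicSpace n`
(`isHyperSymplecticOn_of_model`).

*The dual fibration.* In a flat chart, two tangent vectors are identified if the difference of their
components is in `2π` times the dual of the constant lattice `Λ` (`IsFlatChart.mk_eq_iff`). The
translations by such vectors are deck transformations, so that the quotient is a manifold
(`exists_manifold_of_isLocalHomeomorph`, `DualFibration.exists_manifold`), and the coordinates
`(x, y, P, Q)` of the tangent bundle are well defined up to constants on the quotient
(`IsFlatChart.exists_dualCoordinates`). In these coordinates the endomorphisms are constant, hence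
integrable (`isComplexStructureOn_of_model`), and the quaternionic relations are a computation with
signed permutations of the four blocks (`IsFlatChart.exists_hypercomplex`).
-/

open Set Filter Topology

namespace IntegrableSystem

/-! ### Integrals depending on a parameter -/

section ParametricIntegral

variable {V : Type*} [NormedAddCommGroup V] [NormedSpace ℝ V]

/-- An integral over `[0, 1]` is continuous at a parameter if the integrand is continuous near the
corresponding segment. -/
theorem continuousAt_intervalIntegral_param {X F : Type*} [TopologicalSpace X]
    [FirstCountableTopology X] [NormedAddCommGroup F] [NormedSpace ℝ F]
    {f : ℝ × X → F} {x₀ : X} (hf : ∀ t ∈ Icc (0 : ℝ) 1, ∀ᶠ q in 𝓝 (t, x₀), ContinuousAt f q) :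
    ContinuousAt (fun x => ∫ t in (0 : ℝ)..1, f (t, x)) x₀ := by
  obtain ⟨u, v, hu, hv, hIu, hxv, huv⟩ := generalized_tube_lemma (s := Icc (0 : ℝ) 1)
    isCompact_Icc (t := {x₀}) isCompact_singleton
    (n := interior {q | ContinuousAt f q ∧ ‖f q‖ < ‖f q‖ + 1}) isOpen_interior (by
      rintro ⟨t, x⟩ ⟨ht, rfl⟩
      rw [mem_interior_iff_mem_nhds]
      filter_upwards [hf t ht] with q hq using ⟨hq, by simp⟩)
  have hcont : ∀ x ∈ v, ContinuousOn (fun t => f (t, x)) (Icc (0 : ℝ) 1) := fun x hx t ht =>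
    ((interior_subset (huv (mk_mem_prod (hIu ht) hx))).1.comp
      (f := fun t => (t, x)) (by fun_prop)).continuousWithinAt
  have hbd : ∃ C, ∀ᶠ x in 𝓝 x₀, ∀ t ∈ Icc (0 : ℝ) 1, ‖f (t, x)‖ ≤ C := by
    obtain ⟨C, hC⟩ := isCompact_Icc.exists_bound_of_continuousOn (hcont x₀ (hxv rfl))
    obtain ⟨u', v', hu', hv', hIu', hxv', huv'⟩ := generalized_tube_lemma (s := Icc (0 : ℝ) 1)
      isCompact_Icc (t := {x₀}) isCompact_singleton
      (n := interior {q | ‖f q‖ < C + 1}) isOpen_interior (by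
        rintro ⟨t, x⟩ ⟨ht, rfl⟩
        rw [mem_interior_iff_mem_nhds]
        have h1 : ContinuousAt f (t, x) := (hf t ht).self_of_nhds
        exact h1.norm.eventually_lt continuousAt_const
          (lt_of_le_of_lt (hC t ht) (by linarith)))
    refine ⟨C + 1, ?_⟩
    filter_upwards [hv'.mem_nhds (hxv' rfl)] with x hx t ht
    have h1 := interior_subset (huv' (mk_mem_prod (hIu' ht) hx))
    exact le_of_lt h1
  obtain ⟨C, hC⟩ := hbd
  refine intervalIntegral.continuousAt_of_dominated_interval (bound := fun _ => C) ?_ ?_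
    (by simp) ?_
  · filter_upwards [hv.mem_nhds (hxv rfl)] with x hx
    rw [uIoc_of_le zero_le_one]
    exact ((hcont x hx).mono Ioc_subset_Icc_self).aestronglyMeasurable measurableSet_Ioc
  · filter_upwards [hC] with x hx
    refine Eventually.of_forall fun t ht => hx t ?_
    rw [uIoc_of_le zero_le_one] at ht
    exact Ioc_subset_Icc_self ht
  · refine Eventually.of_forall fun t ht => ?_
    rw [uIoc_of_le zero_le_one] at ht
    exact (hf t (Ioc_subset_Icc_self ht)).self_of_nhds.comp
      (f := fun x => (t, x)) (by fun_prop)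

/-- The derivative of an integral over `[0, 1]` with respect to a parameter. -/
theorem hasFDerivAt_intervalIntegral_param {F : Type*} [NormedAddCommGroup F] [NormedSpace ℝ F]
    {f : ℝ × V → F} {x₀ : V} (hf : ∀ t ∈ Icc (0 : ℝ) 1, ContDiffAt ℝ 1 f (t, x₀)) :
    HasFDerivAt (fun x => ∫ t in (0 : ℝ)..1, f (t, x))
      (∫ t in (0 : ℝ)..1, (fderiv ℝ f (t, x₀)).comp (ContinuousLinearMap.inr ℝ ℝ V)) x₀ := by
  have hev : ∀ t ∈ Icc (0 : ℝ) 1, ∀ᶠ q in 𝓝 (t, x₀), ContDiffAt ℝ 1 f q := fun t ht =>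
    (hf t ht).eventually (by simp)
  have hfd : ∀ t ∈ Icc (0 : ℝ) 1, ContinuousAt (fderiv ℝ f) (t, x₀) := fun t ht =>
    ((hf t ht).fderiv_right (m := 0) (by simp)).continuousAt
  obtain ⟨C, hC⟩ := isCompact_Icc.exists_bound_of_continuousOn
    (s := Icc (0 : ℝ) 1) (f := fun t => fderiv ℝ f (t, x₀)) (fun t ht =>
      ((hfd t ht).comp (f := fun t => (t, x₀)) (by fun_prop)).continuousWithinAt)
  obtain ⟨u, v, hu, hv, hIu, hxv, huv⟩ := generalized_tube_lemma (s := Icc (0 : ℝ) 1)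
    isCompact_Icc (t := {x₀}) isCompact_singleton
    (n := interior {q | ContDiffAt ℝ 1 f q ∧ ‖fderiv ℝ f q‖ < C + 1}) isOpen_interior (by
      rintro ⟨t, x⟩ ⟨ht, rfl⟩
      rw [mem_interior_iff_mem_nhds]
      filter_upwards [hev t ht, (hfd t ht).norm.eventually_lt continuousAt_const
          (lt_of_le_of_lt (hC t ht) (by linarith : C < C + 1))] with q hq hq' using ⟨hq, hq'⟩)
  have key : ∀ x ∈ v, ∀ t ∈ Icc (0 : ℝ) 1,
      ContDiffAt ℝ 1 f (t, x) ∧ ‖fderiv ℝ f (t, x)‖ < C + 1 := fun x hx t ht => by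
    have h1 := interior_subset (huv (mk_mem_prod (hIu ht) hx))
    exact h1
  have hcont : ∀ x ∈ v, ContinuousOn (fun t => f (t, x)) (Icc (0 : ℝ) 1) := fun x hx t ht =>
    ((key x hx t ht).1.continuousAt.comp (f := fun t => (t, x)) (by fun_prop)).continuousWithinAt
  have hx₀ : x₀ ∈ v := hxv rfl
  refine intervalIntegral.hasFDerivAt_integral_of_dominated_of_fderiv_le
    (F' := fun x t => (fderiv ℝ f (t, x)).comp (ContinuousLinearMap.inr ℝ ℝ V))
    (bound := fun _ => (C + 1) * ‖ContinuousLinearMap.inr ℝ ℝ V‖)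
    (hv.mem_nhds hx₀) ?_ ?_ ?_ ?_ (by simp) ?_
  · filter_upwards [hv.mem_nhds hx₀] with x hx
    rw [uIoc_of_le zero_le_one]
    exact ((hcont x hx).mono Ioc_subset_Icc_self).aestronglyMeasurable measurableSet_Ioc
  · exact ContinuousOn.intervalIntegrable (by rw [uIcc_of_le zero_le_one]; exact hcont x₀ hx₀)
  · rw [uIoc_of_le zero_le_one]
    refine ContinuousOn.aestronglyMeasurable ?_ measurableSet_Ioc
    intro t ht
    have h1 : ContinuousAt (fun t => fderiv ℝ f (t, x₀)) t :=
      (hfd t (Ioc_subset_Icc_self ht)).comp (f := fun t => (t, x₀)) (by fun_prop)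
    exact (h1.clm_comp continuousAt_const).continuousWithinAt
  · refine Eventually.of_forall fun t ht x hx => ?_
    rw [uIoc_of_le zero_le_one] at ht
    exact (ContinuousLinearMap.opNorm_comp_le _ _).trans (by
      gcongr; exact (key x hx t (Ioc_subset_Icc_self ht)).2.le)
  · refine Eventually.of_forall fun t ht x hx => ?_
    rw [uIoc_of_le zero_le_one] at ht
    exact (((key x hx t (Ioc_subset_Icc_self ht)).1.differentiableAt
      one_ne_zero).hasFDerivAt.comp x (hasFDerivAt_prodMk_right t x))

/-- Differentiation under the integral sign: the integral over `[0, 1]` of a smooth family of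
smooth functions is smooth. -/
theorem contDiffOn_intervalIntegral_param {V F : Type*} [NormedAddCommGroup V]
    [NormedSpace ℝ V] [FiniteDimensional ℝ V] [NormedAddCommGroup F] [NormedSpace ℝ F]
    [CompleteSpace F] {f : ℝ × V → F} {s : Set V} (hs : IsOpen s)
    (hf : ∀ x ∈ s, ∀ t ∈ Icc (0 : ℝ) 1, ContDiffAt ℝ ∞ f (t, x)) :
    ContDiffOn ℝ ∞ (fun x => ∫ t in (0 : ℝ)..1, f (t, x)) s := by
  suffices H : ∀ n : ℕ, ∀ f : ℝ × V → F, (∀ x ∈ s, ∀ t ∈ Icc (0 : ℝ) 1, ContDiffAt ℝ ∞ f (t, x)) →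
      ContDiffOn ℝ n (fun x => ∫ t in (0 : ℝ)..1, f (t, x)) s from
    contDiffOn_infty.2 fun n => H n f hf
  intro n
  induction n with
  | zero =>
    intro f hf
    rw [Nat.cast_zero, contDiffOn_zero]
    intro x hx
    refine (continuousAt_intervalIntegral_param fun t ht => ?_).continuousWithinAt
    have h1 : ContDiffAt ℝ 1 f (t, x) := (hf x hx t ht).of_le (by simp)
    filter_upwards [h1.eventually (by simp)] with q hq using hq.continuousAt
  | succ n ih =>
    intro f hf
    have hder : ∀ x ∈ s, HasFDerivAt (fun x => ∫ t in (0 : ℝ)..1, f (t, x))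
        (∫ t in (0 : ℝ)..1, (fderiv ℝ f (t, x)).comp (ContinuousLinearMap.inr ℝ ℝ V)) x :=
      fun x hx => hasFDerivAt_intervalIntegral_param fun t ht => (hf x hx t ht).of_le (by simp)
    rw [Nat.cast_succ, contDiffOn_succ_iff_fderiv_of_isOpen hs]
    refine ⟨fun x hx => (hder x hx).differentiableAt.differentiableWithinAt, by simp, ?_⟩
    refine contDiffOn_clm_apply.2 fun y => ?_
    refine ContDiffOn.congr (f := fun x => ∫ t in (0 : ℝ)..1, fderiv ℝ f (t, x) (0, y)) ?_ ?_
    · refine ih (fun q => fderiv ℝ f q (0, y)) fun x hx t ht => ?_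
      exact ((hf x hx t ht).fderiv_right (m := ∞) (by simp)).clm_apply contDiffAt_const
    · intro x hx
      rw [(hder x hx).fderiv, ContinuousLinearMap.intervalIntegral_apply]
      · simp
      · refine ContinuousOn.intervalIntegrable ?_
        rw [uIcc_of_le zero_le_one]
        intro t ht
        have h1 : ContinuousAt (fderiv ℝ f) (t, x) :=
          ((hf x hx t ht).fderiv_right (m := 0) (by simp)).continuousAt
        have h2 : ContinuousAt (fun t => fderiv ℝ f (t, x)) t :=
          h1.comp (f := fun t => (t, x)) (by fun_prop)
        exact (h2.clm_comp continuousAt_const).continuousWithinAt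

end ParametricIntegral

/-! ### 2-forms on vector spaces and the Poincaré lemma -/

section TwoFormsOnVectorSpaces

variable {V : Type*} [NormedAddCommGroup V] [NormedSpace ℝ V] [FiniteDimensional ℝ V]

theorem alternating_add_left {V : Type*} [AddCommGroup V] [Module ℝ V] [TopologicalSpace V]
    (η : V [⋀^Fin 2]→L[ℝ] ℝ) (a a' b : V) : η ![a + a', b] = η ![a, b] + η ![a', b] := by
  have e : ∀ x, Function.update ![0, b] 0 x = ![x, b] := fun x => by
    ext i; fin_cases i <;> simp
  rw [← e (a + a'), ← e a, ← e a']
  exact η.map_update_add _ _ _ _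

theorem alternating_smul_left {V : Type*} [AddCommGroup V] [Module ℝ V] [TopologicalSpace V]
    (η : V [⋀^Fin 2]→L[ℝ] ℝ) (c : ℝ) (a b : V) : η ![c • a, b] = c * η ![a, b] := by
  have e : ∀ x, Function.update ![0, b] 0 x = ![x, b] := fun x => by
    ext i; fin_cases i <;> simp
  rw [← e (c • a), ← e a]
  exact η.map_update_smul _ _ _ _

theorem alternating_swap {V : Type*} [AddCommGroup V] [Module ℝ V] [TopologicalSpace V]
    (η : V [⋀^Fin 2]→L[ℝ] ℝ) (a b : V) : η ![a, b] = -η ![b, a] := by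
  have h := η.map_swap ![b, a] (i := 0) (j := 1) (by decide)
  have e : (![b, a] ∘ (Equiv.swap (0 : Fin 2) 1)) = ![a, b] := by
    ext i; fin_cases i <;> simp
  rw [e] at h
  exact h

theorem alternating_add_right {V : Type*} [AddCommGroup V] [Module ℝ V] [TopologicalSpace V]
    (η : V [⋀^Fin 2]→L[ℝ] ℝ) (a b b' : V) : η ![a, b + b'] = η ![a, b] + η ![a, b'] := by
  rw [alternating_swap, alternating_add_left, alternating_swap η a b, alternating_swap η a b']
  ring

theorem alternating_smul_right {V : Type*} [AddCommGroup V] [Module ℝ V] [TopologicalSpace V]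
    (η : V [⋀^Fin 2]→L[ℝ] ℝ) (c : ℝ) (a b : V) : η ![a, c • b] = c * η ![a, b] := by
  rw [alternating_swap, alternating_smul_left, alternating_swap η a b]
  ring

/-- The bilinear map `a, b ↦ η ![a, b]` underlying an alternating 2-form on a finite-dimensional
space, as a continuous map. -/
noncomputable def toBilin (η : V [⋀^Fin 2]→L[ℝ] ℝ) : V →L[ℝ] V →L[ℝ] ℝ :=
  LinearMap.toContinuousLinearMap
    { toFun := fun a => LinearMap.toContinuousLinearMap
        { toFun := fun b => η ![a, b]
          map_add' := alternating_add_right η a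
          map_smul' := fun c b => alternating_smul_right η c a b }
      map_add' := fun a a' => by
        ext b
        exact alternating_add_left η a a' b
      map_smul' := fun c a => by
        ext b
        exact alternating_smul_left η c a b }

@[simp] theorem toBilin_apply (η : V [⋀^Fin 2]→L[ℝ] ℝ) (a b : V) :
    toBilin η a b = η ![a, b] := rfl

theorem toBilin_swap (η : V [⋀^Fin 2]→L[ℝ] ℝ) (a b : V) : toBilin η a b = -toBilin η b a :=
  alternating_swap η a b

/-- The expansion of a 2-form in a basis. -/
theorem eq_sum_wedge {ι : Type*} [Fintype ι] (e : Module.Basis ι ℝ V) (η : V [⋀^Fin 2]→L[ℝ] ℝ) :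
    η = ∑ i, ∑ j, (η ![e i, e j] / 2) •
      wedge (LinearMap.toContinuousLinearMap (e.coord i))
        (LinearMap.toContinuousLinearMap (e.coord j)) := by
  have hB : ∀ a b : V, toBilin η a b = ∑ i, ∑ j, e.coord i a * e.coord j b * η ![e i, e j] := by
    intro a b
    conv_lhs => rw [← e.sum_repr a, ← e.sum_repr b]
    simp only [map_sum, map_smul, sum_apply, smul_apply,
      smul_eq_mul, toBilin_apply, Finset.mul_sum, Module.Basis.coord_apply]
    rw [Finset.sum_comm]
    exact Finset.sum_congr rfl fun i _ => Finset.sum_congr rfl fun j _ => by ring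
  ext v
  have hv : v = ![v 0, v 1] := by ext i; fin_cases i <;> rfl
  have h1 : η v = (toBilin η (v 0) (v 1) - toBilin η (v 1) (v 0)) / 2 := by
    rw [toBilin_swap η (v 1) (v 0), toBilin_apply, ← hv]; ring
  rw [h1, hB, hB, ← Finset.sum_sub_distrib, Finset.sum_div,
    ContinuousAlternatingMap.sum_apply]
  refine Finset.sum_congr rfl fun i _ => ?_
  rw [← Finset.sum_sub_distrib, Finset.sum_div, ContinuousAlternatingMap.sum_apply]
  refine Finset.sum_congr rfl fun j _ => ?_
  rw [ContinuousAlternatingMap.smul_apply, wedge_apply]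
  simp only [LinearMap.coe_toContinuousLinearMap', smul_eq_mul]
  ring

variable {D : Type*} [NormedAddCommGroup D] [NormedSpace ℝ D] {n : WithTop ℕ∞} {s : Set D}

theorem contDiffOn_toBilin {η : D → V [⋀^Fin 2]→L[ℝ] ℝ} (hη : ContDiffOn ℝ n η s) :
    ContDiffOn ℝ n (fun x => toBilin (η x)) s := by
  refine contDiffOn_clm_apply.2 fun a => contDiffOn_clm_apply.2 fun b => ?_
  exact (ContinuousAlternatingMap.apply ℝ V ℝ ![a, b]).contDiff.comp_contDiffOn hη

/-- A field of 2-forms is smooth as soon as its values on constant vectors are. -/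
theorem contDiffOn_of_apply {η : D → V [⋀^Fin 2]→L[ℝ] ℝ}
    (hη : ∀ a b, ContDiffOn ℝ n (fun x => η x ![a, b]) s) : ContDiffOn ℝ n η s := by
  let e := Module.finBasis ℝ V
  refine ContDiffOn.congr ?_ fun x _ => eq_sum_wedge e (η x)
  exact ContDiffOn.sum fun i _ => ContDiffOn.sum fun j _ =>
    ((hη _ _).div_const 2).smul contDiffOn_const

omit [FiniteDimensional ℝ V] in
theorem extDeriv_two_apply {η : V → V [⋀^Fin 2]→L[ℝ] ℝ} {x : V} (h : DifferentiableAt ℝ η x)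
    (a b c : V) : extDeriv η x ![a, b, c] =
      fderiv ℝ (fun y => η y ![b, c]) x a - fderiv ℝ (fun y => η y ![a, c]) x b +
        fderiv ℝ (fun y => η y ![a, b]) x c := by
  have e0 : (0 : Fin 3).removeNth ![a, b, c] = ![b, c] := by ext i; fin_cases i <;> rfl
  have e1 : (1 : Fin 3).removeNth ![a, b, c] = ![a, c] := by ext i; fin_cases i <;> rfl
  have e2 : (2 : Fin 3).removeNth ![a, b, c] = ![a, b] := by ext i; fin_cases i <;> rfl
  rw [extDeriv_apply h, Fin.sum_univ_three, e0, e1, e2]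
  simp [sub_eq_add_neg]

theorem fderiv_toBilin_apply {η : V → V [⋀^Fin 2]→L[ℝ] ℝ} {x : V}
    (h : DifferentiableAt ℝ (fun y => toBilin (η y)) x) (a b c : V) :
    fderiv ℝ (fun y => η y ![b, c]) x a = fderiv ℝ (fun y => toBilin (η y)) x a b c := by
  have h2 : HasFDerivAt (fun y => toBilin (η y) b c) _ x :=
    ((h.hasFDerivAt.clm_apply (hasFDerivAt_const b x)).clm_apply (hasFDerivAt_const c x))
  have h3 := h2.fderiv
  simp only [toBilin_apply] at h3
  rw [h3]
  simp

/-- The Poincaré lemma for 2-forms on a star-shaped open set. -/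
theorem exists_primitive_of_extDeriv_eq_zero {η : V → V [⋀^Fin 2]→L[ℝ] ℝ} {s : Set V} {c : V}
    (hs : IsOpen s) (hsc : StarConvex ℝ c s) (hη : ContDiffOn ℝ ∞ η s)
    (hd : ∀ x ∈ s, extDeriv η x = 0) :
    ∃ l : V → V →L[ℝ] ℝ, ContDiffOn ℝ ∞ l s ∧
      ∀ x ∈ s, ∀ a b, η x ![a, b] = fderiv ℝ l x a b - fderiv ℝ l x b a := by
  obtain ⟨B, hBdef⟩ : ∃ B : V → V →L[ℝ] V →L[ℝ] ℝ, B = fun x => toBilin (η x) := ⟨_, rfl⟩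
  have hBa : ∀ y u v, B y u v = η y ![u, v] := fun y u v => by rw [hBdef]; rfl
  have hB : ∀ x ∈ s, ContDiffAt ℝ ∞ B x := fun x hx => by
    rw [hBdef]
    exact (contDiffOn_toBilin hη).contDiffAt (hs.mem_nhds hx)
  have hmem : ∀ x ∈ s, ∀ t ∈ Icc (0 : ℝ) 1, c + t • (x - c) ∈ s := fun x hx t ht =>
    hsc.add_smul_sub_mem hx ht.1 ht.2
  set f : ℝ × V → V →L[ℝ] ℝ := fun q => q.1 • B (c + q.1 • (q.2 - c)) (q.2 - c) with hf
  have hfc : ∀ x ∈ s, ∀ t ∈ Icc (0 : ℝ) 1, ContDiffAt ℝ ∞ f (t, x) := by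
    intro x hx t ht
    have h1 : ContDiffAt ℝ ∞ (fun q : ℝ × V => B (c + q.1 • (q.2 - c))) (t, x) :=
      ContDiffAt.comp (f := fun q : ℝ × V => c + q.1 • (q.2 - c)) (t, x)
        (hB _ (hmem x hx t ht)) (by fun_prop)
    exact (contDiffAt_fst).smul (h1.clm_apply (by fun_prop))
  refine ⟨fun x => ∫ t in (0 : ℝ)..1, f (t, x), contDiffOn_intervalIntegral_param hs hfc, ?_⟩
  intro x hx a b
  have hder := hasFDerivAt_intervalIntegral_param (x₀ := x) fun t ht =>
    (hfc x hx t ht).of_le (m := 1) (by simp)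
  have hcontf : ContinuousOn (fun t : ℝ => fderiv ℝ f (t, x)) (Icc 0 1) := fun t ht => by
    have h1 : ContinuousAt (fderiv ℝ f) (t, x) :=
      ((hfc x hx t ht).fderiv_right (m := 0) (by simp)).continuousAt
    exact (h1.comp (f := fun t => (t, x)) (by fun_prop)).continuousWithinAt
  have hint : ∀ a b : V, IntervalIntegrable (fun t => fderiv ℝ f (t, x) (0, a) b)
      MeasureTheory.volume 0 1 := fun a b => by
    refine ContinuousOn.intervalIntegrable ?_
    rw [uIcc_of_le zero_le_one]
    exact (hcontf.clm_apply continuousOn_const).clm_apply continuousOn_const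
  have happ : ∀ a b : V, fderiv ℝ (fun x => ∫ t in (0 : ℝ)..1, f (t, x)) x a b =
      ∫ t in (0 : ℝ)..1, fderiv ℝ f (t, x) (0, a) b := by
    intro a b
    rw [hder.fderiv, ContinuousLinearMap.intervalIntegral_apply,
      ContinuousLinearMap.intervalIntegral_apply]
    · simp
    · refine ContinuousOn.intervalIntegrable ?_
      rw [uIcc_of_le zero_le_one]
      exact (hcontf.clm_comp continuousOn_const).clm_apply continuousOn_const
    · refine ContinuousOn.intervalIntegrable ?_
      rw [uIcc_of_le zero_le_one]
      exact hcontf.clm_comp continuousOn_const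
  have hval : ∀ t ∈ Icc (0 : ℝ) 1, ∀ a b : V, fderiv ℝ f (t, x) (0, a) b =
      t * (t * fderiv ℝ B (c + t • (x - c)) a (x - c) b + B (c + t • (x - c)) a b) := by
    intro t ht a b
    have hBd : HasFDerivAt B (fderiv ℝ B (c + t • (x - c))) (c + t • (x - c)) :=
      ((hB _ (hmem x hx t ht)).differentiableAt (by simp)).hasFDerivAt
    have hy : HasFDerivAt (fun y : V => c + t • (y - c)) (t • ContinuousLinearMap.id ℝ V) x :=
      (((hasFDerivAt_id x).sub_const c).const_smul t).const_add c
    have h1 : HasFDerivAt (fun y => f (t, y)) _ x :=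
      ((HasFDerivAt.comp (g := B) x hBd hy).clm_apply ((hasFDerivAt_id x).sub_const c)).const_smul t
    have h2 : HasFDerivAt (fun y => f (t, y))
        ((fderiv ℝ f (t, x)).comp (ContinuousLinearMap.inr ℝ ℝ V)) x :=
      ((hfc x hx t ht).differentiableAt (by simp)).hasFDerivAt.comp x
        (hasFDerivAt_prodMk_right t x)
    have h3 := congrArg (fun L => L a b) (h2.unique h1)
    simp at h3
    rw [h3]
    simp
    ring
  have hclosed : ∀ y ∈ s, ∀ u v w : V, fderiv ℝ B y u v w - fderiv ℝ B y v u w +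
      fderiv ℝ B y w u v = 0 := by
    intro y hy u v w
    have hBy := (hB y hy).differentiableAt (by simp)
    rw [hBdef] at hBy
    have h1 := extDeriv_two_apply ((hη.contDiffAt (hs.mem_nhds hy)).differentiableAt (by simp))
      u v w
    rw [hd y hy, fderiv_toBilin_apply hBy, fderiv_toBilin_apply hBy,
      fderiv_toBilin_apply hBy, ← hBdef] at h1
    simpa using h1.symm
  have hswap : ∀ y u v, B y u v = - B y v u := fun y u v => by
    rw [hBa, hBa, alternating_swap]
  rw [happ, happ, ← intervalIntegral.integral_sub (hint a b) (hint b a)]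
  have hF : ∀ t ∈ uIcc (0 : ℝ) 1, HasDerivAt (fun t : ℝ => t ^ 2 * B (c + t • (x - c)) a b)
      (fderiv ℝ f (t, x) (0, a) b - fderiv ℝ f (t, x) (0, b) a) t := by
    intro t ht
    rw [uIcc_of_le zero_le_one] at ht
    have hBd : HasFDerivAt B (fderiv ℝ B (c + t • (x - c))) (c + t • (x - c)) :=
      ((hB _ (hmem x hx t ht)).differentiableAt (by simp)).hasFDerivAt
    have hy : HasDerivAt (fun t : ℝ => c + t • (x - c)) ((1 : ℝ) • (x - c)) t :=
      ((hasDerivAt_id t).smul_const (x - c)).const_add c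
    have h1 := HasFDerivAt.comp_hasDerivAt (l := B) t hBd hy
    have h2 := ((h1.clm_apply (hasDerivAt_const t a)).clm_apply (hasDerivAt_const t b))
    refine ((hasDerivAt_pow 2 t).mul h2).congr_deriv ?_
    have h3 := hclosed _ (hmem x hx t ht) (x - c) a b
    have h4 := hswap (c + t • (x - c)) a b
    rw [hval t ht, hval t ht]
    simp [-map_sub]
    linear_combination (t ^ 2) * h3 + t * h4
  rw [intervalIntegral.integral_eq_sub_of_hasDerivAt hF ((hint a b).sub (hint b a))]
  simp [hBa]

end TwoFormsOnVectorSpaces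

/-! ### Closed 2-forms with isotropic slices -/

section DarbouxCaratheodory

theorem two_le_infty : (2 : WithTop ℕ∞) ≤ ∞ :=
  WithTop.coe_le_coe.2 le_top

variable {N : ℕ}

/-- The vector representing, for the inner product, a linear form on Euclidean space. -/
noncomputable def dualVec (l : EuclideanSpace ℝ (Fin N) →L[ℝ] ℝ) : EuclideanSpace ℝ (Fin N) :=
  WithLp.toLp 2 fun i => l (EuclideanSpace.single i 1)

theorem inner_dualVec (l : EuclideanSpace ℝ (Fin N) →L[ℝ] ℝ) (v : EuclideanSpace ℝ (Fin N)) :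
    inner ℝ (dualVec l) v = l v := by
  have hv : v = ∑ i, v i • EuclideanSpace.single i (1 : ℝ) := by
    conv_lhs => rw [← (EuclideanSpace.basisFun (Fin N) ℝ).sum_repr v]
    simp
  conv_rhs => rw [hv, map_sum]
  simp [dualVec, PiLp.inner_apply]

theorem contDiffOn_dualVec {D : Type*} [NormedAddCommGroup D] [NormedSpace ℝ D] {s : Set D}
    {n : WithTop ℕ∞} {l : D → EuclideanSpace ℝ (Fin N) →L[ℝ] ℝ} (hl : ContDiffOn ℝ n l s) :
    ContDiffOn ℝ n (fun x => dualVec (l x)) s :=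
  contDiffOn_euclidean.2 fun _ => hl.clm_apply contDiffOn_const

local notation "𝔼" => EuclideanSpace ℝ (Fin N)

/-- A 1-form on `E × E` near `c` which is closed along the slices `E × {b}` is, along these slices,
the differential of a function which depends smoothly on all variables: the Poincaré lemma for
1-forms, with the base point as a parameter. -/
theorem exists_slice_primitive {l : 𝔼 × 𝔼 → 𝔼 × 𝔼 →L[ℝ] ℝ} {c : 𝔼 × 𝔼} {r : ℝ}
    (hl : ContDiffOn ℝ ∞ l (Metric.ball c r))
    (hsymm : ∀ x ∈ Metric.ball c r, ∀ h k : 𝔼,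
      fderiv ℝ l x (h, 0) (k, 0) = fderiv ℝ l x (k, 0) (h, 0)) :
    ∃ S : 𝔼 × 𝔼 → ℝ, ContDiffOn ℝ ∞ S (Metric.ball c r) ∧
      ∀ x ∈ Metric.ball c r, ∀ h : 𝔼, fderiv ℝ S x (h, 0) = l x (h, 0) := by
  set s := Metric.ball c r with hs
  have hso : IsOpen s := Metric.isOpen_ball
  have hlc : ∀ x ∈ s, ContDiffAt ℝ ∞ l x := fun x hx => hl.contDiffAt (hso.mem_nhds hx)
  have hmem : ∀ x ∈ s, ∀ t ∈ Icc (0 : ℝ) 1, (c.1 + t • (x.1 - c.1), x.2) ∈ s := by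
    intro x hx t ht
    rw [hs, Metric.mem_ball, Prod.dist_eq, max_lt_iff] at hx
    rw [hs, Metric.mem_ball, Prod.dist_eq, max_lt_iff]
    have hr : 0 < r := dist_nonneg.trans_lt hx.1
    exact ⟨((convex_ball c.1 r).starConvex (Metric.mem_ball_self hr)).add_smul_sub_mem
      (Metric.mem_ball.2 hx.1) ht.1 ht.2, hx.2⟩
  set f : ℝ × (𝔼 × 𝔼) → ℝ := fun q =>
    l (c.1 + q.1 • (q.2.1 - c.1), q.2.2) (q.2.1 - c.1, 0) with hf
  have hfc : ∀ x ∈ s, ∀ t ∈ Icc (0 : ℝ) 1, ContDiffAt ℝ ∞ f (t, x) := by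
    intro x hx t ht
    have h1 : ContDiffAt ℝ ∞ (fun q : ℝ × (𝔼 × 𝔼) => l (c.1 + q.1 • (q.2.1 - c.1), q.2.2))
        (t, x) :=
      ContDiffAt.comp (f := fun q : ℝ × (𝔼 × 𝔼) => (c.1 + q.1 • (q.2.1 - c.1), q.2.2)) (t, x)
        (hlc _ (hmem x hx t ht)) (by fun_prop)
    exact h1.clm_apply (by fun_prop)
  refine ⟨fun x => ∫ t in (0 : ℝ)..1, f (t, x), contDiffOn_intervalIntegral_param hso hfc, ?_⟩
  intro x hx h
  have hder := hasFDerivAt_intervalIntegral_param (x₀ := x) fun t ht =>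
    (hfc x hx t ht).of_le (m := 1) (by simp)
  have hcontf : ContinuousOn (fun t : ℝ => fderiv ℝ f (t, x)) (Icc 0 1) := fun t ht => by
    have h1 : ContinuousAt (fderiv ℝ f) (t, x) :=
      ((hfc x hx t ht).fderiv_right (m := 0) (by simp)).continuousAt
    exact (h1.comp (f := fun t => (t, x)) (by fun_prop)).continuousWithinAt
  have hint : IntervalIntegrable (fun t => fderiv ℝ f (t, x) (0, (h, 0)))
      MeasureTheory.volume 0 1 := by
    refine ContinuousOn.intervalIntegrable ?_
    rw [uIcc_of_le zero_le_one]
    exact hcontf.clm_apply continuousOn_const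
  rw [hder.fderiv, ContinuousLinearMap.intervalIntegral_apply]
  swap
  · refine ContinuousOn.intervalIntegrable ?_
    rw [uIcc_of_le zero_le_one]
    exact hcontf.clm_comp continuousOn_const
  have hF : ∀ t ∈ uIcc (0 : ℝ) 1,
      HasDerivAt (fun t : ℝ => t * l (c.1 + t • (x.1 - c.1), x.2) (h, 0))
        (fderiv ℝ f (t, x) (0, (h, 0))) t := by
    intro t ht
    rw [uIcc_of_le zero_le_one] at ht
    have hld : HasFDerivAt l (fderiv ℝ l (c.1 + t • (x.1 - c.1), x.2))
        (c.1 + t • (x.1 - c.1), x.2) :=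
      ((hlc _ (hmem x hx t ht)).differentiableAt (by simp)).hasFDerivAt
    have hy : HasDerivAt (fun t : ℝ => ((c.1 + t • (x.1 - c.1), x.2) : 𝔼 × 𝔼))
        ((1 : ℝ) • (x.1 - c.1), 0) t :=
      (((hasDerivAt_id t).smul_const (x.1 - c.1)).const_add c.1).prodMk (hasDerivAt_const t x.2)
    have h1 := HasFDerivAt.comp_hasDerivAt (l := l) t hld hy
    have h2 := (hasDerivAt_id t).mul (h1.clm_apply (hasDerivAt_const t ((h, 0) : 𝔼 × 𝔼)))
    refine h2.congr_deriv ?_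
    have hz : HasFDerivAt (fun y : 𝔼 × 𝔼 => ((c.1 + t • (y.1 - c.1), y.2) : 𝔼 × 𝔼))
        ((t • ContinuousLinearMap.fst ℝ 𝔼 𝔼).prod (ContinuousLinearMap.snd ℝ 𝔼 𝔼)) x :=
      (((hasFDerivAt_fst.sub_const c.1).const_smul t).const_add c.1).prodMk hasFDerivAt_snd
    have hw : HasFDerivAt (fun y : 𝔼 × 𝔼 => ((y.1 - c.1, 0) : 𝔼 × 𝔼))
        ((ContinuousLinearMap.fst ℝ 𝔼 𝔼).prod 0) x :=
      (hasFDerivAt_fst.sub_const c.1).prodMk (hasFDerivAt_const _ _)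
    have h3 : HasFDerivAt (fun y => f (t, y)) _ x :=
      (HasFDerivAt.comp (g := l) x hld hz).clm_apply hw
    have h4 : HasFDerivAt (fun y => f (t, y))
        ((fderiv ℝ f (t, x)).comp (ContinuousLinearMap.inr ℝ ℝ (𝔼 × 𝔼))) x :=
      ((hfc x hx t ht).differentiableAt (by simp)).hasFDerivAt.comp x
        (hasFDerivAt_prodMk_right t x)
    have h5 := congrArg (fun L => L (h, 0)) (h4.unique h3)
    simp at h5
    rw [h5]
    have h6 := hsymm _ (hmem x hx t ht) (x.1 - c.1) h
    have h7 : ((t • h, 0) : 𝔼 × 𝔼) = t • (h, 0) := by simp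
    rw [h7, map_smul]
    simp [h6]
  have h8 := intervalIntegral.integral_eq_sub_of_hasDerivAt hF hint
  simpa using h8

/-- The analytic core of the Darboux-Carathéodory theorem: a closed 2-form on a ball in `E × E`
for which the slices `E × {b}` are isotropic has the form `∑ dpᵢ ∧ dbᵢ`, where `b` is the
second projection. -/
theorem exists_momenta {η : 𝔼 × 𝔼 → (𝔼 × 𝔼) [⋀^Fin 2]→L[ℝ] ℝ} {c : 𝔼 × 𝔼} {r : ℝ}
    (hη : ContDiffOn ℝ ∞ η (Metric.ball c r)) (hd : ∀ x ∈ Metric.ball c r, extDeriv η x = 0)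
    (hiso : ∀ x ∈ Metric.ball c r, ∀ h k : 𝔼, η x ![(h, 0), (k, 0)] = 0) :
    ∃ p : 𝔼 × 𝔼 → 𝔼, ContDiffOn ℝ ∞ p (Metric.ball c r) ∧
      ∀ x ∈ Metric.ball c r, ∀ a b : 𝔼 × 𝔼, η x ![a, b] =
        inner ℝ (fderiv ℝ p x a) b.2 - inner ℝ (fderiv ℝ p x b) a.2 := by
  have hso : IsOpen (Metric.ball c r) := Metric.isOpen_ball
  rcases le_or_gt r 0 with hr | hr
  · exact ⟨0, by simp [Metric.ball_eq_empty.2 hr], by simp [Metric.ball_eq_empty.2 hr]⟩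
  obtain ⟨l, hl, hηl⟩ := exists_primitive_of_extDeriv_eq_zero hso
    ((convex_ball c r).starConvex (Metric.mem_ball_self hr)) hη hd
  obtain ⟨S, hS, hSl⟩ := exists_slice_primitive hl fun x hx h k => by
    have h1 := hηl x hx (h, 0) (k, 0)
    rw [hiso x hx] at h1
    linarith
  have hfS : ContDiffOn ℝ ∞ (fderiv ℝ S) (Metric.ball c r) :=
    ((contDiffOn_infty_iff_fderiv_of_isOpen hso).1 hS).2
  have hμ : ContDiffOn ℝ ∞ (fun x => l x - fderiv ℝ S x) (Metric.ball c r) := hl.sub hfS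
  -- the primitive `l - dS` vanishes on the slices, hence only involves the `dbᵢ`
  set p : 𝔼 × 𝔼 → 𝔼 := fun x =>
    dualVec ((l x - fderiv ℝ S x).comp (ContinuousLinearMap.inr ℝ 𝔼 𝔼)) with hpdef
  have hp : ContDiffOn ℝ ∞ p (Metric.ball c r) :=
    contDiffOn_dualVec (hμ.clm_comp contDiffOn_const)
  have hinner : ∀ x ∈ Metric.ball c r, ∀ b : 𝔼 × 𝔼,
      (l x - fderiv ℝ S x) b = inner ℝ (p x) b.2 := by
    intro x hx b
    rw [hpdef, inner_dualVec]
    have hb : b = (b.1, 0) + (0, b.2) := by simp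
    conv_lhs => rw [hb, map_add]
    simp [hSl x hx]
  refine ⟨p, hp, fun x hx a b => ?_⟩
  have hD : ∀ a b : 𝔼 × 𝔼, fderiv ℝ l x a b - fderiv ℝ (fderiv ℝ S) x a b =
      inner ℝ (fderiv ℝ p x a) b.2 := by
    intro a b
    have hld := ((hl.contDiffAt (hso.mem_nhds hx)).differentiableAt (by simp)).hasFDerivAt
    have hSd := ((hfS.contDiffAt (hso.mem_nhds hx)).differentiableAt (by simp)).hasFDerivAt
    have hpd := ((hp.contDiffAt (hso.mem_nhds hx)).differentiableAt (by simp)).hasFDerivAt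
    have h1 : HasFDerivAt (fun y => (l y - fderiv ℝ S y) b) _ x :=
      (hld.sub hSd).clm_apply (hasFDerivAt_const b x)
    have h2 : HasFDerivAt (fun y => inner ℝ (p y) b.2) _ x :=
      hpd.inner ℝ (hasFDerivAt_const b.2 x)
    have h3 : (fun y => (l y - fderiv ℝ S y) b) =ᶠ[𝓝 x] fun y => inner ℝ (p y) b.2 := by
      filter_upwards [hso.mem_nhds hx] with y hy using hinner y hy b
    have h4 := congrArg (fun L => L a) ((h1.congr_of_eventuallyEq h3.symm).unique h2)
    simpa [fderivInnerCLM_apply] using h4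
  have hsym : fderiv ℝ (fderiv ℝ S) x a b = fderiv ℝ (fderiv ℝ S) x b a :=
    ((hS.contDiffAt (hso.mem_nhds hx)).isSymmSndFDerivAt
      (by simpa using two_le_infty)) a b
  rw [hηl x hx, ← hD a b, ← hD b a, hsym]
  ring

/-- Two systems of momenta for the same 2-form differ by a closed 1-form on the base. -/
theorem momenta_sub_eq {G : 𝔼 × 𝔼 → 𝔼} {c : 𝔼 × 𝔼} {r : ℝ} (hr : 0 < r)
    (hG : ContDiffOn ℝ ∞ G (Metric.ball c r))
    (h : ∀ x ∈ Metric.ball c r, ∀ a b : 𝔼 × 𝔼,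
      inner ℝ (fderiv ℝ G x a) b.2 - inner ℝ (fderiv ℝ G x b) a.2 =
        inner ℝ a.1 b.2 - inner ℝ b.1 a.2) :
    ∃ g : 𝔼 → 𝔼, ContDiffOn ℝ ∞ g (Metric.ball c.2 r) ∧
      (∀ b ∈ Metric.ball c.2 r, ∀ u v, inner ℝ (fderiv ℝ g b u) v = inner ℝ (fderiv ℝ g b v) u) ∧
      ∀ x ∈ Metric.ball c r, G x = x.1 + g x.2 := by
  have hso : IsOpen (Metric.ball c r) := Metric.isOpen_ball
  have hprod : Metric.ball c r = Metric.ball c.1 r ×ˢ Metric.ball c.2 r :=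
    (ball_prod_same c.1 c.2 r).symm
  have hGd : ∀ x ∈ Metric.ball c r, HasFDerivAt G (fderiv ℝ G x) x := fun x hx =>
    ((hG.contDiffAt (hso.mem_nhds hx)).differentiableAt (by simp)).hasFDerivAt
  -- on the slices, `G` differs from the first projection by a constant
  have hG1 : ∀ x ∈ Metric.ball c r, ∀ u, fderiv ℝ G x (u, 0) = u := by
    intro x hx u
    refine ext_inner_right ℝ fun v => ?_
    have := h x hx (u, 0) (0, v)
    simpa using this
  set g : 𝔼 → 𝔼 := fun b => G (c.1, b) - c.1 with hg
  have hmem : ∀ b ∈ Metric.ball c.2 r, (c.1, b) ∈ Metric.ball c r := fun b hb => by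
    rw [hprod]; exact ⟨Metric.mem_ball_self hr, hb⟩
  have hgd : ∀ b ∈ Metric.ball c.2 r,
      HasFDerivAt g ((fderiv ℝ G (c.1, b)).comp (ContinuousLinearMap.inr ℝ 𝔼 𝔼)) b :=
    fun b hb => ((hGd _ (hmem b hb)).comp b (hasFDerivAt_prodMk_right c.1 b)).sub_const c.1
  refine ⟨g, ?_, ?_, ?_⟩
  · exact ((hG.comp (contDiff_prodMk_right c.1).contDiffOn fun b hb => hmem b hb).sub
      contDiffOn_const)
  · intro b hb u v
    rw [(hgd b hb).fderiv]
    have := h _ (hmem b hb) (0, u) (0, v)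
    simp at this
    simpa using sub_eq_zero.1 this
  · intro x hx
    have hx' := hx
    rw [hprod] at hx'
    have hconst : ∀ u ∈ Metric.ball c.1 r, G (u, x.2) - u = G (c.1, x.2) - c.1 := by
      intro u hu
      refine (convex_ball c.1 r).is_const_of_fderivWithin_eq_zero (𝕜 := ℝ)
        (f := fun u => G (u, x.2) - u) ?_ ?_ hu (Metric.mem_ball_self hr)
      · intro u hu
        have h1 : (u, x.2) ∈ Metric.ball c r := by rw [hprod]; exact ⟨hu, hx'.2⟩
        exact (((hGd _ h1).comp u (hasFDerivAt_prodMk_left u x.2)).sub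
          (hasFDerivAt_id u)).differentiableAt.differentiableWithinAt
      · intro u hu
        have h1 : (u, x.2) ∈ Metric.ball c r := by rw [hprod]; exact ⟨hu, hx'.2⟩
        have h2 : HasFDerivAt (fun u => G (u, x.2) - u) _ u :=
          ((hGd _ h1).comp u (hasFDerivAt_prodMk_left u x.2)).sub (hasFDerivAt_id u)
        rw [fderivWithin_of_isOpen Metric.isOpen_ball hu, h2.fderiv]
        ext1 v
        simp [hG1 _ h1]
    have := hconst x.1 hx'.1
    simp only [hg]
    rw [← this]
    simp

end DarbouxCaratheodory

/-! ### The inverse function theorem for partial diffeomorphisms -/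

section InverseFunction

variable {V W : Type*} [NormedAddCommGroup V] [NormedSpace ℝ V] [FiniteDimensional ℝ V]
  [NormedAddCommGroup W] [NormedSpace ℝ W] [FiniteDimensional ℝ W]

/-- The inverse function theorem for smooth maps. -/
theorem exists_partialDiffeomorph_of_bijective {f : V → W} {s : Set V} (hs : IsOpen s)
    (hf : ContDiffOn ℝ ∞ f s) {x : V} (hx : x ∈ s) (hbij : Function.Bijective (fderiv ℝ f x)) :
    ∃ Φ : PartialDiffeomorph 𝓘(ℝ, V) 𝓘(ℝ, W) V W ∞, x ∈ Φ.source ∧ Φ.source ⊆ s ∧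
      ∀ y, Φ y = f y := by
  have : CompleteSpace V := FiniteDimensional.complete ℝ V
  have : CompleteSpace W := FiniteDimensional.complete ℝ W
  have hfc : ∀ y ∈ s, ContDiffAt ℝ ∞ f y := fun y hy => hf.contDiffAt (hs.mem_nhds hy)
  have hfd : ∀ y ∈ s, HasFDerivAt f (fderiv ℝ f y) y := fun y hy =>
    ((hfc y hy).differentiableAt (by simp)).hasFDerivAt
  obtain ⟨L, hL⟩ : ∃ L : V ≃L[ℝ] W, (L : V →L[ℝ] W) = fderiv ℝ f x :=
    ⟨ContinuousLinearEquiv.ofBijective (fderiv ℝ f x) (LinearMap.ker_eq_bot.2 hbij.1)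
      (LinearMap.range_eq_top.2 hbij.2), by ext; rfl⟩
  have hcont : ContinuousOn (fderiv ℝ f) s :=
    ((contDiffOn_infty_iff_fderiv_of_isOpen hs).1 hf).2.continuousOn
  set t := s ∩ fderiv ℝ f ⁻¹' range ((↑) : (V ≃L[ℝ] W) → V →L[ℝ] W) with ht
  have hto : IsOpen t := hcont.isOpen_inter_preimage hs ContinuousLinearEquiv.isOpen
  have hxt : x ∈ t := ⟨hx, L, hL⟩
  let e := (hfc x hx).toOpenPartialHomeomorph f (f' := L) (by rw [hL]; exact hfd x hx) (by simp)
  have he : ∀ y, e y = f y := fun y => rfl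
  have hxe : x ∈ e.source := (hfc x hx).mem_toOpenPartialHomeomorph_source _ _
  let e' := e.restrOpen t hto
  have hsub : e'.source ⊆ t := fun y hy => by
    rw [OpenPartialHomeomorph.restrOpen_source] at hy; exact hy.2
  refine ⟨{ toPartialEquiv := e'.toPartialEquiv
            open_source := e'.open_source
            open_target := e'.open_target
            contMDiffOn_toFun := ?_
            contMDiffOn_invFun := ?_ }, ?_, ?_, ?_⟩
  · exact (hf.mono (hsub.trans inter_subset_left)).contMDiffOn
  · refine ContDiffOn.contMDiffOn fun y hy => ?_
    have h1 := hsub (e'.map_target hy)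
    obtain ⟨L', hL'⟩ := h1.2
    refine (e'.contDiffAt_symm (f₀' := L') hy ?_ ?_).contDiffWithinAt
    · rw [hL']; exact hfd _ h1.1
    · exact hfc _ h1.1
  · change x ∈ (e.restrOpen t hto).source
    rw [OpenPartialHomeomorph.restrOpen_source]; exact ⟨hxe, hxt⟩
  · exact hsub.trans inter_subset_left
  · exact fun y => rfl

end InverseFunction

/-! ### Extension of local actions of vector groups -/

section LocalActions

variable {V : Type*} [NormedAddCommGroup V] [NormedSpace ℝ V] {X : Type*}

/-- The additivity of a local action, for multiples of a vector that stay in its domain. -/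
theorem iterate_of_local_action {T : V → X → X} {ε : ℝ} (h0 : T 0 = id)
    (hadd : ∀ s t, ‖s‖ + ‖t‖ < ε → T (s + t) = T s ∘ T t) (m : ℕ) {s : V} (hs : m * ‖s‖ < ε) :
    (T s)^[m] = T ((m : ℝ) • s) := by
  induction m with
  | zero => simp [h0]
  | succ m ih =>
    push_cast at hs
    rw [Function.iterate_succ, ih (by linarith [norm_nonneg s]), ← hadd]
    · congr 1; push_cast; module
    · rw [norm_smul, Real.norm_natCast]; linarith

/-- A local action of a normed space extends to an action. -/
theorem exists_action_of_local_action {T : V → X → X} {ε : ℝ} (hε : 0 < ε) (h0 : T 0 = id)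
    (hadd : ∀ s t, ‖s‖ + ‖t‖ < ε → T (s + t) = T s ∘ T t) :
    ∃ H : V → X → X, (∀ s t, H (s + t) = H s ∘ H t) ∧ ∀ t, ‖t‖ < ε → H t = T t := by
  -- the action of `t` is the `k`-fold iterate of that of `t / k`, for all large `k`
  have key : ∀ (t : V) (k n : ℕ), 0 < k → 0 < n → ‖t‖ < k * ε →
      (T ((k : ℝ)⁻¹ • t))^[k] = (T (((n * k : ℕ) : ℝ)⁻¹ • t))^[n * k] := by
    intro t k n hk hn ht
    have hk' : (0 : ℝ) < k := by exact_mod_cast hk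
    have hn' : (0 : ℝ) < n := by exact_mod_cast hn
    rw [Function.iterate_mul, iterate_of_local_action h0 hadd n]
    · congr 2
      rw [smul_smul]; push_cast; congr 1; field_simp
    · rw [norm_smul]
      push_cast
      rw [norm_inv, norm_mul, Real.norm_natCast, Real.norm_natCast]
      calc (n : ℝ) * ((n * k : ℝ)⁻¹ * ‖t‖) = ‖t‖ / k := by field_simp
        _ < ε := by rw [div_lt_iff₀ hk']; linarith
  have indep : ∀ (t : V) (k n : ℕ), 0 < k → 0 < n → ‖t‖ < k * ε → ‖t‖ < n * ε →
      (T ((k : ℝ)⁻¹ • t))^[k] = (T ((n : ℝ)⁻¹ • t))^[n] := by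
    intro t k n hk hn h1 h2
    rw [key t k n hk hn h1, key t n k hn hk h2, mul_comm]
  have hex : ∀ r : ℝ, ∃ n : ℕ, 0 < n ∧ r < n * ε := by
    intro r
    obtain ⟨n, hn⟩ := exists_nat_gt (r / ε)
    refine ⟨n + 1, n.succ_pos, ?_⟩
    rw [div_lt_iff₀ hε] at hn
    push_cast; linarith
  choose n hn0 hn using id hex
  refine ⟨fun t => (T (((n ‖t‖ : ℕ) : ℝ)⁻¹ • t))^[n ‖t‖], ?_, ?_⟩
  · intro s t
    obtain ⟨k, hk, hk'⟩ := hex (‖s‖ + ‖t‖)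
    have hkr : (0 : ℝ) < k := by exact_mod_cast hk
    have hst := norm_add_le s t
    have hcomm : ∀ a b : V, ‖a‖ + ‖b‖ < k * ε →
        T ((k : ℝ)⁻¹ • (a + b)) = T ((k : ℝ)⁻¹ • a) ∘ T ((k : ℝ)⁻¹ • b) := by
      intro a b hab
      rw [smul_add, hadd]
      rw [norm_smul, norm_smul, ← mul_add, norm_inv, Real.norm_natCast, inv_mul_lt_iff₀ hkr]
      exact hab
    dsimp only
    rw [indep (s + t) _ k (hn0 _) hk (hn _) (by linarith),
      indep s _ k (hn0 _) hk (hn _) (by linarith [norm_nonneg t]),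
      indep t _ k (hn0 _) hk (hn _) (by linarith [norm_nonneg s]), hcomm s t hk']
    have hc : Function.Commute (T ((k : ℝ)⁻¹ • s)) (T ((k : ℝ)⁻¹ • t)) := by
      intro x
      have h1 := hcomm s t hk'
      rw [add_comm, hcomm t s (by linarith)] at h1
      exact (congrFun h1 x).symm
    exact hc.comp_iterate k
  · intro t ht
    dsimp only
    rw [indep t _ 1 (hn0 _) one_pos (hn _) (by simpa using ht)]
    simp

end LocalActions

/-! ### Discrete subgroups of vector spaces -/

section Lattices

variable {V : Type*} [NormedAddCommGroup V] [NormedSpace ℝ V] [FiniteDimensional ℝ V]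

/-- In a discrete subgroup containing a basis, every element has a multiple in the lattice
spanned by this basis. -/
theorem exists_nsmul_mem_of_discrete {ι : Type*} [Finite ι] (b : Module.Basis ι ℝ V)
    {Λ : AddSubgroup V} {ε : ℝ} (hε : 0 < ε) (hΛ : ∀ t ∈ Λ, ‖t‖ < ε → t = 0) (hb : ∀ i, b i ∈ Λ)
    {t : V} (ht : t ∈ Λ) :
    ∃ k : ℕ, 0 < k ∧ ∀ Λ' : AddSubgroup V, (∀ i, b i ∈ Λ') → k • t ∈ Λ' := by
  have := Fintype.ofFinite ι
  have hspan : ∀ Λ' : AddSubgroup V, (∀ i, b i ∈ Λ') → ∀ x : V, (ZSpan.floor b x : V) ∈ Λ' := by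
    intro Λ' h x
    have h1 : Submodule.span ℤ (Set.range b) ≤ AddSubgroup.toIntSubmodule Λ' := by
      rw [Submodule.span_le]
      rintro _ ⟨i, rfl⟩
      exact h i
    exact h1 (ZSpan.floor b x).2
  obtain ⟨a, -, φ, hφ, hlim⟩ := tendsto_subseq_of_bounded
    (ZSpan.fundamentalDomain_isBounded b) (fun k : ℕ => ZSpan.fract_mem_fundamentalDomain b (k • t))
  obtain ⟨n, hn⟩ := (Metric.cauchySeq_iff.1 hlim.cauchySeq ε hε)
  have h1 := hn (n + 1) (by omega) n le_rfl
  have hlt : φ n < φ (n + 1) := hφ (Nat.lt_succ_self n)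
  have hmem : ZSpan.fract b (φ (n + 1) • t) - ZSpan.fract b (φ n • t) ∈ Λ := by
    rw [ZSpan.fract_apply, ZSpan.fract_apply]
    exact Λ.sub_mem (Λ.sub_mem (Λ.nsmul_mem ht _) (hspan Λ hb _))
      (Λ.sub_mem (Λ.nsmul_mem ht _) (hspan Λ hb _))
  have h2 := hΛ _ hmem (by simpa [dist_eq_norm] using h1)
  refine ⟨φ (n + 1) - φ n, by omega, fun Λ' h => ?_⟩
  have h3 : (φ (n + 1) - φ n) • t =
      ZSpan.floor b (φ (n + 1) • t) - ZSpan.floor b (φ n • t) := by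
    rw [ZSpan.fract_apply, ZSpan.fract_apply] at h2
    rw [sub_nsmul t hlt.le, ← sub_eq_add_neg]
    rw [← sub_eq_zero, ← h2]
    abel
  rw [h3]
  exact Λ'.sub_mem (hspan Λ' h _) (hspan Λ' h _)

end Lattices

/-! ### Symplectic bases -/

section SymplecticBasis

variable {V : Type*} [AddCommGroup V] [Module ℝ V] [FiniteDimensional ℝ V]

/-- `(v, w)` is a symplectic family for the alternating form `B`. -/
structure IsSymplecticFamily (B : V →ₗ[ℝ] V →ₗ[ℝ] ℝ) {n : ℕ} (v w : Fin n → V) : Prop where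
  vv : ∀ i j, B (v i) (v j) = 0
  ww : ∀ i j, B (w i) (w j) = 0
  vw : ∀ i j, B (v i) (w j) = if i = j then 1 else 0

omit [FiniteDimensional ℝ V] in
theorem IsSymplecticFamily.linearIndependent {B : V →ₗ[ℝ] V →ₗ[ℝ] ℝ} (hB : ∀ x, B x x = 0) {n : ℕ}
    {v w : Fin n → V} (h : IsSymplecticFamily B v w) :
    LinearIndependent ℝ (Sum.elim v w) := by
  have hB' : ∀ x y, B x y = -B y x := fun x y => by
    have := hB (x + y)
    simp [hB] at this
    linarith
  rw [Fintype.linearIndependent_iff]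
  intro g hg
  simp only [Fintype.sum_sum_type, Sum.elim_inl, Sum.elim_inr] at hg
  rintro (j | j)
  · have := congrArg (fun x => B x (w j)) hg
    simpa [h.ww, h.vw] using this
  · have := congrArg (fun x => B (v j) x) hg
    simpa [h.vv, h.vw] using this

/-- A symplectic vector space has a symplectic basis. -/
theorem exists_symplectic_basis (B : V →ₗ[ℝ] V →ₗ[ℝ] ℝ) (hB : ∀ x, B x x = 0)
    (hnd : ∀ x, (∀ y, B x y = 0) → x = 0) :
    ∃ (n : ℕ) (b : Module.Basis (Fin n ⊕ Fin n) ℝ V), ∀ x y, B x y =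
      ∑ i, (b.coord (.inl i) x * b.coord (.inr i) y - b.coord (.inl i) y * b.coord (.inr i) x) := by
  have hB' : ∀ x y, B x y = -B y x := fun x y => by
    have := hB (x + y)
    simp [hB] at this
    linarith
  have hbdd : ∀ n, (∃ v w : Fin n → V, IsSymplecticFamily B v w) →
      n ≤ Module.finrank ℝ V := by
    rintro n ⟨v, w, h⟩
    have := (h.linearIndependent hB).fintype_card_le_finrank
    simp at this
    omega
  classical
  have hzero : ∃ v w : Fin 0 → V, IsSymplecticFamily B v w :=
    ⟨Fin.elim0, Fin.elim0, ⟨fun i => i.elim0, fun i => i.elim0, fun i => i.elim0⟩⟩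
  let n := Nat.findGreatest (fun n => ∃ v w : Fin n → V, IsSymplecticFamily B v w)
    (Module.finrank ℝ V)
  obtain ⟨v, w, h⟩ : ∃ v w : Fin n → V, IsSymplecticFamily B v w :=
    Nat.findGreatest_spec (P := fun n => ∃ v w : Fin n → V, IsSymplecticFamily B v w)
      (Nat.zero_le _) hzero
  have hmax : ¬ ∃ v w : Fin (n + 1) → V, IsSymplecticFamily B v w := fun h' =>
    absurd (Nat.le_findGreatest (P := fun n => ∃ v w : Fin n → V, IsSymplecticFamily B v w)
      (hbdd _ h') h') (by simp [n])
  -- the projection to the symplectic complement of a symplectic family of maximal length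
  let r : V → V := fun x => x - ∑ i, (B x (w i) • v i + B (v i) x • w i)
  have hrv : ∀ x j, B (v j) (r x) = 0 := fun x j => by
    simp [r, h.vv, h.vw]
  have hrw : ∀ x j, B (w j) (r x) = 0 := fun x j => by
    simp [r, h.ww, hB' (w j), h.vw]
  have hexp : ∀ x, r x = 0 := by
    intro x
    by_contra hx
    obtain ⟨y, hy⟩ : ∃ y, B (r x) y ≠ 0 := by
      by_contra hcon
      push Not at hcon
      exact hx (hnd _ hcon)
    let y' := (B (r x) y)⁻¹ • r y
    have hxy : B (r x) (r y) = B (r x) y := by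
      have h1 : ∀ j, B (r x) (v j) = 0 := fun j => by rw [hB', hrv, neg_zero]
      have h2 : ∀ j, B (r x) (w j) = 0 := fun j => by rw [hB', hrw, neg_zero]
      change B (r x) (y - _) = _
      simp [h1, h2]
    refine hmax ⟨Fin.cons (r x) v, Fin.cons y' w, ⟨?_, ?_, ?_⟩⟩
    · intro i j
      refine Fin.cases ?_ (fun i => ?_) i <;> refine Fin.cases ?_ (fun j => ?_) j
      · simp [hB]
      · simp [hB' (r x), hrv]
      · simp [hrv]
      · simp [h.vv]
    · intro i j
      refine Fin.cases ?_ (fun i => ?_) i <;> refine Fin.cases ?_ (fun j => ?_) j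
      · simp [hB]
      · simp [y', hB' (r y), hrw]
      · simp [y', hrw]
      · simp [h.ww]
    · intro i j
      refine Fin.cases ?_ (fun i => ?_) i <;> refine Fin.cases ?_ (fun j => ?_) j
      · simp [y', hxy, hy]
      · simp [hB' (r x), hrw, (Fin.succ_ne_zero _).symm]
      · simp [y', hrv]
      · simp [h.vw, Fin.succ_inj]
  have hx : ∀ x, x = ∑ i, (B x (w i) • v i + B (v i) x • w i) := fun x =>
    sub_eq_zero.1 (hexp x)
  have hspan : ⊤ ≤ Submodule.span ℝ (Set.range (Sum.elim v w)) := by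
    intro x _
    rw [hx x]
    refine Submodule.sum_mem _ fun i _ => Submodule.add_mem _ ?_ ?_
    · exact Submodule.smul_mem _ _ (Submodule.subset_span ⟨.inl i, rfl⟩)
    · exact Submodule.smul_mem _ _ (Submodule.subset_span ⟨.inr i, rfl⟩)
  let b := Module.Basis.mk (h.linearIndependent hB) hspan
  have hbv : ∀ i, b (.inl i) = v i := fun i => by simp [b]
  have hbw : ∀ i, b (.inr i) = w i := fun i => by simp [b]
  have hsum : ∀ x, ∑ i, b.repr x (.inl i) • v i + ∑ i, b.repr x (.inr i) • w i = x := by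
    intro x
    have e := b.sum_repr x
    rw [Fintype.sum_sum_type] at e
    simpa only [hbv, hbw] using e
  have hl : ∀ i x, b.coord (.inl i) x = B x (w i) := by
    intro i x
    have := congrArg (fun z => B z (w i)) (hsum x)
    simpa [h.vw, h.ww] using this
  have hr : ∀ i x, b.coord (.inr i) x = B (v i) x := by
    intro i x
    have := congrArg (fun z => B (v i) z) (hsum x)
    simpa [h.vw, h.vv] using this
  refine ⟨n, b, fun x y => ?_⟩
  simp only [hl, hr]
  conv_lhs => rw [hx x]
  simp only [map_sum, map_add, map_smul, LinearMap.sum_apply, LinearMap.add_apply,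
    LinearMap.smul_apply, smul_eq_mul]
  refine Finset.sum_congr rfl fun i _ => ?_
  rw [hB' (w i) y]
  ring

end SymplecticBasis

/-! ### Partial diffeomorphisms and chain rules -/

section PartialDiffeomorphs

variable {E : Type*} [NormedAddCommGroup E] [NormedSpace ℝ E]
  {H : Type*} [TopologicalSpace H] {I : ModelWithCorners ℝ E H}
  {M : Type*} [TopologicalSpace M] [ChartedSpace H M]
  {E' : Type*} [NormedAddCommGroup E'] [NormedSpace ℝ E']
  {H' : Type*} [TopologicalSpace H'] {J : ModelWithCorners ℝ E' H'}
  {M' : Type*} [TopologicalSpace M'] [ChartedSpace H' M']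

namespace PDiffeo

variable (Φ : PartialDiffeomorph I J M M' ∞)

theorem left_inv {z : M} (hz : z ∈ Φ.source) : Φ.symm (Φ z) = z := Φ.toPartialEquiv.left_inv hz

theorem right_inv {w : M'} (hw : w ∈ Φ.target) : Φ (Φ.symm w) = w := Φ.toPartialEquiv.right_inv hw

theorem map_source {z : M} (hz : z ∈ Φ.source) : Φ z ∈ Φ.target := Φ.toPartialEquiv.map_source hz

theorem map_target {w : M'} (hw : w ∈ Φ.target) : Φ.symm w ∈ Φ.source :=
  Φ.toPartialEquiv.map_target hw

theorem source_mem_nhds {z : M} (hz : z ∈ Φ.source) : Φ.source ∈ 𝓝 z := Φ.open_source.mem_nhds hz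

theorem target_mem_nhds {w : M'} (hw : w ∈ Φ.target) : Φ.target ∈ 𝓝 w := Φ.open_target.mem_nhds hw

theorem contMDiffAt {z : M} (hz : z ∈ Φ.source) : ContMDiffAt I J ∞ Φ z :=
  Φ.contMDiffOn_toFun.contMDiffAt (source_mem_nhds Φ hz)

theorem contMDiffAt_symm {w : M'} (hw : w ∈ Φ.target) : ContMDiffAt J I ∞ Φ.symm w :=
  Φ.contMDiffOn_invFun.contMDiffAt (target_mem_nhds Φ hw)

theorem mdifferentiableAt {z : M} (hz : z ∈ Φ.source) : MDifferentiableAt I J Φ z :=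
  (contMDiffAt Φ hz).mdifferentiableAt (by simp)

theorem mdifferentiableAt_symm {w : M'} (hw : w ∈ Φ.target) : MDifferentiableAt J I Φ.symm w :=
  (contMDiffAt_symm Φ hw).mdifferentiableAt (by simp)

theorem continuousAt {z : M} (hz : z ∈ Φ.source) : ContinuousAt Φ z :=
  (contMDiffAt Φ hz).continuousAt

theorem continuousAt_symm {w : M'} (hw : w ∈ Φ.target) : ContinuousAt Φ.symm w :=
  (contMDiffAt_symm Φ hw).continuousAt

theorem mfderiv_symm_mfderiv {z : M} (hz : z ∈ Φ.source) (u : TangentSpace I z) :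
    mfderiv J I Φ.symm (Φ z) (mfderiv I J Φ z u) = u := by
  have h1 : MDifferentiableAt J I Φ.symm (Φ z) := mdifferentiableAt_symm Φ (map_source Φ hz)
  have h2 := mfderiv_comp_apply z h1 (mdifferentiableAt Φ hz) u
  rw [← h2]
  have h3 : Φ.symm ∘ Φ =ᶠ[𝓝 z] id := by
    filter_upwards [source_mem_nhds Φ hz] with y hy using left_inv Φ hy
  rw [h3.mfderiv_eq, mfderiv_id]
  rfl

theorem mfderiv_mfderiv_symm {w : M'} (hw : w ∈ Φ.target) (u : TangentSpace J w) :
    mfderiv I J Φ (Φ.symm w) (mfderiv J I Φ.symm w u) = u := by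
  have h1 : MDifferentiableAt I J Φ (Φ.symm w) := mdifferentiableAt Φ (map_target Φ hw)
  have h2 := mfderiv_comp_apply w h1 (mdifferentiableAt_symm Φ hw) u
  rw [← h2]
  have h3 : Φ ∘ Φ.symm =ᶠ[𝓝 w] id := by
    filter_upwards [target_mem_nhds Φ hw] with y hy using right_inv Φ hy
  rw [h3.mfderiv_eq, mfderiv_id]
  rfl

theorem mfderiv_injective {z : M} (hz : z ∈ Φ.source) :
    Function.Injective (mfderiv I J Φ z) :=
  Function.LeftInverse.injective (mfderiv_symm_mfderiv Φ hz)

theorem mfderiv_symm_injective {w : M'} (hw : w ∈ Φ.target) :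
    Function.Injective (mfderiv J I Φ.symm w) :=
  Function.LeftInverse.injective (mfderiv_mfderiv_symm Φ hw)

theorem mfderiv_bijective {z : M} (hz : z ∈ Φ.source) :
    Function.Bijective (mfderiv I J Φ z) := by
  refine ⟨mfderiv_injective Φ hz, fun w => ?_⟩
  refine ⟨mfderiv J I Φ.symm (Φ z) w |> fun u => (left_inv Φ hz ▸ u : TangentSpace I z), ?_⟩
  have h := mfderiv_mfderiv_symm Φ (map_source Φ hz) w
  have key : ∀ (z' : M) (e : z' = z) (u : TangentSpace I z'),
      mfderiv I J Φ z (e ▸ u : TangentSpace I z) = mfderiv I J Φ z' u := by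
    rintro z' rfl u; rfl
  exact (key _ (left_inv Φ hz) _).trans h

/-- The restriction of a partial diffeomorphism to an open set. -/
noncomputable def restr (s : Set M) (hs : IsOpen s) : PartialDiffeomorph I J M M' ∞ where
  toPartialEquiv := (Φ.toOpenPartialHomeomorph.restrOpen s hs).toPartialEquiv
  open_source := (Φ.toOpenPartialHomeomorph.restrOpen s hs).open_source
  open_target := (Φ.toOpenPartialHomeomorph.restrOpen s hs).open_target
  contMDiffOn_toFun := Φ.contMDiffOn_toFun.mono (by
    rw [OpenPartialHomeomorph.restrOpen_source]; exact inter_subset_left)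
  contMDiffOn_invFun := Φ.contMDiffOn_invFun.mono fun w hw => by
    simpa using hw.1

theorem restr_source (s : Set M) (hs : IsOpen s) : (restr Φ s hs).source = Φ.source ∩ s :=
  OpenPartialHomeomorph.restrOpen_source _ s hs

@[simp] theorem restr_apply (s : Set M) (hs : IsOpen s) (z : M) : restr Φ s hs z = Φ z := rfl

@[simp] theorem restr_symm_apply (s : Set M) (hs : IsOpen s) (w : M') :
    (restr Φ s hs).symm w = Φ.symm w := rfl

theorem restr_target (s : Set M) (hs : IsOpen s) :
    (restr Φ s hs).target = Φ.target ∩ Φ.symm ⁻¹' s := by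
  ext w
  constructor
  · intro hw
    have h1 := map_target (restr Φ s hs) hw
    rw [restr_source, restr_symm_apply] at h1
    have h2 := right_inv (restr Φ s hs) hw
    rw [restr_symm_apply, restr_apply] at h2
    exact ⟨h2 ▸ map_source Φ h1.1, h1.2⟩
  · rintro ⟨hw, hs'⟩
    have h1 : Φ.symm w ∈ (restr Φ s hs).source := by
      rw [restr_source]; exact ⟨map_target Φ hw, hs'⟩
    have h2 := map_source _ h1
    rwa [restr_apply, right_inv Φ hw] at h2

end PDiffeo

/-- The preferred chart at a point of a boundaryless manifold. -/
noncomputable def chartPDiffeo (I : ModelWithCorners ℝ E H) [I.Boundaryless] [IsManifold I ∞ M]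
    (z : M) : PartialDiffeomorph I 𝓘(ℝ, E) M E ∞ where
  toPartialEquiv := extChartAt I z
  open_source := isOpen_extChartAt_source z
  open_target := isOpen_extChartAt_target z
  contMDiffOn_toFun := by
    rw [extChartAt_source]; exact contMDiffOn_extChartAt
  contMDiffOn_invFun := contMDiffOn_extChartAt_symm z

variable {F : Type*} [NormedAddCommGroup F] [NormedSpace ℝ F]
  {F' : Type*} [NormedAddCommGroup F'] [NormedSpace ℝ F']

theorem mvfderiv_congr {f g : M → F} {z : M} (h : f =ᶠ[𝓝 z] g) :
    mvfderiv I f z = mvfderiv I g z := by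
  unfold mvfderiv
  rw [h.mfderiv_eq]
  have := h.self_of_nhds
  ext v
  rfl

/-- The chain rule for a vector-valued function on a manifold. -/
theorem mvfderiv_comp_mfderiv {g : M' → F} {f : M → M'} {z : M}
    (hg : MDifferentiableAt J 𝓘(ℝ, F) g (f z)) (hf : MDifferentiableAt I J f z)
    (v : TangentSpace I z) :
    mvfderiv I (fun y => g (f y)) z v = mvfderiv J g (f z) (mfderiv I J f z v) :=
  mfderiv_comp_apply z hg hf v

theorem mvfderiv_comp_fderiv {g : F → F'} {f : M → F} {z : M}
    (hg : DifferentiableAt ℝ g (f z)) (hf : MDifferentiableAt I 𝓘(ℝ, F) f z)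
    (v : TangentSpace I z) :
    mvfderiv I (fun y => g (f y)) z v = fderiv ℝ g (f z) (mvfderiv I f z v) := by
  have h := mfderiv_comp_apply z hg.mdifferentiableAt hf v
  rw [mfderiv_eq_fderiv] at h
  exact h

theorem mvfderiv_eq_fderiv (f : F → F') (x : F) (v : F) :
    mvfderiv 𝓘(ℝ, F) f x v = fderiv ℝ f x v := by
  unfold mvfderiv
  rw [mfderiv_eq_fderiv]
  rfl

end PartialDiffeomorphs

/-! ### Pull-back of 2-forms to vector spaces -/

section Pullback

variable {E : Type*} [NormedAddCommGroup E] [NormedSpace ℝ E] [FiniteDimensional ℝ E]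
  {H : Type*} [TopologicalSpace H] {I : ModelWithCorners ℝ E H} [I.Boundaryless]
  {M : Type*} [TopologicalSpace M] [ChartedSpace H M] [IsManifold I ∞ M]
  {V : Type*} [NormedAddCommGroup V] [NormedSpace ℝ V] [FiniteDimensional ℝ V]

/-- The pull-back of a 2-form on a manifold under a map from a vector space. -/
noncomputable def TwoForm.pullback (η : TwoForm I M) (ψ : V → M) (w : V) : V [⋀^Fin 2]→L[ℝ] ℝ :=
  (η (ψ w)).compContinuousLinearMap (mfderiv 𝓘(ℝ, V) I ψ w : V →L[ℝ] TangentSpace I (ψ w))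

omit [FiniteDimensional ℝ E] [I.Boundaryless] [IsManifold I ∞ M] [FiniteDimensional ℝ V] in
theorem TwoForm.pullback_apply (η : TwoForm I M) (ψ : V → M) (w a b : V) :
    η.pullback ψ w ![a, b] =
      η (ψ w) ![mfderiv 𝓘(ℝ, V) I ψ w a, mfderiv 𝓘(ℝ, V) I ψ w b] := by
  refine congrArg (η (ψ w)) (funext fun i => ?_)
  fin_cases i <;> rfl

/-- Smoothness and closedness, which are defined by the preferred charts, pass to the pull-back
under any smooth map from a vector space, in particular to the expression of the form in any chart.
-/
theorem TwoForm.pullback_smooth_closed {η : TwoForm I M} (hη : η.IsSymplecticOn univ) {ψ : V → M}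
    {W : Set V} (hW : IsOpen W) (hψ : ContMDiffOn 𝓘(ℝ, V) I ∞ ψ W) :
    ContDiffOn ℝ ∞ (η.pullback ψ) W ∧ ∀ w ∈ W, extDeriv (η.pullback ψ) w = 0 := by
  have key : ∀ w₀ ∈ W, ContDiffAt ℝ ∞ (η.pullback ψ) w₀ ∧ extDeriv (η.pullback ψ) w₀ = 0 := by
    intro w₀ hw₀
    let κ := chartPDiffeo I (ψ w₀)
    have hψ₀ : ContMDiffAt 𝓘(ℝ, V) I ∞ ψ w₀ := hψ.contMDiffAt (hW.mem_nhds hw₀)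
    have hκ₀ : ψ w₀ ∈ κ.source := mem_extChartAt_source (I := I) (ψ w₀)
    set f : V → E := fun w => κ (ψ w) with hf
    have hev : ∀ᶠ w in 𝓝 w₀, ψ w ∈ κ.source ∧ w ∈ W :=
      (hψ₀.continuousAt.eventually_mem (PDiffeo.source_mem_nhds κ hκ₀)).and (hW.mem_nhds hw₀)
    have hfs : ∀ w, ψ w ∈ κ.source → w ∈ W → ContDiffAt ℝ ∞ f w := fun w h1 h2 =>
      contMDiffAt_iff_contDiffAt.1 ((PDiffeo.contMDiffAt κ h1).comp w
        (hψ.contMDiffAt (hW.mem_nhds h2)))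
    have hf₀ : ContDiffAt ℝ ∞ f w₀ := hfs w₀ hκ₀ hw₀
    have hdom : chartDomain I univ (ψ w₀) = κ.target := by
      simp [chartDomain, κ, chartPDiffeo]
    have hopen : κ.target ∈ 𝓝 (f w₀) := PDiffeo.target_mem_nhds κ (PDiffeo.map_source κ hκ₀)
    have hrep : ContDiffAt ℝ ∞ (η.chartRep (ψ w₀)) (f w₀) :=
      (hdom ▸ hη.smooth (ψ w₀)).contDiffAt hopen
    have hEq : η.pullback ψ =ᶠ[𝓝 w₀]
        fun w => (η.chartRep (ψ w₀) (f w)).compContinuousLinearMap (fderiv ℝ f w) := by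
      filter_upwards [hev, eventually_eventually_nhds.2 hev] with w hw hw'
      have h1 : ψ =ᶠ[𝓝 w] fun y => κ.symm (f y) := by
        filter_upwards [hw'] with y hy using (PDiffeo.left_inv κ hy.1).symm
      have h2 : MDifferentiableAt 𝓘(ℝ, E) I κ.symm (f w) :=
        PDiffeo.mdifferentiableAt_symm κ (PDiffeo.map_source κ hw.1)
      have h3 : κ.symm (f w) = ψ w := PDiffeo.left_inv κ hw.1
      have h4 : HasMFDerivAt 𝓘(ℝ, V) I (fun y => κ.symm (f y)) w
          ((mfderiv 𝓘(ℝ, E) I κ.symm (f w)).comp (fderiv ℝ f w)) :=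
        HasMFDerivAt.comp w h2.hasMFDerivAt
          ((hfs w hw.1 hw.2).differentiableAt (by simp)).hasFDerivAt.hasMFDerivAt
      have key : ∀ (ψ' : V → M), ψ =ᶠ[𝓝 w] ψ' →
          η.pullback ψ w = η.pullback ψ' w := by
        intro ψ' h
        have e1 := h.self_of_nhds
        unfold TwoForm.pullback
        have e2 := h.mfderiv_eq (I := 𝓘(ℝ, V)) (I' := I)
        have e3 : ∀ (m : M) (em : ψ w = m) (L : V →L[ℝ] TangentSpace I (ψ w))
            (L' : V →L[ℝ] TangentSpace I m), HEq L L' →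
            (η (ψ w)).compContinuousLinearMap L = (η m).compContinuousLinearMap L' := by
          rintro m rfl L L' h
          rw [eq_of_heq h]
        exact e3 _ e1 _ _ (heq_of_eq e2)
      rw [key _ h1]
      unfold TwoForm.pullback
      rw [h4.mfderiv]
      rfl
    have hf' : ContDiffAt ℝ ∞ (fderiv ℝ f) w₀ := hf₀.fderiv_right (by simp)
    refine ⟨?_, ?_⟩
    · refine ContDiffAt.congr_of_eventuallyEq ?_ hEq
      rw [← contDiffWithinAt_univ, ← insert_eq_of_mem (mem_univ w₀)]
      have hWo : ∃ s : Set V, IsOpen s ∧ w₀ ∈ s ∧ ContDiffOn ℝ ∞ f s ∧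
          ContDiffOn ℝ ∞ (fun w => η.chartRep (ψ w₀) (f w)) s := by
        obtain ⟨s, hs, hso, hws⟩ := eventually_nhds_iff.1 hev
        refine ⟨s, hso, hws, fun w hw => (hfs w (hs w hw).1 (hs w hw).2).contDiffWithinAt, ?_⟩
        intro w hw
        have h5 : ContDiffAt ℝ ∞ (η.chartRep (ψ w₀)) (f w) :=
          (hdom ▸ hη.smooth (ψ w₀)).contDiffAt
            (PDiffeo.target_mem_nhds κ (PDiffeo.map_source κ (hs w hw).1))
        exact (h5.comp w (hfs w (hs w hw).1 (hs w hw).2)).contDiffWithinAt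
      obtain ⟨s, hso, hws, hfs', hrs⟩ := hWo
      have h6 : ContDiffOn ℝ ∞ (fun w => (η.chartRep (ψ w₀) (f w)).compContinuousLinearMap
          (fderiv ℝ f w)) s := by
        refine contDiffOn_of_apply fun a b => ?_
        have h7 := contDiffOn_toBilin hrs
        have h8 := ((contDiffOn_infty_iff_fderiv_of_isOpen hso).1 hfs').2
        refine ((h7.clm_apply (h8.clm_apply (contDiffOn_const (c := a)))).clm_apply
          (h8.clm_apply (contDiffOn_const (c := b)))).congr fun w _ => ?_
        rw [ContinuousAlternatingMap.compContinuousLinearMap_apply, toBilin_apply]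
        congr 1
        ext i; fin_cases i <;> rfl
      exact (h6.contDiffAt (hso.mem_nhds hws)).contDiffWithinAt
    · rw [hEq.extDeriv_eq, extDeriv_pullback (hrep.differentiableAt (by simp)) hf₀
        (by simpa using two_le_infty), hη.closed (ψ w₀) (f w₀)]
      · ext; simp
      · rw [hdom]; exact PDiffeo.map_source κ hκ₀
  exact ⟨fun w hw => (key w hw).1.contDiffWithinAt, fun w hw => (key w hw).2⟩

end Pullback

/-! ### Momenta and the Darboux-Carathéodory theorem -/

/-- A surjective linear map can be completed to an isomorphism, by the coordinates of a projection
to its kernel. -/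
theorem exists_prod_bijective {V W W' : Type*} [NormedAddCommGroup V] [NormedSpace ℝ V]
    [FiniteDimensional ℝ V] [NormedAddCommGroup W] [NormedSpace ℝ W] [FiniteDimensional ℝ W]
    [NormedAddCommGroup W'] [NormedSpace ℝ W'] [FiniteDimensional ℝ W'] (D : V →L[ℝ] W)
    (hD : Function.Surjective D)
    (hdim : Module.finrank ℝ V = Module.finrank ℝ W' + Module.finrank ℝ W) :
    ∃ L : V →L[ℝ] W', Function.Bijective (L.prod D) := by
  have h1 := LinearMap.finrank_range_add_finrank_ker (D : V →ₗ[ℝ] W)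
  rw [LinearMap.range_eq_top.2 hD, finrank_top] at h1
  have e : LinearMap.ker (D : V →ₗ[ℝ] W) ≃ₗ[ℝ] W' :=
    LinearEquiv.ofFinrankEq _ _ (by omega)
  obtain ⟨L, hL⟩ := LinearMap.exists_extend (e : LinearMap.ker (D : V →ₗ[ℝ] W) →ₗ[ℝ] W')
  refine ⟨LinearMap.toContinuousLinearMap L, ?_⟩
  have hinj : Function.Injective ((LinearMap.toContinuousLinearMap L).prod D) := by
    rw [injective_iff_map_eq_zero]
    intro v hv
    have h2 : L v = 0 := congrArg Prod.fst hv
    have h3 : D v = 0 := congrArg Prod.snd hv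
    have h4 : e ⟨v, h3⟩ = L v := (LinearMap.congr_fun hL ⟨v, h3⟩).symm
    rw [h2] at h4
    have h5 := e.map_eq_zero_iff.1 h4
    exact congrArg Subtype.val h5
  refine ⟨hinj, ?_⟩
  exact (LinearMap.injective_iff_surjective_of_finrank_eq_finrank
    (f := ((LinearMap.toContinuousLinearMap L).prod D : V →ₗ[ℝ] W' × W))
    (by rw [Module.finrank_prod]; exact hdim)).1 hinj

section Momenta

variable {N : ℕ}
  {X : Type*} [TopologicalSpace X] [ChartedSpace (EuclideanSpace ℝ (Fin (2 * N))) X]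
  {B : Type*} [TopologicalSpace B] [ChartedSpace (EuclideanSpace ℝ (Fin N)) B]

local notation "𝔼" => EuclideanSpace ℝ (Fin N)

/-- `p` is a system of momenta at `z` for the coordinates `x` of the base: near `z`,
`ω = ∑ dpᵢ ∧ dxᵢ`. -/
def IsMomentum (η : TwoForm (𝓡 (2 * N)) X) (π : X → B) (x : B → 𝔼) (p : X → 𝔼) (z : X) : Prop :=
  ∀ᶠ z' in 𝓝 z, ContMDiffAt (𝓡 (2 * N)) 𝓘(ℝ, 𝔼) ∞ p z' ∧
    ∀ u v : TangentSpace (𝓡 (2 * N)) z', η z' ![u, v] =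
      inner ℝ (mvfderiv (𝓡 (2 * N)) p z' u) (mvfderiv (𝓡 (2 * N)) (fun y => x (π y)) z' v) -
      inner ℝ (mvfderiv (𝓡 (2 * N)) p z' v) (mvfderiv (𝓡 (2 * N)) (fun y => x (π y)) z' u)

variable [IsManifold (𝓡 (2 * N)) ∞ X] [IsManifold (𝓡 N) ∞ B]
  {η : TwoForm (𝓡 (2 * N)) X} {π : X → B}

omit [IsManifold (𝓡 (2 * N)) ∞ X] [IsManifold (𝓡 N) ∞ B] in
theorem IsIntegrableSystem.mdifferentiableAt (hπ : IsIntegrableSystem η π) (z : X) :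
    MDifferentiableAt (𝓡 (2 * N)) (𝓡 N) π z :=
  hπ.smooth.mdifferentiable (by simp) z

omit [IsManifold (𝓡 N) ∞ B] in
/-- Near each point, a submersion is a projection in suitable coordinates. -/
theorem exists_submersion_chart (hπ : IsIntegrableSystem η π)
    (x : PartialDiffeomorph (𝓡 N) 𝓘(ℝ, 𝔼) B 𝔼 ∞) {z₀ : X} (hz₀ : π z₀ ∈ x.source) :
    ∃ κ : PartialDiffeomorph (𝓡 (2 * N)) 𝓘(ℝ, 𝔼 × 𝔼) X (𝔼 × 𝔼) ∞, z₀ ∈ κ.source ∧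
      (∀ z ∈ κ.source, π z ∈ x.source) ∧ ∀ z ∈ κ.source, (κ z).2 = x (π z) := by
  let c := chartPDiffeo (𝓡 (2 * N)) z₀
  have hc : z₀ ∈ c.source := mem_extChartAt_source (I := 𝓡 (2 * N)) z₀
  have hcc : c z₀ ∈ c.target := PDiffeo.map_source c hc
  set f : EuclideanSpace ℝ (Fin (2 * N)) → 𝔼 := fun w => x (π (c.symm w)) with hf
  have hcont : ContinuousOn (fun w => π (c.symm w)) c.target :=
    hπ.smooth.continuous.comp_continuousOn fun w hw =>
      (PDiffeo.continuousAt_symm c hw).continuousWithinAt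
  set s := c.target ∩ (fun w => π (c.symm w)) ⁻¹' x.source with hs
  have hso : IsOpen s := hcont.isOpen_inter_preimage c.open_target x.open_source
  have hcs : c z₀ ∈ s := ⟨hcc, by
    change π (c.symm (c z₀)) ∈ x.source
    rwa [PDiffeo.left_inv c hc]⟩
  have hfm : ∀ w ∈ s, ContMDiffAt 𝓘(ℝ, EuclideanSpace ℝ (Fin (2 * N))) 𝓘(ℝ, 𝔼) ∞ f w :=
    fun w hw => (PDiffeo.contMDiffAt x hw.2).comp w
      ((hπ.smooth _).comp w (PDiffeo.contMDiffAt_symm c hw.1))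
  have hfs : ContDiffOn ℝ ∞ f s := fun w hw =>
    (contMDiffAt_iff_contDiffAt.1 (hfm w hw)).contDiffWithinAt
  have hsurj : Function.Surjective (fderiv ℝ f (c z₀)) := by
    have h1 : HasMFDerivAt 𝓘(ℝ, EuclideanSpace ℝ (Fin (2 * N))) 𝓘(ℝ, 𝔼) f (c z₀)
        ((mfderiv (𝓡 N) 𝓘(ℝ, 𝔼) x (π (c.symm (c z₀)))).comp
          ((mfderiv (𝓡 (2 * N)) (𝓡 N) π (c.symm (c z₀))).comp
            (mfderiv 𝓘(ℝ, EuclideanSpace ℝ (Fin (2 * N))) (𝓡 (2 * N)) c.symm (c z₀)))) := by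
      refine HasMFDerivAt.comp (c z₀) (PDiffeo.mdifferentiableAt x hcs.2).hasMFDerivAt ?_
      exact HasMFDerivAt.comp (c z₀) (hπ.mdifferentiableAt _).hasMFDerivAt
        (PDiffeo.mdifferentiableAt_symm c hcc).hasMFDerivAt
    rw [← mfderiv_eq_fderiv, h1.mfderiv]
    exact (PDiffeo.mfderiv_bijective x hcs.2).2.comp ((hπ.submersion _).comp
      (PDiffeo.mfderiv_bijective c.symm hcc).2)
  obtain ⟨L, hL⟩ := exists_prod_bijective (W' := 𝔼) (fderiv ℝ f (c z₀)) hsurj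
    (by simp; ring)
  have hfd : HasFDerivAt f (fderiv ℝ f (c z₀)) (c z₀) :=
    ((hfs.contDiffAt (hso.mem_nhds hcs)).differentiableAt (by simp)).hasFDerivAt
  obtain ⟨Ψ, hΨ, hΨs, hΨf⟩ := exists_partialDiffeomorph_of_bijective
    (f := fun w => (L w, f w)) hso (L.contDiff.contDiffOn.prodMk hfs) hcs (by
      rw [(L.hasFDerivAt.prodMk hfd).fderiv]; exact hL)
  refine ⟨c.trans Ψ, ⟨hc, hΨ⟩, fun z hz => ?_, fun z hz => ?_⟩
  · have h1 := hΨs hz.2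
    have h2 : π (c.symm (c z)) ∈ x.source := h1.2
    rwa [PDiffeo.left_inv c hz.1] at h2
  · change (Ψ (c z)).2 = _
    rw [hΨf]
    change x (π (c.symm (c z))) = _
    rw [PDiffeo.left_inv c hz.1]

/-- A momentum chart for the coordinates `x` of the base: a chart `(p, x ∘ π)` of the total space
in which `ω = ∑ dpᵢ ∧ dxᵢ`. -/
structure IsMomentumChart (η : TwoForm (𝓡 (2 * N)) X) (π : X → B)
    (x : PartialDiffeomorph (𝓡 N) 𝓘(ℝ, 𝔼) B 𝔼 ∞)
    (κ : PartialDiffeomorph (𝓡 (2 * N)) 𝓘(ℝ, 𝔼 × 𝔼) X (𝔼 × 𝔼) ∞) : Prop where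
  mem_source : ∀ z ∈ κ.source, π z ∈ x.source
  snd_eq : ∀ z ∈ κ.source, (κ z).2 = x (π z)
  momentum : ∀ z ∈ κ.source, IsMomentum η π x (fun y => (κ y).1) z

omit [IsManifold (𝓡 (2 * N)) ∞ X] in
theorem mvfderiv_fst_snd {F F' : Type*} [NormedAddCommGroup F] [NormedSpace ℝ F]
    [NormedAddCommGroup F'] [NormedSpace ℝ F'] {κ : X → F × F'} {z : X}
    (hκ : MDifferentiableAt (𝓡 (2 * N)) 𝓘(ℝ, F × F') κ z) (u : TangentSpace (𝓡 (2 * N)) z) :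
    mvfderiv (𝓡 (2 * N)) (fun y => (κ y).1) z u = (mvfderiv (𝓡 (2 * N)) κ z u).1 ∧
    mvfderiv (𝓡 (2 * N)) (fun y => (κ y).2) z u = (mvfderiv (𝓡 (2 * N)) κ z u).2 := by
  constructor
  · rw [mvfderiv_comp_fderiv (g := Prod.fst) differentiableAt_fst hκ, fderiv_fst]; rfl
  · rw [mvfderiv_comp_fderiv (g := Prod.snd) differentiableAt_snd hκ, fderiv_snd]; rfl

omit [IsManifold (𝓡 N) ∞ B] in
/-- The Darboux-Carathéodory theorem: momentum charts exist near each point. -/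
theorem exists_momentumChart (hπ : IsIntegrableSystem η π)
    (x : PartialDiffeomorph (𝓡 N) 𝓘(ℝ, 𝔼) B 𝔼 ∞) {z₀ : X} (hz₀ : π z₀ ∈ x.source) :
    ∃ κ : PartialDiffeomorph (𝓡 (2 * N)) 𝓘(ℝ, 𝔼 × 𝔼) X (𝔼 × 𝔼) ∞, z₀ ∈ κ.source ∧
      IsMomentumChart η π x κ := by
  obtain ⟨κ, hκ, hκx, hκ2⟩ := exists_submersion_chart hπ x hz₀
  have hκκ := PDiffeo.map_source κ hκ
  obtain ⟨r, hr, hball⟩ := Metric.isOpen_iff.1 κ.open_target _ hκκ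
  set s := Metric.ball (κ z₀) r with hs
  have hso : IsOpen s := Metric.isOpen_ball
  have hcs : κ z₀ ∈ s := Metric.mem_ball_self hr
  obtain ⟨hsm, hcl⟩ := TwoForm.pullback_smooth_closed hπ.symplectic (ψ := κ.symm)
    κ.open_target κ.contMDiffOn_invFun
  -- vectors tangent to the slices are vertical
  have hxd : ∀ w ∈ κ.target, ∀ a : 𝔼 × 𝔼,
      mfderiv (𝓡 N) 𝓘(ℝ, 𝔼) x (π (κ.symm w)) (mfderiv (𝓡 (2 * N)) (𝓡 N) π (κ.symm w)
        (mfderiv 𝓘(ℝ, 𝔼 × 𝔼) (𝓡 (2 * N)) κ.symm w a)) = a.2 := by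
    intro w hw a
    have h1 : HasMFDerivAt 𝓘(ℝ, 𝔼 × 𝔼) 𝓘(ℝ, 𝔼) (fun w => x (π (κ.symm w))) w
        ((mfderiv (𝓡 N) 𝓘(ℝ, 𝔼) x (π (κ.symm w))).comp
          ((mfderiv (𝓡 (2 * N)) (𝓡 N) π (κ.symm w)).comp
            (mfderiv 𝓘(ℝ, 𝔼 × 𝔼) (𝓡 (2 * N)) κ.symm w))) := by
      refine HasMFDerivAt.comp w (PDiffeo.mdifferentiableAt x
        (hκx _ (PDiffeo.map_target κ hw))).hasMFDerivAt ?_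
      exact HasMFDerivAt.comp w (hπ.mdifferentiableAt _).hasMFDerivAt
        (PDiffeo.mdifferentiableAt_symm κ hw).hasMFDerivAt
    have h2 : (fun w => x (π (κ.symm w))) =ᶠ[𝓝 w] Prod.snd := by
      filter_upwards [PDiffeo.target_mem_nhds κ hw] with y hy
      rw [← hκ2 _ (PDiffeo.map_target κ hy), PDiffeo.right_inv κ hy]
    have h3 : mvfderiv 𝓘(ℝ, 𝔼 × 𝔼) (fun w => x (π (κ.symm w))) w a =
        mvfderiv 𝓘(ℝ, 𝔼 × 𝔼) (Prod.snd : 𝔼 × 𝔼 → 𝔼) w a := by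
      rw [mvfderiv_congr h2]
    rw [mvfderiv_eq_fderiv Prod.snd w a, fderiv_snd] at h3
    refine Eq.trans ?_ h3
    exact (DFunLike.congr_fun h1.mfderiv a).symm
  have hvert : ∀ w ∈ κ.target, ∀ h : 𝔼, mfderiv (𝓡 (2 * N)) (𝓡 N) π (κ.symm w)
      (mfderiv 𝓘(ℝ, 𝔼 × 𝔼) (𝓡 (2 * N)) κ.symm w ((h, 0) : 𝔼 × 𝔼)) = 0 := by
    intro w hw h
    refine PDiffeo.mfderiv_injective x (hκx _ (PDiffeo.map_target κ hw)) ?_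
    rw [map_zero]
    exact hxd w hw (h, 0)
  -- the slices are Lagrangian, so the expression of the form in the chart has momenta
  obtain ⟨p, hp, hpη⟩ := exists_momenta (hsm.mono hball) (fun w hw => hcl w (hball hw))
    fun w hw h k => by
      rw [TwoForm.pullback_apply]
      exact hπ.lagrangian _ _ _ (hvert w (hball hw) h) (hvert w (hball hw) k)
  have hpd : ∀ w ∈ s, DifferentiableAt ℝ p w := fun w hw =>
    (hp.contDiffAt (hso.mem_nhds hw)).differentiableAt (by simp)
  -- a vector killed by `dp` and `dx` is in the kernel of the symplectic form
  have hinj : Function.Injective (fderiv ℝ (fun w : 𝔼 × 𝔼 => (p w, w.2)) (κ z₀)) := by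
    rw [((hpd _ hcs).hasFDerivAt.prodMk hasFDerivAt_snd).fderiv, injective_iff_map_eq_zero]
    intro a ha
    have ha1 : fderiv ℝ p (κ z₀) a = 0 := congrArg Prod.fst ha
    have ha2 : a.2 = 0 := congrArg Prod.snd ha
    refine PDiffeo.mfderiv_symm_injective κ hκκ ?_
    refine Eq.trans ?_ (map_zero (mfderiv 𝓘(ℝ, 𝔼 × 𝔼) (𝓡 (2 * N)) κ.symm (κ z₀))).symm
    refine hπ.symplectic.nondegenerate _ (mem_univ _) _ fun v => ?_
    obtain ⟨b, rfl⟩ := (PDiffeo.mfderiv_bijective κ.symm hκκ).2 v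
    refine (TwoForm.pullback_apply η κ.symm (κ z₀) a b).symm.trans ?_
    have h1 := hpη _ hcs a b
    rw [ha1, ha2, inner_zero_left, inner_zero_right, sub_zero] at h1
    exact h1
  have hbij : Function.Bijective (fderiv ℝ (fun w : 𝔼 × 𝔼 => (p w, w.2)) (κ z₀)) :=
    ⟨hinj, LinearMap.injective_iff_surjective.1 hinj⟩
  obtain ⟨Ψ, hΨ, hΨs, hΨf⟩ := exists_partialDiffeomorph_of_bijective
    (f := fun w : 𝔼 × 𝔼 => (p w, w.2)) hso (hp.prodMk contDiffOn_snd) hcs hbij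
  refine ⟨κ.trans Ψ, ⟨hκ, hΨ⟩, fun z hz => hκx z hz.1, fun z hz => ?_, fun z hz => ?_⟩
  · change (Ψ (κ z)).2 = _
    rw [hΨf]
    exact hκ2 z hz.1
  · have hfst : ∀ y, ((κ.trans Ψ) y).1 = p (κ y) := fun y => by
      change (Ψ (κ y)).1 = _
      rw [hΨf]
    filter_upwards [(κ.trans Ψ).open_source.mem_nhds hz] with y hy
    have hy2 : κ y ∈ s := hΨs hy.2
    refine ⟨?_, fun u v => ?_⟩
    · simp only [hfst]
      exact (contMDiffAt_iff_contDiffAt.2 (hp.contDiffAt (hso.mem_nhds hy2))).comp y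
        (PDiffeo.contMDiffAt κ hy.1)
    · have hd : ∀ u : TangentSpace (𝓡 (2 * N)) y, mvfderiv (𝓡 (2 * N)) (fun y => p (κ y)) y u =
          fderiv ℝ p (κ y) (mvfderiv (𝓡 (2 * N)) κ y u) := fun u =>
        mvfderiv_comp_fderiv (hpd _ hy2) (PDiffeo.mdifferentiableAt κ hy.1) u
      have hx2 : ∀ u : TangentSpace (𝓡 (2 * N)) y,
          mvfderiv (𝓡 (2 * N)) (fun y => x (π y)) y u = (mvfderiv (𝓡 (2 * N)) κ y u).2 := by
        intro u
        rw [← (mvfderiv_fst_snd (PDiffeo.mdifferentiableAt κ hy.1) u).2]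
        have h1 : (fun y => x (π y)) =ᶠ[𝓝 y] fun y => (κ y).2 := by
          filter_upwards [PDiffeo.source_mem_nhds κ hy.1] with y' hy' using (hκ2 y' hy').symm
        rw [mvfderiv_congr h1]
      simp only [hfst, hd, hx2]
      rw [← hpη _ hy2, TwoForm.pullback_apply]
      have hpt : κ.symm (κ y) = y := PDiffeo.left_inv κ hy.1
      have gen : ∀ (y' : X) (_ : y' = y) (u' v' : TangentSpace (𝓡 (2 * N)) y'),
          u' = (u : EuclideanSpace ℝ (Fin (2 * N))) → v' = (v : EuclideanSpace ℝ (Fin (2 * N))) →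
          η y ![u, v] = η y' ![u', v'] := by
        rintro y' rfl u' v' rfl rfl; rfl
      exact gen _ hpt _ _ (PDiffeo.mfderiv_symm_mfderiv κ hy.1 u)
        (PDiffeo.mfderiv_symm_mfderiv κ hy.1 v)

end Momenta

/-! ### Changes of momenta, and displacements in the fibres -/

section Transition

variable {N : ℕ}
  {X : Type*} [TopologicalSpace X] [ChartedSpace (EuclideanSpace ℝ (Fin (2 * N))) X]
  {B : Type*} [TopologicalSpace B] [ChartedSpace (EuclideanSpace ℝ (Fin N)) B]
  {η : TwoForm (𝓡 (2 * N)) X} {π : X → B}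

local notation "𝔼" => EuclideanSpace ℝ (Fin N)

/-- Near `y`, `g` is smooth and has a symmetric derivative, i.e. the 1-form with components `g` is
closed. -/
def IsGradientNear (g : 𝔼 → 𝔼) (y : 𝔼) : Prop :=
  ∀ᶠ y' in 𝓝 y, ContDiffAt ℝ ∞ g y' ∧
    ∀ u v : 𝔼, inner ℝ (fderiv ℝ g y' u) v = inner ℝ (fderiv ℝ g y' v) u

theorem IsGradientNear.sub {g h : 𝔼 → 𝔼} {y : 𝔼} (hg : IsGradientNear g y)
    (hh : IsGradientNear h y) : IsGradientNear (fun y' => g y' - h y') y := by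
  filter_upwards [hg, hh] with y' h1 h2
  refine ⟨h1.1.sub h2.1, fun u v => ?_⟩
  rw [fderiv_fun_sub (h1.1.differentiableAt (by simp)) (h2.1.differentiableAt (by simp))]
  simp only [sub_apply, inner_sub_left]
  rw [h1.2, h2.2]

omit [TopologicalSpace B] [ChartedSpace 𝔼 B] in
theorem IsMomentum.congr {x : B → 𝔼} {p p' : X → 𝔼} {z : X} (hp : IsMomentum η π x p z)
    (h : p =ᶠ[𝓝 z] p') : IsMomentum η π x p' z := by
  filter_upwards [hp, eventually_eventually_nhds.2 h] with z' h1 h2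
  refine ⟨h1.1.congr_of_eventuallyEq (h2.mono fun _ h => h.symm), fun u v => ?_⟩
  rw [h1.2, mvfderiv_congr h2]

omit [TopologicalSpace B] [ChartedSpace 𝔼 B] in
theorem IsMomentum.eventually {x : B → 𝔼} {p : X → 𝔼} {z : X} (hp : IsMomentum η π x p z) :
    ∀ᶠ z' in 𝓝 z, IsMomentum η π x p z' :=
  eventually_eventually_nhds.2 hp

omit [TopologicalSpace B] [ChartedSpace 𝔼 B] in
theorem IsMomentum.contMDiffAt {x : B → 𝔼} {p : X → 𝔼} {z : X} (hp : IsMomentum η π x p z) :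
    ContMDiffAt (𝓡 (2 * N)) 𝓘(ℝ, 𝔼) ∞ p z :=
  hp.self_of_nhds.1

omit [TopologicalSpace B] [ChartedSpace 𝔼 B] in
theorem IsMomentum.continuousAt {x : B → 𝔼} {p : X → 𝔼} {z : X} (hp : IsMomentum η π x p z) :
    ContinuousAt p z :=
  hp.contMDiffAt.continuousAt

variable {x : PartialDiffeomorph (𝓡 N) 𝓘(ℝ, EuclideanSpace ℝ (Fin N)) B (EuclideanSpace ℝ (Fin N)) ∞}

theorem contMDiffAt_base (hπ : IsIntegrableSystem η π) {z : X} (hz : π z ∈ x.source) :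
    ContMDiffAt (𝓡 (2 * N)) 𝓘(ℝ, 𝔼) ∞ (fun y => x (π y)) z :=
  (PDiffeo.contMDiffAt x hz).comp z (hπ.smooth z)

/-- Momenta may be changed by the components of a closed 1-form of the base. -/
theorem IsMomentum.add_gradient (hπ : IsIntegrableSystem η π) {p : X → 𝔼} {z : X}
    (hz : π z ∈ x.source) (hp : IsMomentum η π x p z) {g : 𝔼 → 𝔼}
    (hg : IsGradientNear g (x (π z))) :
    IsMomentum η π x (fun y => p y + g (x (π y))) z := by
  have hx := contMDiffAt_base (x := x) hπ hz
  filter_upwards [hp, hx.continuousAt.eventually hg,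
    hπ.smooth.continuous.continuousAt.eventually_mem (PDiffeo.source_mem_nhds x hz)] with y h1 h2 h3
  have hxy := contMDiffAt_base (x := x) hπ h3
  have hgy : ContMDiffAt (𝓡 (2 * N)) 𝓘(ℝ, 𝔼) ∞ (fun y => g (x (π y))) y :=
    (contMDiffAt_iff_contDiffAt.2 h2.1).comp y hxy
  have hd : ∀ u : TangentSpace (𝓡 (2 * N)) y,
      mvfderiv (𝓡 (2 * N)) (fun y => p y + g (x (π y))) y u =
        mvfderiv (𝓡 (2 * N)) p y u +
          fderiv ℝ g (x (π y)) (mvfderiv (𝓡 (2 * N)) (fun y => x (π y)) y u) := by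
    intro u
    have h4 := mvfderiv_comp_fderiv (f := fun y => x (π y)) (h2.1.differentiableAt (by simp))
      (hxy.mdifferentiableAt (by simp)) u
    rw [← h4]
    have := mvfderiv_fun_add (h1.1.mdifferentiableAt (by simp)) (hgy.mdifferentiableAt (by simp))
    rw [this]; rfl
  refine ⟨h1.1.add hgy, fun u v => ?_⟩
  rw [hd, hd, inner_add_left, inner_add_left, h1.2, h2.2]
  ring

theorem IsMomentumChart.mvfderiv_snd {κ : PartialDiffeomorph (𝓡 (2 * N)) 𝓘(ℝ, 𝔼 × 𝔼) X (𝔼 × 𝔼) ∞}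
    (hκ : IsMomentumChart η π x κ) {w : 𝔼 × 𝔼} (hw : w ∈ κ.target) (a : 𝔼 × 𝔼) :
    mvfderiv (𝓡 (2 * N)) (fun y => x (π y)) (κ.symm w)
      (mfderiv 𝓘(ℝ, 𝔼 × 𝔼) (𝓡 (2 * N)) κ.symm w a) = a.2 := by
  have h1 : (fun y => x (π y)) =ᶠ[𝓝 (κ.symm w)] fun y => (κ y).2 := by
    filter_upwards [PDiffeo.source_mem_nhds κ (PDiffeo.map_target κ hw)] with y hy using
      (hκ.snd_eq y hy).symm
  rw [mvfderiv_congr h1,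
    (mvfderiv_fst_snd (PDiffeo.mdifferentiableAt κ (PDiffeo.map_target κ hw)) _).2]
  exact congrArg Prod.snd (PDiffeo.mfderiv_mfderiv_symm κ hw a)

theorem IsMomentumChart.mvfderiv_fst {κ : PartialDiffeomorph (𝓡 (2 * N)) 𝓘(ℝ, 𝔼 × 𝔼) X (𝔼 × 𝔼) ∞}
    {w : 𝔼 × 𝔼} (hw : w ∈ κ.target) (a : 𝔼 × 𝔼) :
    mvfderiv (𝓡 (2 * N)) (fun y => (κ y).1) (κ.symm w)
      (mfderiv 𝓘(ℝ, 𝔼 × 𝔼) (𝓡 (2 * N)) κ.symm w a) = a.1 := by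
  rw [(mvfderiv_fst_snd (PDiffeo.mdifferentiableAt κ (PDiffeo.map_target κ hw)) _).1]
  exact congrArg Prod.fst (PDiffeo.mfderiv_mfderiv_symm κ hw a)

/-- The momenta of a momentum chart determine all the others, up to the components of a closed
1-form of the base. -/
theorem IsMomentumChart.exists_gradient
    {κ : PartialDiffeomorph (𝓡 (2 * N)) 𝓘(ℝ, 𝔼 × 𝔼) X (𝔼 × 𝔼) ∞}
    (hκ : IsMomentumChart η π x κ) {z : X} (hz : z ∈ κ.source) {p : X → 𝔼}
    (hp : IsMomentum η π x p z) :
    ∃ g, IsGradientNear g (x (π z)) ∧ ∀ᶠ z' in 𝓝 z, p z' = (κ z').1 + g (x (π z')) := by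
  have hw := PDiffeo.map_source κ hz
  have hsz : κ.symm (κ z) = z := PDiffeo.left_inv κ hz
  have h1 : ∀ᶠ w in 𝓝 (κ z), w ∈ κ.target ∧ (ContMDiffAt (𝓡 (2 * N)) 𝓘(ℝ, 𝔼) ∞ p (κ.symm w) ∧
    ∀ u v : TangentSpace (𝓡 (2 * N)) (κ.symm w), η (κ.symm w) ![u, v] =
      inner ℝ (mvfderiv (𝓡 (2 * N)) p (κ.symm w) u)
        (mvfderiv (𝓡 (2 * N)) (fun y => x (π y)) (κ.symm w) v) -
      inner ℝ (mvfderiv (𝓡 (2 * N)) p (κ.symm w) v)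
        (mvfderiv (𝓡 (2 * N)) (fun y => x (π y)) (κ.symm w) u)) := by
    refine (show ∀ᶠ w in 𝓝 (κ z), w ∈ κ.target from PDiffeo.target_mem_nhds κ hw).and ?_
    have := PDiffeo.continuousAt_symm κ hw
    rw [ContinuousAt, hsz] at this
    exact this.eventually hp
  obtain ⟨r, hr, hball⟩ := Metric.eventually_nhds_iff_ball.1 h1
  set G : 𝔼 × 𝔼 → 𝔼 := fun w => p (κ.symm w) with hG
  have hGs : ∀ w ∈ Metric.ball (κ z) r, ContDiffAt ℝ ∞ G w := fun w hw =>
    contMDiffAt_iff_contDiffAt.1 ((hball w hw).2.1.comp w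
      (PDiffeo.contMDiffAt_symm κ (hball w hw).1))
  obtain ⟨g, hg, hgs, hgG⟩ := momenta_sub_eq hr (G := G) (c := κ z)
    (fun w hw => (hGs w hw).contDiffWithinAt) (by
      intro w hw a b
      obtain ⟨hwt, hps, hpη⟩ := hball w hw
      have hd : ∀ a : 𝔼 × 𝔼, fderiv ℝ G w a = mvfderiv (𝓡 (2 * N)) p (κ.symm w)
          (mfderiv 𝓘(ℝ, 𝔼 × 𝔼) (𝓡 (2 * N)) κ.symm w a) := fun a => by
        have h4 := mvfderiv_comp_mfderiv (f := κ.symm) (hps.mdifferentiableAt (by simp))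
          (PDiffeo.mdifferentiableAt_symm κ hwt) a
        exact (mvfderiv_eq_fderiv G w a).symm.trans h4
      have h2 := hpη (mfderiv 𝓘(ℝ, 𝔼 × 𝔼) (𝓡 (2 * N)) κ.symm w a)
        (mfderiv 𝓘(ℝ, 𝔼 × 𝔼) (𝓡 (2 * N)) κ.symm w b)
      have h3 := (hκ.momentum _ (PDiffeo.map_target κ hwt)).self_of_nhds.2
        (mfderiv 𝓘(ℝ, 𝔼 × 𝔼) (𝓡 (2 * N)) κ.symm w a)
        (mfderiv 𝓘(ℝ, 𝔼 × 𝔼) (𝓡 (2 * N)) κ.symm w b)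
      rw [hκ.mvfderiv_snd hwt, hκ.mvfderiv_snd hwt, ← hd, ← hd] at h2
      rw [hκ.mvfderiv_snd hwt, hκ.mvfderiv_snd hwt, IsMomentumChart.mvfderiv_fst hwt,
        IsMomentumChart.mvfderiv_fst hwt] at h3
      exact h2.symm.trans h3)
  have hx2 : (κ z).2 = x (π z) := hκ.snd_eq z hz
  refine ⟨g, ?_, ?_⟩
  · rw [IsGradientNear, ← hx2]
    filter_upwards [Metric.ball_mem_nhds (κ z).2 hr] with y hy
    exact ⟨hg.contDiffAt (Metric.isOpen_ball.mem_nhds hy), hgs y hy⟩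
  · filter_upwards [PDiffeo.source_mem_nhds κ hz,
      (PDiffeo.continuousAt κ hz).eventually_mem (Metric.ball_mem_nhds (κ z) hr)] with y hy hy'
    have := hgG _ hy'
    rw [hκ.snd_eq y hy] at this
    rw [← this, hG]
    simp only
    rw [PDiffeo.left_inv κ hy]

variable [IsManifold (𝓡 (2 * N)) ∞ X]

/-- Two systems of momenta differ by the components of a closed 1-form of the base. -/
theorem IsMomentum.exists_gradient (hπ : IsIntegrableSystem η π) {z : X} (hz : π z ∈ x.source)
    {p p' : X → 𝔼} (hp : IsMomentum η π x p z) (hp' : IsMomentum η π x p' z) :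
    ∃ g, IsGradientNear g (x (π z)) ∧ ∀ᶠ z' in 𝓝 z, p' z' = p z' + g (x (π z')) := by
  obtain ⟨κ, hκz, hκ⟩ := exists_momentumChart hπ x hz
  obtain ⟨g, hg, h⟩ := hκ.exists_gradient hκz hp
  obtain ⟨g', hg', h'⟩ := hκ.exists_gradient hκz hp'
  refine ⟨_, hg'.sub hg, ?_⟩
  filter_upwards [h, h'] with y h1 h2
  rw [h1, h2]; abel

/-- The displacement between two nearby points of a fibre does not depend on the momenta used to
measure it. -/
theorem IsMomentum.sub_eq_sub (hπ : IsIntegrableSystem η π) {z : X} (hz : π z ∈ x.source)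
    {p p' : X → 𝔼} (hp : IsMomentum η π x p z) (hp' : IsMomentum η π x p' z) :
    ∀ᶠ q : X × X in 𝓝 (z, z), π q.1 = π q.2 → p' q.1 - p' q.2 = p q.1 - p q.2 := by
  obtain ⟨g, -, h⟩ := hp.exists_gradient hπ hz hp'
  filter_upwards [(continuous_fst.tendsto (z, z)).eventually h,
    (continuous_snd.tendsto (z, z)).eventually h] with q h1 h2 h3
  rw [h1, h2, h3]; abel

/-- Momenta are coordinates on the fibres. -/
theorem IsMomentum.eq_of_eq (hπ : IsIntegrableSystem η π) {z : X} (hz : π z ∈ x.source)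
    {p : X → 𝔼} (hp : IsMomentum η π x p z) :
    ∀ᶠ q : X × X in 𝓝 (z, z), π q.1 = π q.2 → p q.1 = p q.2 → q.1 = q.2 := by
  obtain ⟨κ, hκz, hκ⟩ := exists_momentumChart hπ x hz
  have hs := PDiffeo.source_mem_nhds κ hκz
  filter_upwards [hp.sub_eq_sub hπ hz (hκ.momentum z hκz),
    (continuous_fst.tendsto (z, z)).eventually hs,
    (continuous_snd.tendsto (z, z)).eventually hs]
    with q h1 h2 h3 h4 h5
  have h6 := h1 h4
  rw [h5, sub_self, sub_eq_zero] at h6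
  have h7 : κ q.1 = κ q.2 := Prod.ext h6 (by rw [hκ.snd_eq _ h2, hκ.snd_eq _ h3, h4])
  rw [← PDiffeo.left_inv κ h2, h7, PDiffeo.left_inv κ h3]

/-- `c` is a curve in a fibre with displacement `d`, as measured by momenta. -/
structure HasDisplacement {S : Type*} [TopologicalSpace S] (η : TwoForm (𝓡 (2 * N)) X) (π : X → B)
    (x : B → 𝔼) (b : B) (c : S → X) (d : S → 𝔼) : Prop where
  continuous : Continuous c
  vertical : ∀ s, π (c s) = b
  displacement : ∀ s, ∃ p, IsMomentum η π x p (c s) ∧ ∀ᶠ s' in 𝓝 s, p (c s') - p (c s) = d s' - d s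

/-- A curve in a fibre is determined by its displacement and one of its points: two such curves
agree on an open and closed set of parameters. This replaces the uniqueness of the integral curves
of the Hamiltonian vector fields. -/
theorem HasDisplacement.eq [T2Space X] (hπ : IsIntegrableSystem η π) {S : Type*}
    [TopologicalSpace S] [PreconnectedSpace S] {b : B} (hb : b ∈ x.source) {c c' : S → X} {d : S → 𝔼}
    (h : HasDisplacement η π x b c d) (h' : HasDisplacement η π x b c' d) {s₀ : S}
    (h0 : c s₀ = c' s₀) (s : S) : c s = c' s := by
  have hclopen : IsClopen {s | c s = c' s} := by
    refine ⟨isClosed_eq h.continuous h'.continuous, isOpen_iff_mem_nhds.2 fun s hs => ?_⟩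
    obtain ⟨p, hp, hpd⟩ := h.displacement s
    obtain ⟨p', hp', hpd'⟩ := h'.displacement s
    have hs' : c s = c' s := hs
    rw [← hs'] at hp' hpd'
    have hz : π (c s) ∈ x.source := by rwa [h.vertical]
    have t1 : Tendsto (fun s' => (c s', c' s')) (𝓝 s) (𝓝 (c s, c s)) := by
      have := h.continuous.continuousAt.prodMk_nhds (h'.continuous.continuousAt (x := s))
      rwa [← hs'] at this
    have t2 : Tendsto (fun s' => (c' s', c s)) (𝓝 s) (𝓝 (c s, c s)) := by
      have := (h'.continuous.continuousAt (x := s)).prodMk_nhds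
        (continuousAt_const (x := s) (y := c s))
      rwa [← hs'] at this
    filter_upwards [hpd, hpd', t2.eventually (hp.sub_eq_sub hπ hz hp'),
      t1.eventually (hp.eq_of_eq hπ hz)] with s' h1 h2 h3 h4
    refine h4 (by rw [h.vertical, h'.vertical]) ?_
    have h5 := h3 (by rw [h.vertical, h'.vertical])
    rw [h2, ← h1] at h5
    simpa using h5
  have : {s | c s = c' s} = univ := (isClopen_iff.1 hclopen).resolve_left
    (Set.nonempty_iff_ne_empty.1 ⟨s₀, h0⟩)
  exact this.ge (mem_univ s)

end Transition

/-! ### Momentum charts of uniform size -/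

section PartialDiffeomorphs

variable {E : Type*} [NormedAddCommGroup E] [NormedSpace ℝ E]
  {H : Type*} [TopologicalSpace H] {I : ModelWithCorners ℝ E H}
  {M : Type*} [TopologicalSpace M] [ChartedSpace H M]
  {E' : Type*} [NormedAddCommGroup E'] [NormedSpace ℝ E']
  {H' : Type*} [TopologicalSpace H'] {J : ModelWithCorners ℝ E' H'}
  {M' : Type*} [TopologicalSpace M'] [ChartedSpace H' M']

theorem PDiffeo.isOpen_inter_preimage (Φ : PartialDiffeomorph I J M M' ∞) {s : Set M'}
    (hs : IsOpen s) : IsOpen (Φ.source ∩ Φ ⁻¹' s) :=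
  Φ.contMDiffOn_toFun.continuousOn.isOpen_inter_preimage Φ.open_source hs

/-- The restriction of a partial diffeomorphism to the preimage of an open set. -/
noncomputable def PDiffeo.corestr (Φ : PartialDiffeomorph I J M M' ∞) (s : Set M')
    (hs : IsOpen s) : PartialDiffeomorph I J M M' ∞ :=
  PDiffeo.restr Φ (Φ.source ∩ Φ ⁻¹' s) (PDiffeo.isOpen_inter_preimage Φ hs)

theorem PDiffeo.corestr_source (Φ : PartialDiffeomorph I J M M' ∞) (s : Set M') (hs : IsOpen s) :
    (PDiffeo.corestr Φ s hs).source = Φ.source ∩ Φ ⁻¹' s := by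
  rw [PDiffeo.corestr, PDiffeo.restr_source, ← inter_assoc, inter_self]

theorem PDiffeo.corestr_target (Φ : PartialDiffeomorph I J M M' ∞) {s : Set M'} (hs : IsOpen s)
    (hsub : s ⊆ Φ.target) : (PDiffeo.corestr Φ s hs).target = s := by
  rw [PDiffeo.corestr, PDiffeo.restr_target]
  ext w
  constructor
  · rintro ⟨hw, -, h⟩
    have h' : Φ (Φ.symm w) ∈ s := h
    rwa [PDiffeo.right_inv Φ hw] at h'
  · intro hw
    refine ⟨hsub hw, PDiffeo.map_target Φ (hsub hw), ?_⟩
    change Φ (Φ.symm w) ∈ s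
    rwa [PDiffeo.right_inv Φ (hsub hw)]

end PartialDiffeomorphs

section Boxes

variable {N : ℕ}
  {X : Type*} [TopologicalSpace X] [ChartedSpace (EuclideanSpace ℝ (Fin (2 * N))) X]
  {B : Type*} [TopologicalSpace B] [ChartedSpace (EuclideanSpace ℝ (Fin N)) B]
  {η : TwoForm (𝓡 (2 * N)) X} {π : X → B} [IsManifold (𝓡 (2 * N)) ∞ X] [IsManifold (𝓡 N) ∞ B]

local notation "𝔼" => EuclideanSpace ℝ (Fin N)

/-- A submersion is open, since it is a projection in suitable coordinates. -/
theorem IsIntegrableSystem.isOpenMap (hπ : IsIntegrableSystem η π) : IsOpenMap π := by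
  refine isOpenMap_iff_nhds_le.2 fun z => ?_
  let x := chartPDiffeo (𝓡 N) (π z)
  have hx : π z ∈ x.source := mem_extChartAt_source (I := 𝓡 N) (π z)
  obtain ⟨κ, hκ, hκx, hκ2⟩ := exists_submersion_chart hπ x hx
  intro s hs
  have h1 : κ.symm ⁻¹' (π ⁻¹' s) ∈ 𝓝 (κ z) := by
    have h := PDiffeo.continuousAt_symm κ (PDiffeo.map_source κ hκ)
    rw [ContinuousAt, PDiffeo.left_inv κ hκ] at h
    exact h hs
  have h2 := Filter.inter_mem h1 (PDiffeo.target_mem_nhds κ (PDiffeo.map_source κ hκ))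
  have h3 : Prod.snd '' (κ.symm ⁻¹' (π ⁻¹' s) ∩ κ.target) ∈ 𝓝 (x (π z)) := by
    rw [← hκ2 z hκ]
    exact isOpenMap_snd.image_mem_nhds h2
  filter_upwards [(PDiffeo.continuousAt x hx).preimage_mem_nhds h3,
    PDiffeo.source_mem_nhds x hx] with b hb hbx
  obtain ⟨w, ⟨hw, hwt⟩, hwb⟩ := hb
  have hws := PDiffeo.map_target κ hwt
  have h4 := hκ2 _ hws
  rw [PDiffeo.right_inv κ hwt, hwb] at h4
  have h5 : b = π (κ.symm w) := by
    rw [← PDiffeo.left_inv x hbx, h4, PDiffeo.left_inv x (hκx _ hws)]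
  rw [h5]; exact hw

/-- The fibres of an integrable system form a proper family. -/
theorem IsIntegrableSystem.exists_preimage_subset [T2Space X] [T2Space B]
    (hπ : IsIntegrableSystem η π) {b₀ : B} {O : Set X} (hO : IsOpen O) (hsub : π ⁻¹' {b₀} ⊆ O) :
    ∃ U : Set B, IsOpen U ∧ b₀ ∈ U ∧ π ⁻¹' U ⊆ O := by
  have : LocallyCompactSpace X :=
    ChartedSpace.locallyCompactSpace (EuclideanSpace ℝ (Fin (2 * N))) X
  obtain ⟨V, hV, hFV, hVO, hVc⟩ :=
    exists_open_between_and_isCompact_closure (hπ.compact_fibre b₀) hO hsub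
  have hfc : IsClosed (π '' frontier V) :=
    ((hVc.of_isClosed_subset isClosed_frontier frontier_subset_closure).image
      hπ.smooth.continuous).isClosed
  refine ⟨π '' V ∩ (π '' frontier V)ᶜ, (hπ.isOpenMap V hV).inter hfc.isOpen_compl, ⟨?_, ?_⟩, ?_⟩
  · obtain ⟨z, hz⟩ := (hπ.connected_fibre b₀).nonempty
    exact ⟨z, hFV hz, hz⟩
  · rintro ⟨z, hz, hzb⟩
    exact (hV.frontier_eq ▸ hz).2 (hFV hzb)
  · rintro z ⟨⟨y, hyV, hyz⟩, hz⟩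
    have h1 : π ⁻¹' {π z} ⊆ V := by
      refine (hπ.connected_fibre (π z)).isPreconnected.subset_left_of_subset_union hV
        (isClosed_closure (s := V)).isOpen_compl
        (disjoint_compl_right.mono_left subset_closure) ?_ ⟨y, hyz, hyV⟩
      intro y' hy'
      by_contra hcon
      simp only [mem_union, mem_compl_iff, not_or, not_not] at hcon
      exact hz ⟨y', hV.frontier_eq ▸ ⟨hcon.2, hcon.1⟩, hy'⟩
    exact hVO (subset_closure (h1 rfl))

/-- A momentum chart whose image is the product of a convex open set with the image of the chart of
the base. -/
structure IsMomentumBox (η : TwoForm (𝓡 (2 * N)) X) (π : X → B)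
    (x : PartialDiffeomorph (𝓡 N) 𝓘(ℝ, 𝔼) B 𝔼 ∞)
    (κ : PartialDiffeomorph (𝓡 (2 * N)) 𝓘(ℝ, 𝔼 × 𝔼) X (𝔼 × 𝔼) ∞) (A : Set 𝔼) : Prop where
  chart : IsMomentumChart η π x κ
  isOpen : IsOpen A
  convex : Convex ℝ A
  target_eq : κ.target = A ×ˢ x.target

/-- Near a fibre, there are momentum charts of uniform size. -/
theorem exists_momentumBoxes [T2Space X] [T2Space B] (hπ : IsIntegrableSystem η π)
    (x₀ : PartialDiffeomorph (𝓡 N) 𝓘(ℝ, 𝔼) B 𝔼 ∞) {b₀ : B} (hb₀ : b₀ ∈ x₀.source) :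
    ∃ x : PartialDiffeomorph (𝓡 N) 𝓘(ℝ, 𝔼) B 𝔼 ∞, b₀ ∈ x.source ∧ x.source ⊆ x₀.source ∧
      (∀ b, x b = x₀ b) ∧ (∃ ρ > 0, x.target = Metric.ball (x b₀) ρ) ∧
      ∃ ε > 0, ∀ z, π z ∈ x.source → ∃ κ A, IsMomentumBox η π x κ A ∧ z ∈ κ.source ∧
        Metric.ball (κ z).1 ε ⊆ A := by
  have h1 : ∀ z : π ⁻¹' {b₀}, ∃ κ : PartialDiffeomorph (𝓡 (2 * N)) 𝓘(ℝ, 𝔼 × 𝔼) X (𝔼 × 𝔼) ∞,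
      (z : X) ∈ κ.source ∧ IsMomentumChart η π x₀ κ ∧ ∃ r > 0,
        Metric.ball (κ z).1 (2 * r) ×ˢ Metric.ball (x₀ b₀) r ⊆ κ.target := by
    rintro ⟨z, hz⟩
    have hz' : π z = b₀ := hz
    obtain ⟨κ, hκz, hκ⟩ := exists_momentumChart hπ x₀ (z₀ := z) (by rwa [hz'])
    obtain ⟨r, hr, hball⟩ := Metric.isOpen_iff.1 κ.open_target _ (PDiffeo.map_source κ hκz)
    refine ⟨κ, hκz, hκ, r / 2, half_pos hr, Subset.trans ?_ hball⟩
    rintro ⟨u, v⟩ ⟨hu, hv⟩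
    rw [← ball_prod_same]
    refine ⟨by simpa [mul_div_cancel₀] using hu, ?_⟩
    rw [hκ.snd_eq z hκz, hz']
    exact Metric.ball_subset_ball (by linarith) hv
  choose κ hκz hκ r hr hball using h1
  set O : π ⁻¹' {b₀} → Set X := fun z =>
    (κ z).source ∩ κ z ⁻¹' (Metric.ball (κ z z).1 (r z) ×ˢ univ) with hO
  have hOo : ∀ z, IsOpen (O z) := fun z =>
    PDiffeo.isOpen_inter_preimage (κ z) (Metric.isOpen_ball.prod isOpen_univ)
  obtain ⟨T, hT⟩ := (hπ.compact_fibre b₀).elim_finite_subcover O hOo fun z hz =>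
    mem_iUnion.2 ⟨⟨z, hz⟩, hκz ⟨z, hz⟩, Metric.mem_ball_self (hr _), mem_univ _⟩
  obtain ⟨V, hV, hbV, hVO⟩ := hπ.exists_preimage_subset
    (isOpen_biUnion fun z (_ : z ∈ T) => hOo z) hT
  obtain ⟨ε, hε, hεr⟩ : ∃ ε > 0, ∀ z ∈ T, ε ≤ r z := by
    rcases T.eq_empty_or_nonempty with rfl | hne
    · exact ⟨1, one_pos, by simp⟩
    · exact ⟨T.inf' hne r, by rw [gt_iff_lt, Finset.lt_inf'_iff]; exact fun z _ => hr z,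
        fun z hz => Finset.inf'_le r hz⟩
  have h2 : x₀.target ∩ x₀.symm ⁻¹' V ∈ 𝓝 (x₀ b₀) := by
    refine Filter.inter_mem (PDiffeo.target_mem_nhds x₀ (PDiffeo.map_source x₀ hb₀)) ?_
    refine (PDiffeo.continuousAt_symm x₀ (PDiffeo.map_source x₀ hb₀)).preimage_mem_nhds ?_
    rw [PDiffeo.left_inv x₀ hb₀]
    exact hV.mem_nhds hbV
  obtain ⟨ρ, hρ, hρs⟩ := Metric.mem_nhds_iff.1 h2
  have hδ : 0 < min ρ ε := lt_min hρ hε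
  have hsub : Metric.ball (x₀ b₀) (min ρ ε) ⊆ x₀.target ∩ x₀.symm ⁻¹' V :=
    (Metric.ball_subset_ball (min_le_left _ _)).trans hρs
  set x := PDiffeo.corestr x₀ (Metric.ball (x₀ b₀) (min ρ ε)) Metric.isOpen_ball with hx
  have hxs : x.source = x₀.source ∩ x₀ ⁻¹' Metric.ball (x₀ b₀) (min ρ ε) :=
    PDiffeo.corestr_source _ _ _
  have hxt : x.target = Metric.ball (x₀ b₀) (min ρ ε) :=
    PDiffeo.corestr_target _ _ (hsub.trans inter_subset_left)
  refine ⟨x, hxs ▸ ⟨hb₀, Metric.mem_ball_self hδ⟩, hxs ▸ inter_subset_left, fun b => rfl,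
    ⟨_, hδ, hxt⟩, ε, hε, fun z hz => ?_⟩
  rw [hxs] at hz
  have hzV : π z ∈ V := by
    have := (hsub hz.2).2
    rwa [mem_preimage, PDiffeo.left_inv x₀ hz.1] at this
  obtain ⟨k, hkT, hzk⟩ := mem_iUnion₂.1 (hVO hzV)
  have hprod : IsOpen (Metric.ball (κ k k).1 (2 * r k) ×ˢ Metric.ball (x₀ b₀) (min ρ ε)) :=
    Metric.isOpen_ball.prod Metric.isOpen_ball
  refine ⟨PDiffeo.corestr (κ k) _ hprod, Metric.ball (κ k k).1 (2 * r k),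
    ⟨⟨fun y hy => ?_, fun y hy => ?_, fun y hy => ?_⟩, Metric.isOpen_ball, convex_ball _ _, ?_⟩,
    ?_, ?_⟩
  · rw [PDiffeo.corestr_source] at hy
    rw [hxs]
    refine ⟨(hκ k).mem_source y hy.1, ?_⟩
    have := hy.2.2
    rwa [(hκ k).snd_eq y hy.1] at this
  · rw [PDiffeo.corestr_source] at hy
    exact (hκ k).snd_eq y hy.1
  · rw [PDiffeo.corestr_source] at hy
    exact (hκ k).momentum y hy.1
  · rw [PDiffeo.corestr_target _ _ ?_, hxt]
    refine Subset.trans (prod_mono le_rfl ?_) (hball k)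
    exact Metric.ball_subset_ball ((min_le_right _ _).trans (hεr k hkT))
  · rw [PDiffeo.corestr_source]
    refine ⟨hzk.1, ?_, ?_⟩
    · exact Metric.ball_subset_ball (by linarith [hr k]) hzk.2.1
    · rw [(hκ k).snd_eq z hzk.1]; exact hz.2
  · refine Metric.ball_subset_ball' ?_
    have h3 : dist (κ k z).1 (κ k k).1 < r k := hzk.2.1
    change ε + dist (κ k z).1 (κ k k).1 ≤ _
    linarith [hεr k hkT]

end Boxes

/-! ### Integration of the Hamiltonian vector fields -/

/-- Induction along the doublings of a vector: it propagates properties of a local action to the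
action that it generates. -/
theorem induction_double {V : Type*} [NormedAddCommGroup V] [NormedSpace ℝ V] {P : V → Prop} {ε : ℝ}
    (hε : 0 < ε) (small : ∀ t, ‖t‖ < ε → P t) (double : ∀ t, P t → P (t + t)) (t : V) : P t := by
  obtain ⟨n, hn⟩ := pow_unbounded_of_one_lt (‖t‖ / ε) one_lt_two
  rw [div_lt_iff₀ hε] at hn
  induction n generalizing t with
  | zero => exact small t (by simpa using hn)
  | succ n ih =>
    have h := double _ (ih ((2 : ℝ)⁻¹ • t) (by
      rw [norm_smul, norm_inv, Real.norm_ofNat]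
      rw [pow_succ] at hn
      linarith))
    rwa [← add_smul, show (2 : ℝ)⁻¹ + 2⁻¹ = 1 by norm_num, one_smul] at h

section Action

variable {N : ℕ}
  {X : Type*} [TopologicalSpace X] [ChartedSpace (EuclideanSpace ℝ (Fin (2 * N))) X]
  {B : Type*} [TopologicalSpace B] [ChartedSpace (EuclideanSpace ℝ (Fin N)) B]
  {η : TwoForm (𝓡 (2 * N)) X} {π : X → B}
  {x : PartialDiffeomorph (𝓡 N) 𝓘(ℝ, EuclideanSpace ℝ (Fin N)) B (EuclideanSpace ℝ (Fin N)) ∞}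

local notation "𝔼" => EuclideanSpace ℝ (Fin N)

theorem isGradientNear_const (t y : 𝔼) : IsGradientNear (fun _ => t) y :=
  Eventually.of_forall fun y' => ⟨contDiffAt_const, fun u v => by simp⟩

/-- The points of a momentum box with the same base coordinates as `z` lie in the fibre of `z`. -/
theorem IsMomentumBox.map_add {κ : PartialDiffeomorph (𝓡 (2 * N)) 𝓘(ℝ, 𝔼 × 𝔼) X (𝔼 × 𝔼) ∞}
    {A : Set 𝔼} (hκ : IsMomentumBox η π x κ A) {z : X} (hz : z ∈ κ.source) {a : 𝔼} (ha : a ∈ A) :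
    κ.symm (a, x (π z)) ∈ κ.source ∧ κ (κ.symm (a, x (π z))) = (a, x (π z)) ∧
      π (κ.symm (a, x (π z))) = π z := by
  have h1 : (a, x (π z)) ∈ κ.target := by
    rw [hκ.target_eq]
    exact ⟨ha, PDiffeo.map_source x (hκ.chart.mem_source z hz)⟩
  have h2 := PDiffeo.map_target κ h1
  have h3 := PDiffeo.right_inv κ h1
  refine ⟨h2, h3, ?_⟩
  have h4 := hκ.chart.snd_eq _ h2
  rw [h3] at h4
  rw [← PDiffeo.left_inv x (hκ.chart.mem_source _ h2), ← h4,
    PDiffeo.left_inv x (hκ.chart.mem_source z hz)]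

theorem IsMomentumBox.fst_mem {κ : PartialDiffeomorph (𝓡 (2 * N)) 𝓘(ℝ, 𝔼 × 𝔼) X (𝔼 × 𝔼) ∞}
    {A : Set 𝔼} (hκ : IsMomentumBox η π x κ A) {z : X} (hz : z ∈ κ.source) : (κ z).1 ∈ A := by
  have h := PDiffeo.map_source κ hz
  rw [hκ.target_eq] at h
  exact h.1

/-- Segments in a momentum box are curves in a fibre with the obvious displacement. -/
theorem IsMomentumBox.hasDisplacement
    {κ : PartialDiffeomorph (𝓡 (2 * N)) 𝓘(ℝ, 𝔼 × 𝔼) X (𝔼 × 𝔼) ∞}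
    {A : Set 𝔼} (hκ : IsMomentumBox η π x κ A) {z : X} (hz : z ∈ κ.source) {t : 𝔼}
    (ht : (κ z).1 + t ∈ A) :
    HasDisplacement η π x (π z) (fun s : unitInterval => κ.symm ((κ z).1 + (s : ℝ) • t, x (π z)))
      (fun s => (s : ℝ) • t) := by
  have hA : ∀ s : unitInterval, (κ z).1 + (s : ℝ) • t ∈ A := fun s =>
    hκ.convex.add_smul_mem (hκ.fst_mem hz) ht s.2
  have h := fun s : unitInterval => hκ.map_add hz (hA s)
  have hmem : ∀ s : unitInterval, ((κ z).1 + (s : ℝ) • t, x (π z)) ∈ κ.target := fun s => by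
    rw [hκ.target_eq]
    exact ⟨hA s, PDiffeo.map_source x (hκ.chart.mem_source z hz)⟩
  refine ⟨?_, fun s => (h s).2.2, fun s => ⟨fun y => (κ y).1,
    hκ.chart.momentum _ (h s).1, Eventually.of_forall fun s' => ?_⟩⟩
  · exact κ.symm.contMDiffOn_toFun.continuousOn.comp_continuous (by fun_prop) hmem
  · change (κ (κ.symm ((κ z).1 + (s' : ℝ) • t, x (π z)))).1 -
      (κ (κ.symm ((κ z).1 + (s : ℝ) • t, x (π z)))).1 = _
    rw [(h s).2.1, (h s').2.1]
    simp

variable [IsManifold (𝓡 (2 * N)) ∞ X]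

/-- The translations by `t` in two momentum boxes coincide. -/
theorem IsMomentumBox.symm_eq_symm [T2Space X] (hπ : IsIntegrableSystem η π)
    {κ κ' : PartialDiffeomorph (𝓡 (2 * N)) 𝓘(ℝ, 𝔼 × 𝔼) X (𝔼 × 𝔼) ∞}
    {A A' : Set 𝔼} (hκ : IsMomentumBox η π x κ A) (hκ' : IsMomentumBox η π x κ' A') {z : X}
    (hz : z ∈ κ.source) (hz' : z ∈ κ'.source) {t : 𝔼} (ht : (κ z).1 + t ∈ A)
    (ht' : (κ' z).1 + t ∈ A') :
    κ.symm ((κ z).1 + t, x (π z)) = κ'.symm ((κ' z).1 + t, x (π z)) := by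
  have h1 : κ.symm ((κ z).1, x (π z)) = z := by
    rw [← hκ.chart.snd_eq z hz]; exact PDiffeo.left_inv κ hz
  have h2 : κ'.symm ((κ' z).1, x (π z)) = z := by
    rw [← hκ'.chart.snd_eq z hz']; exact PDiffeo.left_inv κ' hz'
  have h := (hκ.hasDisplacement hz ht).eq hπ (hκ.chart.mem_source z hz)
    (hκ'.hasDisplacement hz' ht') (s₀ := 0)
    (by simp only [Icc.coe_zero, zero_smul, add_zero]; exact h1.trans h2.symm) 1
  simpa using h

/-- `H` is an action of the vector group on the part of `X` over the domain of `x`, along the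
fibres, whose orbit maps are affine for the momenta: it is generated by the Hamiltonian vector
fields of the coordinates `x`. -/
structure IsFibreAction (η : TwoForm (𝓡 (2 * N)) X) (π : X → B)
    (x : PartialDiffeomorph (𝓡 N) 𝓘(ℝ, 𝔼) B 𝔼 ∞) (H : 𝔼 → X → X) : Prop where
  proj : ∀ t z, π (H t z) = π z
  zero : ∀ z, H 0 z = z
  add : ∀ s t z, H (s + t) z = H s (H t z)
  smooth : ∀ t z, π z ∈ x.source →
    ContMDiffAt (𝓘(ℝ, 𝔼).prod (𝓡 (2 * N))) (𝓡 (2 * N)) ∞ (fun q : 𝔼 × X => H q.1 q.2) (t, z)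
  momentum : ∀ z, π z ∈ x.source → ∀ p, IsMomentum η π x p z →
    ∀ᶠ q : 𝔼 × X in 𝓝 (0, z), p (H q.1 q.2) = p q.2 + q.1
  isMomentum_comp : ∀ t z, π z ∈ x.source → ∀ p, IsMomentum η π x p (H t z) →
    IsMomentum η π x (fun y => p (H t y)) z
  free : ∃ ε > 0, ∀ t z, π z ∈ x.source → ‖t‖ < ε → H t z = z → t = 0

open Classical in
/-- The translations in momentum boxes of uniform size define a local action: they do not depend on
the box. -/
theorem exists_localAction [T2Space X] (hπ : IsIntegrableSystem η π) {ε : ℝ} (hε : 0 < ε)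
    (hx : ∀ z, π z ∈ x.source → ∃ κ A, IsMomentumBox η π x κ A ∧ z ∈ κ.source ∧
        Metric.ball (κ z).1 ε ⊆ A) :
    ∃ T : 𝔼 → X → X, T 0 = id ∧ (∀ s t : 𝔼, ‖s‖ + ‖t‖ < ε → T (s + t) = T s ∘ T t) ∧
      (∀ t z, π (T t z) = π z) ∧ ∀ κ A, IsMomentumBox η π x κ A → ∀ z ∈ κ.source, ∀ t : 𝔼,
        ‖t‖ < ε → (κ z).1 + t ∈ A → T t z = κ.symm ((κ z).1 + t, x (π z)) := by
  choose κ A hκ hz hball using hx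
  have hA : ∀ z (h : π z ∈ x.source) (t : 𝔼), ‖t‖ < ε → (κ z h z).1 + t ∈ A z h := fun z h t ht =>
    hball z h (by simpa using ht)
  set T : 𝔼 → X → X := fun t z =>
    if h : π z ∈ x.source ∧ ‖t‖ < ε then (κ z h.1).symm ((κ z h.1 z).1 + t, x (π z)) else z with hT
  have hT1 : ∀ z (h : π z ∈ x.source) (t : 𝔼), ‖t‖ < ε →
      T t z = (κ z h).symm ((κ z h z).1 + t, x (π z)) := fun z h t ht => dif_pos ⟨h, ht⟩
  have hT0 : ∀ z (t : 𝔼), π z ∉ x.source → T t z = z := fun z t h => dif_neg fun h' => h h'.1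
  have hTκ : ∀ κ A, IsMomentumBox η π x κ A → ∀ z ∈ κ.source, ∀ t : 𝔼,
      ‖t‖ < ε → (κ z).1 + t ∈ A → T t z = κ.symm ((κ z).1 + t, x (π z)) := by
    intro κ' A' hκ' z hz' t ht htA
    have h := hκ'.chart.mem_source z hz'
    rw [hT1 z h t ht]
    exact (hκ z h).symm_eq_symm hπ hκ' (hz z h) hz' (hA z h t ht) htA
  have hTπ : ∀ t z, π (T t z) = π z := by
    intro t z
    by_cases h : π z ∈ x.source ∧ ‖t‖ < ε
    · rw [hT1 z h.1 t h.2]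
      exact ((hκ z h.1).map_add (hz z h.1) (hA z h.1 t h.2)).2.2
    · exact congrArg π (dif_neg h)
  refine ⟨T, ?_, ?_, hTπ, hTκ⟩
  · ext z
    by_cases h : π z ∈ x.source
    · rw [hT1 z h 0 (by simpa using hε), add_zero, ← (hκ z h).chart.snd_eq z (hz z h)]
      exact PDiffeo.left_inv _ (hz z h)
    · exact hT0 z 0 h
  · intro s t hst
    ext z
    by_cases h : π z ∈ x.source
    · have ht : ‖t‖ < ε := by linarith [norm_nonneg s]
      have hs : ‖s‖ < ε := by linarith [norm_nonneg t]
      have hst' : ‖t + s‖ < ε := (norm_add_le _ _).trans_lt (by linarith)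
      obtain ⟨h1, h2, h3⟩ := (hκ z h).map_add (hz z h) (hA z h t ht)
      have h4 : (κ z h (T t z)).1 + s = (κ z h z).1 + (t + s) := by
        rw [hT1 z h t ht, h2, add_assoc]
      rw [Function.comp_apply, hTκ _ _ (hκ z h) (T t z) (hT1 z h t ht ▸ h1) s hs
        (h4 ▸ hA z h _ hst'), h4, hTπ, add_comm s t, hT1 z h _ hst']
    · rw [Function.comp_apply, hT0 z t h, hT0 z _ h, hT0 z _ h]

/-- Integration of the Hamiltonian vector fields of coordinates of the base. -/
theorem exists_isFibreAction [T2Space X] (hπ : IsIntegrableSystem η π) {ε : ℝ} (hε : 0 < ε)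
    (hx : ∀ z, π z ∈ x.source → ∃ κ A, IsMomentumBox η π x κ A ∧ z ∈ κ.source ∧
        Metric.ball (κ z).1 ε ⊆ A) :
    ∃ H : 𝔼 → X → X, IsFibreAction η π x H := by
  obtain ⟨T, hT0, hTadd, hTπ, hTκ⟩ := exists_localAction hπ hε hx
  obtain ⟨H, hHadd, hHT⟩ := exists_action_of_local_action hε hT0 hTadd
  have hadd : ∀ s t z, H (s + t) z = H s (H t z) := fun s t z => congrFun (hHadd s t) z
  have hzero : ∀ z, H 0 z = z := fun z => by rw [hHT 0 (by simpa using hε), hT0]; rfl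
  have hproj : ∀ t z, π (H t z) = π z := by
    refine induction_double hε (fun t ht z => ?_) fun t h z => ?_
    · rw [hHT t ht, hTπ]
    · rw [hadd, h, h]
  -- in a box, small elements act by translations
  have hloc : ∀ κ A, IsMomentumBox η π x κ A → ∀ z ∈ κ.source, ∀ t : 𝔼, ‖t‖ < ε →
      (κ z).1 + t ∈ A → ∀ᶠ q : 𝔼 × X in 𝓝 (t, z), q.2 ∈ κ.source ∧ H q.1 q.2 ∈ κ.source ∧
        κ (H q.1 q.2) = ((κ q.2).1 + q.1, (κ q.2).2) ∧
        H q.1 q.2 = κ.symm ((κ q.2).1 + q.1, (κ q.2).2) := by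
    intro κ A hκ z hz t ht htA
    have hc : ContinuousAt (fun q : 𝔼 × X => (κ q.2).1 + q.1) (t, z) := by
      refine (continuousAt_fst.comp ?_).add continuousAt_fst
      exact ContinuousAt.comp (g := κ) (PDiffeo.continuousAt κ hz) continuousAt_snd
    have h1 : ∀ᶠ q : 𝔼 × X in 𝓝 (t, z), ‖q.1‖ < ε :=
      (continuous_fst.norm.tendsto (t, z)).eventually_lt_const ht
    filter_upwards [h1, hc.eventually_mem (hκ.isOpen.mem_nhds htA),
      (continuous_snd.tendsto (t, z)).eventually (PDiffeo.source_mem_nhds κ hz)] with q hq hqA hqκ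
    have hqκ' : q.2 ∈ κ.source := hqκ
    have h2 := hTκ κ A hκ q.2 hqκ q.1 hq hqA
    obtain ⟨h3, h4, -⟩ := hκ.map_add hqκ' hqA
    rw [hHT _ hq, h2, hκ.chart.snd_eq _ hqκ']
    exact ⟨hqκ', h3, h4, rfl⟩
  have hsmooth : ∀ t z, π z ∈ x.source → ContMDiffAt (𝓘(ℝ, 𝔼).prod (𝓡 (2 * N))) (𝓡 (2 * N)) ∞
      (fun q : 𝔼 × X => H q.1 q.2) (t, z) := by
    refine induction_double hε (fun t ht z hz => ?_) fun t h z hz => ?_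
    · obtain ⟨κ, A, hκ, hzκ, hball⟩ := hx z hz
      have hA : (κ z).1 + t ∈ A := hball (by simpa using ht)
      have hmem : ((κ z).1 + t, (κ z).2) ∈ κ.target := by
        rw [hκ.target_eq, hκ.chart.snd_eq z hzκ]
        exact ⟨hA, PDiffeo.map_source x hz⟩
      have h1 : ContMDiffAt (𝓘(ℝ, 𝔼).prod (𝓡 (2 * N))) 𝓘(ℝ, 𝔼 × 𝔼) ∞
          (fun q : 𝔼 × X => κ q.2) (t, z) :=
        ContMDiffAt.comp (t, z) (g := κ) (PDiffeo.contMDiffAt κ hzκ) contMDiffAt_snd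
      have h2 : ContMDiffAt (𝓘(ℝ, 𝔼).prod (𝓡 (2 * N))) 𝓘(ℝ, 𝔼 × 𝔼) ∞
          (fun q : 𝔼 × X => ((κ q.2).1 + q.1, (κ q.2).2)) (t, z) := by
        refine ContMDiffAt.prodMk_space (ContMDiffAt.add ?_ contMDiffAt_fst) ?_
        · exact ContMDiffAt.comp (t, z) (g := (Prod.fst : 𝔼 × 𝔼 → 𝔼))
            contDiff_fst.contMDiff.contMDiffAt h1
        · exact ContMDiffAt.comp (t, z) (g := (Prod.snd : 𝔼 × 𝔼 → 𝔼))
            contDiff_snd.contMDiff.contMDiffAt h1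
      refine ContMDiffAt.congr_of_eventuallyEq (ContMDiffAt.comp (t, z) (g := κ.symm)
        (PDiffeo.contMDiffAt_symm κ hmem) h2) ?_
      filter_upwards [hloc κ A hκ z hzκ t ht hA] with q hq using hq.2.2.2
    -- the action of `t + t` is, near it, the square of the action of half the group element
    · have hhalf : ContMDiffAt (𝓘(ℝ, 𝔼).prod (𝓡 (2 * N))) 𝓘(ℝ, 𝔼) ∞
          (fun q : 𝔼 × X => (2 : ℝ)⁻¹ • q.1) (t + t, z) :=
        ContMDiffAt.comp (t + t, z) (g := fun v : 𝔼 => (2 : ℝ)⁻¹ • v)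
          (contDiff_const_smul _).contMDiff.contMDiffAt contMDiffAt_fst
      have hval : (2 : ℝ)⁻¹ • (t + t) = t := by
        rw [← two_smul ℝ t, smul_smul]; norm_num
      have h1 : ContMDiffAt (𝓘(ℝ, 𝔼).prod (𝓡 (2 * N))) (𝓡 (2 * N)) ∞
          (fun q : 𝔼 × X => H ((2 : ℝ)⁻¹ • q.1) q.2) (t + t, z) := by
        refine ContMDiffAt.comp (t + t, z) (g := fun q : 𝔼 × X => H q.1 q.2)
          (f := fun q : 𝔼 × X => ((2 : ℝ)⁻¹ • q.1, q.2)) ?_ (hhalf.prodMk contMDiffAt_snd)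
        change ContMDiffAt _ _ _ _ ((2 : ℝ)⁻¹ • (t + t), z)
        rw [hval]
        exact h z hz
      have h2 : ContMDiffAt (𝓘(ℝ, 𝔼).prod (𝓡 (2 * N))) (𝓡 (2 * N)) ∞
          (fun q : 𝔼 × X => H ((2 : ℝ)⁻¹ • q.1) (H ((2 : ℝ)⁻¹ • q.1) q.2)) (t + t, z) := by
        refine ContMDiffAt.comp (t + t, z) (g := fun q : 𝔼 × X => H q.1 q.2)
          (f := fun q : 𝔼 × X => ((2 : ℝ)⁻¹ • q.1, H ((2 : ℝ)⁻¹ • q.1) q.2)) ?_ (hhalf.prodMk h1)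
        change ContMDiffAt _ _ _ _ ((2 : ℝ)⁻¹ • (t + t), H ((2 : ℝ)⁻¹ • (t + t)) z)
        rw [hval]
        exact h _ (by rwa [hproj])
      refine h2.congr_of_eventuallyEq (Eventually.of_forall fun q => ?_)
      change H q.1 q.2 = H ((2 : ℝ)⁻¹ • q.1) (H ((2 : ℝ)⁻¹ • q.1) q.2)
      rw [← hadd, ← add_smul, show (2 : ℝ)⁻¹ + 2⁻¹ = 1 by norm_num, one_smul]
  refine ⟨H, hproj, hzero, hadd, hsmooth, fun z hz p hp => ?_, ?_, ε, hε, fun t z hz ht h => ?_⟩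
  · obtain ⟨κ, A, hκ, hzκ, hball⟩ := hx z hz
    obtain ⟨g, -, hg⟩ := hκ.chart.exists_gradient hzκ hp
    have hc : Tendsto (fun q : 𝔼 × X => H q.1 q.2) (𝓝 (0, z)) (𝓝 z) := by
      have := (hsmooth 0 z hz).continuousAt
      rw [ContinuousAt, hzero] at this
      exact this
    filter_upwards [hloc κ A hκ z hzκ 0 (by simpa using hε) (by simpa using hκ.fst_mem hzκ),
      hc.eventually hg, (continuous_snd.tendsto ((0 : 𝔼), z)).eventually hg] with q h1 h2 h3
    rw [h2, h3, h1.2.2.1, hproj]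
    dsimp only
    abel
  · refine induction_double hε (fun t ht z hz p hp => ?_) fun t h z hz p hp => ?_
    · obtain ⟨κ, A, hκ, hzκ, hball⟩ := hx z hz
      have hev := hloc κ A hκ z hzκ t ht (hball (by simpa using ht))
      have hm : H t z ∈ κ.source := hev.self_of_nhds.2.1
      obtain ⟨g, hgg, hg⟩ := hκ.chart.exists_gradient hm hp
      rw [hproj] at hgg
      have hin : Tendsto (fun y : X => (t, y)) (𝓝 z) (𝓝 (t, z)) :=
        (Continuous.prodMk_right t).tendsto z
      have hc : Tendsto (fun y : X => H t y) (𝓝 z) (𝓝 (H t z)) :=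
        (hsmooth t z hz).continuousAt.tendsto.comp hin
      refine IsMomentum.congr (((hκ.chart.momentum z hzκ).add_gradient hπ hz hgg).add_gradient
        hπ hz (isGradientNear_const t _)) ?_
      filter_upwards [hc.eventually hg, hin.eventually hev] with y h1 h2
      rw [h1, h2.2.2.1, hproj]
      dsimp only
      abel
    · have h1 : IsMomentum η π x (fun y => p (H t y)) (H t z) := by
        refine h _ (by rwa [hproj]) p ?_
        rwa [← hadd]
      refine (h z hz _ h1).congr (Eventually.of_forall fun y => ?_)
      simp only [hadd]
  · obtain ⟨κ, A, hκ, hzκ, hball⟩ := hx z hz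
    have h1 := (hloc κ A hκ z hzκ t ht (hball (by simpa using ht))).self_of_nhds.2.2.1
    simp only [h] at h1
    have h2 := congrArg Prod.fst h1
    simpa using h2

end Action

/-! ### Orbits and the period lattice -/

section Orbits

variable {N : ℕ}
  {X : Type*} [TopologicalSpace X] [ChartedSpace (EuclideanSpace ℝ (Fin (2 * N))) X]
  {B : Type*} [TopologicalSpace B] [ChartedSpace (EuclideanSpace ℝ (Fin N)) B]
  {η : TwoForm (𝓡 (2 * N)) X} {π : X → B}
  {x : PartialDiffeomorph (𝓡 N) 𝓘(ℝ, EuclideanSpace ℝ (Fin N)) B (EuclideanSpace ℝ (Fin N)) ∞}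
  {H : EuclideanSpace ℝ (Fin N) → X → X}

local notation "𝔼" => EuclideanSpace ℝ (Fin N)

theorem IsFibreAction.continuousAt (hH : IsFibreAction η π x H) {t : 𝔼} {z : X}
    (hz : π z ∈ x.source) : ContinuousAt (fun q : 𝔼 × X => H q.1 q.2) (t, z) :=
  (hH.smooth t z hz).continuousAt

theorem IsFibreAction.comm (hH : IsFibreAction η π x H) (s t : 𝔼) (z : X) :
    H s (H t z) = H t (H s z) := by
  rw [← hH.add, add_comm, hH.add]

theorem IsFibreAction.sub (hH : IsFibreAction η π x H) (s t : 𝔼) (z : X) :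
    H (s - t) (H t z) = H s z := by
  rw [← hH.add, sub_add_cancel]

/-- The period lattice: the vectors that act trivially on a fibre. -/
def IsFibreAction.lattice (hH : IsFibreAction η π x H) (b : B) : AddSubgroup 𝔼 where
  carrier := {t | ∀ z, π z = b → H t z = z}
  zero_mem' := fun z _ => hH.zero z
  add_mem' := fun {s t} hs ht z hz => by rw [hH.add, ht z hz, hs z hz]
  neg_mem' := fun {t} ht z hz => by
    conv_lhs => rw [← ht z hz]
    rw [← hH.add, neg_add_cancel, hH.zero]

/-- The period lattices are discrete, uniformly over the base. -/
theorem IsFibreAction.lattice_discrete (hπ : IsIntegrableSystem η π)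
    (hH : IsFibreAction η π x H) :
    ∃ ε > 0, ∀ b ∈ x.source, ∀ t ∈ hH.lattice b, ‖t‖ < ε → t = 0 := by
  obtain ⟨ε, hε, h⟩ := hH.free
  refine ⟨ε, hε, fun b hb t ht hlt => ?_⟩
  obtain ⟨z, hz⟩ := (hπ.connected_fibre b).nonempty
  have hz' : π z = b := hz
  exact h t z (hz' ▸ hb) hlt (ht z hz')

/-- A continuous curve in the vector group acts on a point by a curve in the fibre with the same
displacement. -/
theorem IsFibreAction.hasDisplacement (hH : IsFibreAction η π x H)
    (hmom : ∀ z, π z ∈ x.source → ∃ p, IsMomentum η π x p z) {S : Type*} [TopologicalSpace S]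
    {d : S → 𝔼} (hd : Continuous d) {z : X} (hz : π z ∈ x.source) :
    HasDisplacement η π x (π z) (fun s => H (d s) z) d := by
  refine ⟨?_, fun s => hH.proj _ _, fun s => ?_⟩
  · refine continuous_iff_continuousAt.2 fun s => ?_
    exact ContinuousAt.comp (f := fun s => (d s, z)) (g := fun q : 𝔼 × X => H q.1 q.2)
      (hH.continuousAt hz) (hd.continuousAt.prodMk_nhds continuousAt_const)
  · have hz' : π (H (d s) z) ∈ x.source := by rwa [hH.proj]
    obtain ⟨p, hp⟩ := hmom _ hz'
    refine ⟨p, hp, ?_⟩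
    have h1 : Tendsto (fun s' => (d s' - d s, H (d s) z)) (𝓝 s) (𝓝 (0, H (d s) z)) := by
      have : Continuous fun s' => (d s' - d s, H (d s) z) := by fun_prop
      simpa using this.tendsto s
    filter_upwards [h1.eventually (hH.momentum _ hz' p hp)] with s' h
    rw [hH.sub] at h
    rw [h]; abel

variable [IsManifold (𝓡 (2 * N)) ∞ X]

theorem exists_isMomentum (hπ : IsIntegrableSystem η π)
    (x : PartialDiffeomorph (𝓡 N) 𝓘(ℝ, 𝔼) B 𝔼 ∞) {z : X} (hz : π z ∈ x.source) :
    ∃ p, IsMomentum η π x p z := by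
  obtain ⟨κ, hκz, hκ⟩ := exists_momentumChart hπ x hz
  exact ⟨_, hκ.momentum z hκz⟩

/-- Nearby points of a fibre are related by the action of their displacement. -/
theorem IsFibreAction.eventually_eq (hπ : IsIntegrableSystem η π)
    (hH : IsFibreAction η π x H) {z : X} (hz : π z ∈ x.source) {p : X → 𝔼}
    (hp : IsMomentum η π x p z) :
    ∀ᶠ q : X × X in 𝓝 (z, z), π q.1 = π q.2 → q.1 = H (p q.1 - p q.2) q.2 := by
  have h1 : Tendsto (fun q : X × X => (p q.1 - p q.2, q.2)) (𝓝 (z, z)) (𝓝 (0, z)) := by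
    have hp1 : ContinuousAt (fun q : X × X => p q.1) (z, z) :=
      ContinuousAt.comp (f := Prod.fst) (g := p) hp.continuousAt continuousAt_fst
    have hp2 : ContinuousAt (fun q : X × X => p q.2) (z, z) :=
      ContinuousAt.comp (f := Prod.snd) (g := p) hp.continuousAt continuousAt_snd
    have := (hp1.sub hp2).prodMk_nhds (continuous_snd.tendsto (z, z))
    simpa using this
  have h2 : Tendsto (fun q : X × X => (q.1, H (p q.1 - p q.2) q.2)) (𝓝 (z, z)) (𝓝 (z, z)) := by
    have h3 : Tendsto (fun q : X × X => H (p q.1 - p q.2) q.2) (𝓝 (z, z)) (𝓝 z) := by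
      have := (hH.continuousAt (t := 0) hz).tendsto.comp h1
      rw [hH.zero] at this
      exact this
    exact (continuous_fst.tendsto (z, z)).prodMk_nhds h3
  filter_upwards [h1.eventually (hH.momentum z hz p hp), h2.eventually (hp.eq_of_eq hπ hz)]
    with q h3 h4 h5
  refine h4 (by rw [hH.proj, h5]) ?_
  rw [h3]; abel

/-- The action is transitive on the fibres. -/
theorem IsFibreAction.exists_eq (hπ : IsIntegrableSystem η π) (hH : IsFibreAction η π x H) {z z' : X}
    (hz : π z ∈ x.source) (h : π z' = π z) : ∃ t, H t z = z' := by
  refine (hπ.connected_fibre (π z)).isPreconnected.induction₂ (fun y y' => ∃ t, H t y = y')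
    (fun y hy => ?_) ?_ ?_ (x := z) (y := z') rfl h
  · have hy' : π y = π z := hy
    obtain ⟨p, hp⟩ := exists_isMomentum hπ x (z := y) (by rwa [hy'])
    have h1 : Tendsto (fun y' => (y', y)) (𝓝 y) (𝓝 (y, y)) := (Continuous.prodMk_left y).tendsto y
    filter_upwards [nhdsWithin_le_nhds (h1.eventually
      (hH.eventually_eq hπ (by rwa [hy']) hp)), self_mem_nhdsWithin] with y' h2 h3
    exact ⟨_, (h2 (Eq.trans h3 hy'.symm)).symm⟩
  · rintro a b c - - - ⟨s, rfl⟩ ⟨t, rfl⟩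
    exact ⟨t + s, hH.add _ _ _⟩
  · rintro a b - - ⟨s, rfl⟩
    exact ⟨-s, by rw [← hH.add, neg_add_cancel, hH.zero]⟩

/-- Since the action is commutative and transitive on the fibres, an element that fixes one point of
a fibre acts trivially on it. -/
theorem IsFibreAction.mem_lattice_of_eq (hπ : IsIntegrableSystem η π)
    (hH : IsFibreAction η π x H) {z : X} (hz : π z ∈ x.source) {t : 𝔼} (h : H t z = z) :
    t ∈ hH.lattice (π z) := by
  intro z' hz'
  obtain ⟨s, rfl⟩ := hH.exists_eq hπ hz hz'
  rw [hH.comm, h]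

/-- The differential of the coordinates `x` of the base at a tangent vector. -/
noncomputable def baseDeriv (x : B → 𝔼) (V : TangentBundle (𝓡 N) B) : 𝔼 :=
  mvfderiv (𝓡 N) x V.proj V.snd

omit [IsManifold (𝓡 (2 * N)) ∞ X] in
/-- The lifts of a tangent vector of the base exist, and have its components. -/
theorem mvfderiv_liftAt (hπ : IsIntegrableSystem η π) {V : TangentBundle (𝓡 N) B} {z : X}
    (hz : π z = V.proj) (hV : V.proj ∈ x.source) :
    mvfderiv (𝓡 (2 * N)) (fun y => x (π y)) z (liftAt π V z) = baseDeriv x V := by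
  have hex : ∃ ξ : TangentSpace (𝓡 (2 * N)) z,
      tangentMap (𝓡 (2 * N)) (𝓡 N) π (⟨z, ξ⟩ : TangentBundle (𝓡 (2 * N)) X) = V := by
    obtain ⟨b, v⟩ := V
    have hz' : π z = b := hz
    subst hz'
    obtain ⟨ξ, hξ⟩ := hπ.submersion z v
    exact ⟨ξ, by rw [tangentMap]; exact congrArg _ hξ⟩
  have hlift : tangentMap (𝓡 (2 * N)) (𝓡 N) π
      (⟨z, liftAt π V z⟩ : TangentBundle (𝓡 (2 * N)) X) = V := by
    rw [liftAt, dif_pos hex]; exact hex.choose_spec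
  have h1 := mvfderiv_comp_mfderiv (f := π) (g := x) (z := z)
    (PDiffeo.mdifferentiableAt x (by rwa [hz])) (hπ.mdifferentiableAt z) (liftAt π V z)
  rw [h1]
  conv_rhs => rw [← hlift]
  rfl

omit [IsManifold (𝓡 (2 * N)) ∞ X] in
/-- The velocity of a curve in a fibre is vertical. -/
theorem mvfderiv_vertical (hπ : IsIntegrableSystem η π) {γ : ℝ → X} {s : ℝ}
    (hγ : MDifferentiableAt 𝓘(ℝ, ℝ) (𝓡 (2 * N)) γ s) (hs : π (γ s) ∈ x.source)
    (hv : ∀ s', π (γ s') = π (γ s)) (a : ℝ) :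
    mvfderiv (𝓡 (2 * N)) (fun y => x (π y)) (γ s) (mfderiv 𝓘(ℝ, ℝ) (𝓡 (2 * N)) γ s a) = 0 := by
  have h1 := mvfderiv_comp_mfderiv (f := γ) (g := fun y => x (π y)) (z := s)
    ((contMDiffAt_base hπ hs).mdifferentiableAt (by simp)) hγ a
  rw [← h1]
  have h2 : (fun s' => x (π (γ s'))) = fun _ => x (π (γ s)) := funext fun s' => by rw [hv]
  rw [h2, mvfderiv_eq_fderiv (F := ℝ) (fun _ => x (π (γ s))) s a]
  simp

omit [IsManifold (𝓡 (2 * N)) ∞ X] in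
/-- The integrand of a period, in terms of momenta. -/
theorem IsMomentum.apply_liftAt (hπ : IsIntegrableSystem η π) {γ : ℝ → X} {s : ℝ}
    (hγ : MDifferentiableAt 𝓘(ℝ, ℝ) (𝓡 (2 * N)) γ s) {V : TangentBundle (𝓡 N) B}
    (hV : V.proj ∈ x.source) (hv : ∀ s', π (γ s') = V.proj) {p : X → 𝔼}
    (hp : IsMomentum η π x p (γ s)) :
    η (γ s) ![mfderiv 𝓘(ℝ, ℝ) (𝓡 (2 * N)) γ s (1 : ℝ), liftAt π V (γ s)] =
      inner ℝ (deriv (fun s' => p (γ s')) s) (baseDeriv x V) := by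
  rw [hp.self_of_nhds.2, mvfderiv_liftAt hπ (hv s) hV, mvfderiv_vertical hπ hγ (by rwa [hv])
    (fun s' => by rw [hv, hv]), inner_zero_right, sub_zero]
  congr 1
  have h1 := mvfderiv_comp_mfderiv (f := γ) (g := p) (z := s)
    (hp.contMDiffAt.mdifferentiableAt (by simp)) hγ (1 : ℝ)
  rw [← h1, mvfderiv_eq_fderiv (F := ℝ) (fun s' => p (γ s')) s 1]
  exact fderiv_apply_one_eq_deriv

omit [IsManifold (𝓡 (2 * N)) ∞ X] in
theorem baseDeriv_surjective {b : B} (hb : b ∈ x.source) (a : 𝔼) :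
    ∃ V : TangentBundle (𝓡 N) B, V.proj = b ∧ baseDeriv x V = a := by
  obtain ⟨v, hv⟩ := (PDiffeo.mfderiv_bijective x hb).2 a
  exact ⟨⟨b, v⟩, rfl, hv⟩

end Orbits

/-! ### Periods and displacements -/

section Periods

variable {N : ℕ}
  {X : Type*} [TopologicalSpace X] [ChartedSpace (EuclideanSpace ℝ (Fin (2 * N))) X]
  {B : Type*} [TopologicalSpace B] [ChartedSpace (EuclideanSpace ℝ (Fin N)) B]
  {η : TwoForm (𝓡 (2 * N)) X} {π : X → B}
  {x : PartialDiffeomorph (𝓡 N) 𝓘(ℝ, EuclideanSpace ℝ (Fin N)) B (EuclideanSpace ℝ (Fin N)) ∞}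
  {H : EuclideanSpace ℝ (Fin N) → X → X}

local notation "𝔼" => EuclideanSpace ℝ (Fin N)

theorem contMDiff_slice {Γ : ℝ → ℝ → X}
    (hΓ : ContMDiff 𝓘(ℝ, ℝ × ℝ) (𝓡 (2 * N)) ∞ (fun p : ℝ × ℝ => Γ p.1 p.2)) (t : ℝ) :
    ContMDiff 𝓘(ℝ, ℝ) (𝓡 (2 * N)) ∞ (Γ t) := by
  have h : ContMDiff 𝓘(ℝ, ℝ) 𝓘(ℝ, ℝ × ℝ) ∞ (fun s : ℝ => (t, s)) :=
    (contDiff_prodMk_right t).contMDiff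
  exact hΓ.comp h

variable [IsManifold (𝓡 (2 * N)) ∞ X]

/-- A family of curves in the fibres is obtained from the action by integrating a velocity, and the
periods are the pairings with the total displacements. -/
theorem IsFibreAction.exists_displacement [T2Space X] (hπ : IsIntegrableSystem η π)
    (hH : IsFibreAction η π x H) {Γ : ℝ → ℝ → X}
    (hΓ : ContMDiff 𝓘(ℝ, ℝ × ℝ) (𝓡 (2 * N)) ∞ (fun p : ℝ × ℝ => Γ p.1 p.2))
    (hv : ∀ t s, π (Γ t s) = π (Γ t 0)) :
    ∃ a : ℝ × ℝ → 𝔼, (∀ t s, π (Γ t 0) ∈ x.source → ContinuousAt a (t, s)) ∧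
      (∀ t s, π (Γ t 0) ∈ x.source → Γ t s = H (∫ u in (0 : ℝ)..s, a (t, u)) (Γ t 0)) ∧
      ∀ t (V : TangentBundle (𝓡 N) B), V.proj = π (Γ t 0) → V.proj ∈ x.source →
        period η π V (Γ t) =
          1 / (2 * Real.pi) * inner ℝ (∫ u in (0 : ℝ)..1, a (t, u)) (baseDeriv x V) := by
  classical
  -- the velocity, as measured by arbitrary momenta near the curve
  set a : ℝ × ℝ → 𝔼 := fun q =>
    if h : ∃ p, IsMomentum η π x p (Γ q.1 q.2) then
      fderiv ℝ (fun q' : ℝ × ℝ => h.choose (Γ q'.1 q'.2)) q (0, 1) else 0 with ha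
  have hpd : ∀ (p : X → 𝔼) (q : ℝ × ℝ), IsMomentum η π x p (Γ q.1 q.2) →
      ContDiffAt ℝ ∞ (fun q' : ℝ × ℝ => p (Γ q'.1 q'.2)) q := fun p q hp =>
    contMDiffAt_iff_contDiffAt.1
      (ContMDiffAt.comp q (f := fun q : ℝ × ℝ => Γ q.1 q.2) hp.contMDiffAt (hΓ q))
  have hderiv : ∀ (p : X → 𝔼) (t s : ℝ), IsMomentum η π x p (Γ t s) →
      HasDerivAt (fun s' => p (Γ t s'))
        (fderiv ℝ (fun q' : ℝ × ℝ => p (Γ q'.1 q'.2)) (t, s) (0, 1)) s := by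
    intro p t s hp
    have h1 : HasDerivAt (fun s' : ℝ => (t, s')) ((0 : ℝ), (1 : ℝ)) s :=
      (hasDerivAt_const s t).prodMk (hasDerivAt_id s)
    exact HasFDerivAt.comp_hasDerivAt s (f := fun s' : ℝ => (t, s'))
      ((hpd p (t, s) hp).differentiableAt (by simp)).hasFDerivAt h1
  have hηa : ∀ (p : X → 𝔼) (t s : ℝ), IsMomentum η π x p (Γ t s) →
      ∀ V : TangentBundle (𝓡 N) B, V.proj = π (Γ t 0) → V.proj ∈ x.source →
      η (Γ t s) ![mfderiv 𝓘(ℝ, ℝ) (𝓡 (2 * N)) (Γ t) s (1 : ℝ), liftAt π V (Γ t s)] =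
        inner ℝ (fderiv ℝ (fun q' : ℝ × ℝ => p (Γ q'.1 q'.2)) (t, s) (0, 1)) (baseDeriv x V) := by
    intro p t s hp V hV hVx
    rw [hp.apply_liftAt hπ ((contMDiff_slice hΓ t).mdifferentiable (by simp) s) hVx
      (fun s' => by rw [hv, hV]), (hderiv p t s hp).deriv]
  -- the velocity is determined by the symplectic form, hence independent of the momenta
  have haE : ∀ (p : X → 𝔼) (t s : ℝ), π (Γ t 0) ∈ x.source → IsMomentum η π x p (Γ t s) →
      a (t, s) = fderiv ℝ (fun q' : ℝ × ℝ => p (Γ q'.1 q'.2)) (t, s) (0, 1) := by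
    intro p t s hx hp
    have h : ∃ p, IsMomentum η π x p (Γ t s) := ⟨p, hp⟩
    have h1 : a (t, s) = fderiv ℝ (fun q' : ℝ × ℝ => h.choose (Γ q'.1 q'.2)) (t, s) (0, 1) :=
      dif_pos h
    rw [h1]
    refine ext_inner_right ℝ fun w => ?_
    obtain ⟨V, hV, rfl⟩ := baseDeriv_surjective hx w
    rw [← hηa _ t s h.choose_spec V hV (hV ▸ hx), ← hηa _ t s hp V hV (hV ▸ hx)]
  have hcont : ∀ t s, π (Γ t 0) ∈ x.source → ContinuousAt a (t, s) := by
    intro t s hx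
    obtain ⟨p, hp⟩ := exists_isMomentum hπ x (z := Γ t s) (by rwa [hv])
    have h1 : ContinuousAt (fun q : ℝ × ℝ =>
        fderiv ℝ (fun q' : ℝ × ℝ => p (Γ q'.1 q'.2)) q (0, 1)) (t, s) :=
      (((hpd p (t, s) hp).fderiv_right (m := ∞) (by simp)).continuousAt).clm_apply
        continuousAt_const
    refine h1.congr ?_
    have hc : Tendsto (fun q : ℝ × ℝ => Γ q.1 q.2) (𝓝 (t, s)) (𝓝 (Γ t s)) :=
      hΓ.continuous.tendsto (t, s)
    have h2 : ∀ᶠ q : ℝ × ℝ in 𝓝 (t, s), π (Γ q.1 q.2) ∈ x.source :=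
      (hπ.smooth.continuous.continuousAt.tendsto.comp hc).eventually
        (PDiffeo.source_mem_nhds x (by rwa [hv]))
    filter_upwards [hc.eventually hp.eventually, h2] with q h3 h4
    exact (haE p q.1 q.2 (by rwa [hv] at h4) h3).symm
  refine ⟨a, hcont, fun t s hx => ?_, fun t V hV hVx => ?_⟩
  · have hat : Continuous fun u => a (t, u) := continuous_iff_continuousAt.2 fun s =>
      ContinuousAt.comp (f := fun u : ℝ => (t, u)) (hcont t s hx)
        (Continuous.prodMk_right t).continuousAt
    set d : ℝ → 𝔼 := fun s => ∫ u in (0 : ℝ)..s, a (t, u) with hd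
    have hdd : ∀ s, HasDerivAt d (a (t, s)) s := fun s =>
      (hat.integral_hasStrictDerivAt 0 s).hasDerivAt
    have h1 : HasDisplacement η π x (π (Γ t 0)) (Γ t) d := by
      refine ⟨(contMDiff_slice hΓ t).continuous, hv t, fun s => ?_⟩
      obtain ⟨p, hp⟩ := exists_isMomentum hπ x (z := Γ t s) (by rwa [hv])
      refine ⟨p, hp, ?_⟩
      have h2 : ∀ᶠ s' in 𝓝 s, IsMomentum η π x p (Γ t s') :=
        (contMDiff_slice hΓ t).continuous.continuousAt.eventually hp.eventually
      obtain ⟨r, hr, hball⟩ := Metric.eventually_nhds_iff_ball.1 h2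
      have h3 : ∀ s' ∈ Metric.ball s r, HasDerivAt (fun s' => p (Γ t s') - d s') 0 s' := by
        intro s' hs'
        have := (hderiv p t s' (hball s' hs')).sub (hdd s')
        rwa [haE p t s' hx (hball s' hs'), sub_self] at this
      filter_upwards [Metric.ball_mem_nhds s hr] with s' hs'
      have h4 := Metric.isOpen_ball.is_const_of_deriv_eq_zero (convex_ball s r).isPreconnected
        (fun y hy => (h3 y hy).differentiableAt.differentiableWithinAt)
        (fun y hy => (h3 y hy).deriv) hs' (Metric.mem_ball_self hr)
      rw [sub_eq_sub_iff_add_eq_add] at h4 ⊢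
      rw [add_comm (d s'), ← h4]
    have h2 := hH.hasDisplacement (fun z hz => exists_isMomentum hπ x hz)
      (continuous_iff_continuousAt.2 fun s => (hdd s).continuousAt) hx
    exact h1.eq hπ hx h2 (s₀ := 0) (by simp [hd, hH.zero]) s
  · have hx : π (Γ t 0) ∈ x.source := hV ▸ hVx
    have hat : Continuous fun u => a (t, u) := continuous_iff_continuousAt.2 fun s =>
      ContinuousAt.comp (f := fun u : ℝ => (t, u)) (hcont t s hx)
        (Continuous.prodMk_right t).continuousAt
    have h1 : ∀ s, η (Γ t s) ![mfderiv 𝓘(ℝ, ℝ) (𝓡 (2 * N)) (Γ t) s (1 : ℝ), liftAt π V (Γ t s)] =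
        inner ℝ (baseDeriv x V) (a (t, s)) := by
      intro s
      obtain ⟨p, hp⟩ := exists_isMomentum hπ x (z := Γ t s) (by rwa [hv])
      rw [hηa p t s hp V hV hVx, haE p t s hx hp, real_inner_comm]
    rw [period]
    congr 1
    simp only [h1]
    rw [real_inner_comm, ← innerSL_apply_apply ℝ,
      ← ContinuousLinearMap.intervalIntegral_comp_comm _ (hat.intervalIntegrable _ _)]
    simp

/-- The loops in the fibres that are orbits of the action have their generators as periods. -/
theorem IsFibreAction.period_orbit (hπ : IsIntegrableSystem η π)
    (hH : IsFibreAction η π x H) {z : X} (hz : π z ∈ x.source) (t : 𝔼)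
    {V : TangentBundle (𝓡 N) B} (hV : V.proj = π z) :
    period η π V (fun s => H (s • t) z) = 1 / (2 * Real.pi) * inner ℝ t (baseDeriv x V) := by
  have hsm : ContMDiff 𝓘(ℝ, ℝ) (𝓡 (2 * N)) ∞ (fun s : ℝ => H (s • t) z) := by
    intro s
    refine ContMDiffAt.comp s (f := fun s : ℝ => (s • t, z)) (g := fun q : 𝔼 × X => H q.1 q.2)
      (hH.smooth _ z hz) (ContMDiffAt.prodMk ?_ contMDiffAt_const)
    exact (contDiff_id.smul contDiff_const).contMDiff.contMDiffAt
  have h1 : ∀ s, η (H (s • t) z) ![mfderiv 𝓘(ℝ, ℝ) (𝓡 (2 * N)) (fun s : ℝ => H (s • t) z) s (1 : ℝ),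
      liftAt π V (H (s • t) z)] = inner ℝ t (baseDeriv x V) := by
    intro s
    have hz' : π (H (s • t) z) ∈ x.source := by rwa [hH.proj]
    obtain ⟨p, hp⟩ := exists_isMomentum hπ x hz'
    rw [IsMomentum.apply_liftAt (γ := fun s : ℝ => H (s • t) z) hπ
      (hsm.mdifferentiable (by simp) s) (by rwa [hV]) (fun s' => by rw [hH.proj, hV]) hp]
    congr 1
    have h2 : Tendsto (fun s' : ℝ => (s' • t - s • t, H (s • t) z)) (𝓝 s)
        (𝓝 (0, H (s • t) z)) := by
      have : Continuous fun s' : ℝ => (s' • t - s • t, H (s • t) z) := by fun_prop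
      simpa using this.tendsto s
    have h3 : (fun s' : ℝ => p (H (s' • t) z)) =ᶠ[𝓝 s]
        fun s' => p (H (s • t) z) + (s' • t - s • t) := by
      filter_upwards [h2.eventually (hH.momentum _ hz' p hp)] with s' h
      rwa [hH.sub] at h
    rw [h3.deriv_eq]
    have h4 : HasDerivAt (fun s' : ℝ => p (H (s • t) z) + (s' • t - s • t)) ((1 : ℝ) • t) s :=
      (((hasDerivAt_id s).smul_const t).sub_const _).const_add _
    rw [h4.deriv, one_smul]
  rw [period]
  simp only [h1]
  simp

omit [IsManifold (𝓡 (2 * N)) ∞ X] in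
/-- The elements of the period lattice generate loops in the fibres. -/
theorem IsFibreAction.isFibreLoop (hH : IsFibreAction η π x H) {b : B} (hb : b ∈ x.source)
    {t : 𝔼} (ht : t ∈ hH.lattice b) {z : X} (hz : π z = b) :
    IsFibreLoop (N := N) π b (fun s => H (s • t) z) where
  smooth s := by
    refine ContMDiffAt.comp s (f := fun s : ℝ => (s • t, z)) (g := fun q : 𝔼 × X => H q.1 q.2)
      (hH.smooth _ z (by rwa [hz])) (ContMDiffAt.prodMk ?_ contMDiffAt_const)
    exact (contDiff_id.smul contDiff_const).contMDiff.contMDiffAt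
  periodic s := by
    simp only
    rw [add_smul, one_smul, hH.add, ht z hz]
  vertical s := by rw [hH.proj, hz]

/-- The periods over the loops in a fibre are the pairings with elements of the period lattice. -/
theorem IsFibreAction.exists_period_eq [T2Space X] (hπ : IsIntegrableSystem η π)
    (hH : IsFibreAction η π x H) {b : B} (hb : b ∈ x.source) {γ : ℝ → X}
    (hγ : IsFibreLoop (N := N) π b γ) :
    ∃ t ∈ hH.lattice b, ∀ V : TangentBundle (𝓡 N) B, V.proj = b →
      period η π V γ = 1 / (2 * Real.pi) * inner ℝ t (baseDeriv x V) := by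
  have hsm : ContMDiff 𝓘(ℝ, ℝ × ℝ) (𝓡 (2 * N)) ∞ (fun p : ℝ × ℝ => γ p.2) :=
    hγ.smooth.comp contDiff_snd.contMDiff
  obtain ⟨a, -, h1, h2⟩ := hH.exists_displacement hπ (Γ := fun _ => γ) hsm
    (fun _ s => by rw [hγ.vertical, hγ.vertical])
  have hx : π (γ 0) ∈ x.source := by rwa [hγ.vertical]
  refine ⟨∫ u in (0 : ℝ)..1, a (0, u), ?_, fun V hV => ?_⟩
  · have h3 := h1 0 1 hx
    have h4 : γ 1 = γ 0 := by simpa using hγ.periodic 0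
    rw [h4] at h3
    have := hH.mem_lattice_of_eq hπ hx h3.symm
    rwa [hγ.vertical] at this
  · exact h2 0 V (by rw [hγ.vertical, hV]) (hV ▸ hb)

end Periods

/-! ### The period lattice spans, and varies by closed 1-forms -/

section Lattice

variable {N : ℕ}
  {X : Type*} [TopologicalSpace X] [ChartedSpace (EuclideanSpace ℝ (Fin (2 * N))) X]
  {B : Type*} [TopologicalSpace B] [ChartedSpace (EuclideanSpace ℝ (Fin N)) B]
  {η : TwoForm (𝓡 (2 * N)) X} {π : X → B}
  {x : PartialDiffeomorph (𝓡 N) 𝓘(ℝ, EuclideanSpace ℝ (Fin N)) B (EuclideanSpace ℝ (Fin N)) ∞}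
  {H : EuclideanSpace ℝ (Fin N) → X → X} [IsManifold (𝓡 (2 * N)) ∞ X] [IsManifold (𝓡 N) ∞ B]

local notation "𝔼" => EuclideanSpace ℝ (Fin N)

/-- Properties of the points of the base may be checked near a point of the total space, as the
projection is open. -/
theorem IsIntegrableSystem.eventually_base (hπ : IsIntegrableSystem η π) {z : X} {P : B → Prop}
    (h : ∀ᶠ y in 𝓝 z, P (π y)) : ∀ᶠ b in 𝓝 (π z), P b := by
  filter_upwards [hπ.isOpenMap.image_mem_nhds h] with b hb
  obtain ⟨y, hy, rfl⟩ := hb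
  exact hy

/-- Elements of the period lattice extend to closed 1-forms of the base with values in the period
lattices. -/
theorem IsFibreAction.exists_gradient_sub_mem (hπ : IsIntegrableSystem η π)
    (hH : IsFibreAction η π x H) {b₀ : B} (hb₀ : b₀ ∈ x.source) {t : 𝔼} (ht : t ∈ hH.lattice b₀) :
    ∃ g, IsGradientNear g (x b₀) ∧ g (x b₀) = 0 ∧ ∀ᶠ b in 𝓝 b₀, t - g (x b) ∈ hH.lattice b := by
  obtain ⟨z₀, hz₀⟩ := (hπ.connected_fibre b₀).nonempty
  have hz₀' : π z₀ = b₀ := hz₀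
  subst hz₀'
  have hfix : H t z₀ = z₀ := ht z₀ rfl
  obtain ⟨p, hp⟩ := exists_isMomentum hπ x hb₀
  -- the action of `t` carries the momenta `p` to momenta, which differ from `p` by `g`
  obtain ⟨g, hg, hgp⟩ := hp.exists_gradient hπ hb₀
    (hH.isMomentum_comp t z₀ hb₀ p (by rwa [hfix]))
  have hval := hgp.self_of_nhds
  rw [hfix, left_eq_add] at hval
  refine ⟨g, hg, hval, hπ.eventually_base ?_⟩
  have hc : Tendsto (fun y => (H t y, y)) (𝓝 z₀) (𝓝 (z₀, z₀)) := by
    have h1 : Tendsto (fun y => H t y) (𝓝 z₀) (𝓝 z₀) := by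
      have := (hH.continuousAt (t := t) hb₀).tendsto.comp ((Continuous.prodMk_right t).tendsto z₀)
      rw [hfix] at this
      exact this
    exact h1.prodMk_nhds tendsto_id
  have hs : ∀ᶠ y in 𝓝 z₀, π y ∈ x.source :=
    hπ.smooth.continuous.continuousAt.eventually_mem (PDiffeo.source_mem_nhds x hb₀)
  filter_upwards [hgp, hc.eventually (hH.eventually_eq hπ hb₀ hp), hs] with y h1 h2 h3
  have h4 := h2 (hH.proj t y)
  simp only [h1] at h4
  refine hH.mem_lattice_of_eq hπ h3 ?_
  rw [sub_eq_neg_add, hH.add, h4, ← hH.add]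
  convert hH.zero y using 2
  abel

omit [IsManifold (𝓡 N) ∞ B] in
/-- The period lattices span, because the fibres are compact. -/
theorem IsFibreAction.span_lattice (hπ : IsIntegrableSystem η π)
    (hH : IsFibreAction η π x H) {b : B} (hb : b ∈ x.source) :
    Submodule.span ℝ (hH.lattice b : Set 𝔼) = ⊤ := by
  by_contra hne
  set S := Submodule.span ℝ (hH.lattice b : Set 𝔼) with hS
  have hS' : Sᗮ ≠ ⊥ := fun h => hne (Submodule.orthogonal_eq_bot_iff.1 h)
  obtain ⟨v, hvS, hv0⟩ := Submodule.exists_mem_ne_zero_of_ne_bot hS'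
  have hvΛ : ∀ t ∈ hH.lattice b, inner ℝ v t = 0 := fun t ht =>
    (Submodule.mem_orthogonal' _ _).1 hvS t (Submodule.subset_span ht)
  obtain ⟨z₀, hz₀⟩ := (hπ.connected_fibre b).nonempty
  have hz₀' : π z₀ = b := hz₀
  subst hz₀'
  have hex : ∀ z, π z = π z₀ → ∃ t, H t z₀ = z := fun z hz => hH.exists_eq hπ hb hz
  choose! τ hτ using hex
  -- the linear form `⟪v, ·⟫` descends to a continuous function on the fibre
  have hwd : ∀ s t, H s z₀ = H t z₀ → inner ℝ v s = inner ℝ v t := by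
    intro s t hst
    have h1 : s - t ∈ hH.lattice (π z₀) := by
      refine hH.mem_lattice_of_eq hπ hb ?_
      rw [sub_eq_neg_add, hH.add, hst, ← hH.add, neg_add_cancel, hH.zero]
    have h2 := hvΛ _ h1
    rwa [inner_sub_right, sub_eq_zero] at h2
  have hcont : ContinuousOn (fun z => inner ℝ v (τ z)) (π ⁻¹' {π z₀}) := by
    intro z hz
    have hz' : π z = π z₀ := hz
    have hzs : π z ∈ x.source := by rwa [hz']
    obtain ⟨p, hp⟩ := exists_isMomentum hπ x hzs
    have h1 : Tendsto (fun y => inner ℝ v (p y - p z + τ z)) (𝓝[π ⁻¹' {π z₀}] z)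
        (𝓝 (inner ℝ v (τ z))) := by
      have h2 : ContinuousAt (fun y => inner ℝ v (p y - p z + τ z)) z :=
        continuousAt_const.inner ((hp.continuousAt.sub continuousAt_const).add continuousAt_const)
      have h3 := h2.tendsto
      rw [sub_self, zero_add] at h3
      exact h3.mono_left nhdsWithin_le_nhds
    refine h1.congr' ?_
    have h4 : Tendsto (fun y => (y, z)) (𝓝 z) (𝓝 (z, z)) := (Continuous.prodMk_left z).tendsto z
    filter_upwards [nhdsWithin_le_nhds (h4.eventually (hH.eventually_eq hπ hzs hp)),
      self_mem_nhdsWithin] with y h5 h6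
    have h6' : π y = π z₀ := h6
    refine hwd _ _ ?_
    rw [hH.add, hτ z hz', hτ y h6']
    exact (h5 (h6'.trans hz'.symm)).symm
  obtain ⟨C, hC⟩ := ((hπ.compact_fibre (π z₀)).image_of_continuousOn hcont).isBounded.subset_closedBall 0
  have hvv : (0 : ℝ) < inner ℝ v v := real_inner_self_pos.2 hv0
  -- this function is bounded, but grows linearly along the orbit of `v`
  have h1 : ∀ r : ℝ, |r * inner ℝ v v| ≤ C := by
    intro r
    have h2 : π (H (r • v) z₀) = π z₀ := hH.proj _ _
    have h3 := hC ⟨H (r • v) z₀, h2, rfl⟩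
    simp only at h3
    rw [hwd _ (r • v) (hτ _ h2), inner_smul_right] at h3
    simpa using h3
  have h4 := h1 ((|C| + 1) / inner ℝ v v)
  rw [div_mul_cancel₀ _ hvv.ne', abs_of_pos (by positivity)] at h4
  linarith [le_abs_self C]

/-- A spanning set contains a basis, indexed as a given one. -/
theorem exists_basis_of_span {V : Type*} [NormedAddCommGroup V] [InnerProductSpace ℝ V]
    [FiniteDimensional ℝ V] {ι : Type*} [Finite ι] (e : Module.Basis ι ℝ V) {s : Set V}
    (hs : Submodule.span ℝ s = ⊤) : ∃ b : Module.Basis ι ℝ V, ∀ i, b i ∈ s := by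
  refine ⟨(Module.Basis.ofSpan hs.ge).reindex ((Module.Basis.ofSpan hs.ge).indexEquiv e),
    fun i => ?_⟩
  rw [Module.Basis.reindex_apply]
  exact Module.Basis.ofSpan_subset hs.ge (mem_range_self _)

/-- Functions with prescribed closed differentials, linearly independent at a point, are
coordinates. -/
theorem exists_coordinates_of_gradient {l : Fin N → 𝔼 → 𝔼} {y₀ : 𝔼}
    (hl : ∀ j, IsGradientNear (l j) y₀) (b : Module.Basis (Fin N) ℝ 𝔼) (hb : ∀ j, b j = l j y₀) :
    ∃ Φ : PartialDiffeomorph 𝓘(ℝ, 𝔼) 𝓘(ℝ, 𝔼) 𝔼 𝔼 ∞, y₀ ∈ Φ.source ∧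
      ∀ y ∈ Φ.source, ∀ u j, fderiv ℝ Φ y u j = inner ℝ (l j y) u := by
  obtain ⟨r, hr, hball⟩ := Metric.eventually_nhds_iff_ball.1 (eventually_all.2 hl)
  have h1 : ∀ j, ∃ f : 𝔼 → ℝ, ∀ y ∈ Metric.ball y₀ r, HasFDerivAt f (innerSL ℝ (l j y)) y := by
    intro j
    have hd : ∀ y ∈ Metric.ball y₀ r, HasFDerivAt (fun y => innerSL ℝ (l j y))
        ((innerSL ℝ : 𝔼 →L[ℝ] 𝔼 →L[ℝ] ℝ).comp (fderiv ℝ (l j) y)) y := fun y hy =>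
      (innerSL ℝ : 𝔼 →L[ℝ] 𝔼 →L[ℝ] ℝ).hasFDerivAt.comp y
        ((hball y hy j).1.differentiableAt (by simp)).hasFDerivAt
    refine (convex_ball y₀ r).exists_forall_hasFDerivAt_of_fderiv_symmetric (𝕜 := ℝ)
      Metric.isOpen_ball
      (fun y hy => (hd y hy).differentiableAt.differentiableWithinAt) fun y hy u v => ?_
    rw [(hd y hy).fderiv]
    exact (hball y hy j).2 u v
  choose f hf using h1
  have hfs : ∀ j, ContDiffOn ℝ ∞ (f j) (Metric.ball y₀ r) := by
    intro j
    refine (contDiffOn_infty_iff_fderiv_of_isOpen Metric.isOpen_ball).2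
      ⟨fun y hy => (hf j y hy).differentiableAt.differentiableWithinAt, ?_⟩
    have : ContDiffOn ℝ ∞ (fun y => innerSL ℝ (l j y)) (Metric.ball y₀ r) := fun y hy =>
      ((innerSL ℝ : 𝔼 →L[ℝ] 𝔼 →L[ℝ] ℝ).contDiff.contDiffAt.comp y
        (hball y hy j).1).contDiffWithinAt
    exact this.congr fun y hy => (hf j y hy).fderiv
  set F : 𝔼 → 𝔼 := fun y => WithLp.toLp 2 fun j => f j y with hF
  have hFs : ContDiffOn ℝ ∞ F (Metric.ball y₀ r) := contDiffOn_euclidean.2 hfs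
  have hFd : ∀ y ∈ Metric.ball y₀ r, ∀ u j, fderiv ℝ F y u j = inner ℝ (l j y) u := by
    intro y hy u j
    have h2 : DifferentiableAt ℝ F y :=
      (hFs.contDiffAt (Metric.isOpen_ball.mem_nhds hy)).differentiableAt (by simp)
    have h3 := ((EuclideanSpace.proj j : 𝔼 →L[ℝ] ℝ).hasFDerivAt.comp y h2.hasFDerivAt).unique
      (hf j y hy)
    exact DFunLike.congr_fun h3 u
  have hinj : Function.Injective (fderiv ℝ F y₀) := by
    rw [injective_iff_map_eq_zero]
    intro u hu
    have h2 : (innerₛₗ ℝ).flip u = (0 : 𝔼 →ₗ[ℝ] ℝ) := b.ext fun j => by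
      have h3 := hFd y₀ (Metric.mem_ball_self hr) u j
      rw [hu, ← hb] at h3
      exact h3.symm
    exact inner_self_eq_zero.1 (LinearMap.congr_fun h2 u)
  obtain ⟨Φ, hΦ, hΦs, hΦF⟩ := exists_partialDiffeomorph_of_bijective Metric.isOpen_ball hFs
    (Metric.mem_ball_self hr) ⟨hinj, LinearMap.injective_iff_surjective.1 hinj⟩
  refine ⟨Φ, hΦ, fun y hy u j => ?_⟩
  have : (Φ : 𝔼 → 𝔼) = F := funext hΦF
  rw [this]
  exact hFd y (hΦs hy) u j

end Lattice

/-! ### Flat charts -/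

section FlatCharts

variable {N : ℕ}
  {X : Type*} [TopologicalSpace X] [ChartedSpace (EuclideanSpace ℝ (Fin (2 * N))) X]
  {B : Type*} [TopologicalSpace B] [ChartedSpace (EuclideanSpace ℝ (Fin N)) B]
  {η : TwoForm (𝓡 (2 * N)) X} {π : X → B}
  {x : PartialDiffeomorph (𝓡 N) 𝓘(ℝ, EuclideanSpace ℝ (Fin N)) B (EuclideanSpace ℝ (Fin N)) ∞}
  {H : EuclideanSpace ℝ (Fin N) → X → X} [IsManifold (𝓡 (2 * N)) ∞ X] [IsManifold (𝓡 N) ∞ B]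

local notation "𝔼" => EuclideanSpace ℝ (Fin N)

/-- Coordinates of the base with an action whose period lattices contain the standard lattice. -/
theorem exists_isFibreAction_single_mem [T2Space X] [T2Space B] (hπ : IsIntegrableSystem η π)
    (b₀ : B) :
    ∃ (x : PartialDiffeomorph (𝓡 N) 𝓘(ℝ, 𝔼) B 𝔼 ∞) (H : 𝔼 → X → X)
      (hH : IsFibreAction η π x H), b₀ ∈ x.source ∧
      ∀ᶠ b in 𝓝 b₀, ∀ j, EuclideanSpace.single j (1 : ℝ) ∈ hH.lattice b := by
  obtain ⟨x, hb₀, -, -, -, ε, hε, hx⟩ := exists_momentumBoxes hπ (chartPDiffeo (𝓡 N) b₀)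
    (mem_extChartAt_source (I := 𝓡 N) b₀)
  obtain ⟨H, hH⟩ := exists_isFibreAction hπ hε hx
  obtain ⟨e, he⟩ := exists_basis_of_span (EuclideanSpace.basisFun (Fin N) ℝ).toBasis
    (hH.span_lattice hπ hb₀)
  choose g hg hg0 hgΛ using fun j => hH.exists_gradient_sub_mem hπ hb₀ (he j)
  -- the action coordinates are the primitives of a basis of closed 1-forms with lattice values
  obtain ⟨Φ, hΦ, hΦd⟩ := exists_coordinates_of_gradient (l := fun j y => e j - g j y)
    (fun j => (isGradientNear_const (e j) (x b₀)).sub (hg j)) e (fun j => by simp [hg0])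
  have hb₀' : b₀ ∈ (x.trans Φ).source := ⟨hb₀, hΦ⟩
  obtain ⟨x', hb', hx's, hx'e, -, ε', hε', hx'⟩ := exists_momentumBoxes hπ (x.trans Φ) hb₀'
  obtain ⟨H', hH'⟩ := exists_isFibreAction hπ hε' hx'
  refine ⟨x', H', hH', hb', eventually_all.2 fun j => ?_⟩
  filter_upwards [hgΛ j, PDiffeo.source_mem_nhds x' hb'] with b hb hbx'
  have hbt : b ∈ x.source ∧ x b ∈ Φ.source := hx's hbx'
  obtain ⟨z, hz⟩ := (hπ.connected_fibre b).nonempty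
  have hz' : π z = b := hz
  -- a loop generated by the first action has a period vector `t` for the second one, which is
  -- found by comparing the periods of tangent vectors
  obtain ⟨t, ht, hper⟩ := hH'.exists_period_eq hπ hbx' (hH.isFibreLoop hbt.1 hb hz')
  suffices h : t = EuclideanSpace.single j 1 by rwa [← h]
  refine ext_inner_right ℝ fun w => ?_
  obtain ⟨V, hV, rfl⟩ := baseDeriv_surjective hbx' w
  have h1 := hper V hV
  rw [hH.period_orbit hπ (by rw [hz']; exact hbt.1) _ (hV.trans hz'.symm)] at h1
  have h2 := mul_left_cancel₀ (by positivity) h1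
  rw [← h2, EuclideanSpace.inner_single_left, map_one, one_mul]
  have h3 : baseDeriv x' V = fderiv ℝ Φ (x b) (baseDeriv x V) := by
    have h4 : (x' : B → 𝔼) = fun b => Φ (x b) := funext fun b => hx'e b
    rw [h4]
    subst hV
    exact mvfderiv_comp_fderiv (f := x) (g := Φ) ((PDiffeo.contMDiffAt Φ hbt.2).contDiffAt.differentiableAt
      (by simp)) (PDiffeo.mdifferentiableAt x hbt.1) V.2
  rw [h3, hΦd _ hbt.2]

omit [IsManifold (𝓡 (2 * N)) ∞ X] [IsManifold (𝓡 N) ∞ B] in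
theorem IsFibreAction.mono (hH : IsFibreAction η π x H)
    {x' : PartialDiffeomorph (𝓡 N) 𝓘(ℝ, 𝔼) B 𝔼 ∞} (hs : x'.source ⊆ x.source)
    (hx : ∀ b, x' b = x b) : IsFibreAction η π x' H := by
  have h : (x' : B → 𝔼) = x := funext hx
  refine ⟨hH.proj, hH.zero, hH.add, fun t z hz => hH.smooth t z (hs hz), fun z hz p hp => ?_,
    fun t z hz p hp => ?_, ?_⟩
  · rw [h] at hp
    exact hH.momentum z (hs hz) p hp
  · rw [h] at hp ⊢
    exact hH.isMomentum_comp t z (hs hz) p hp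
  · obtain ⟨ε, hε, h'⟩ := hH.free
    exact ⟨ε, hε, fun t z hz => h' t z (hs hz)⟩

/-- The union of the period lattices is closed. -/
theorem IsFibreAction.eventually_notMem [T2Space X] (hπ : IsIntegrableSystem η π)
    (hH : IsFibreAction η π x H) {b₀ : B} (hb₀ : b₀ ∈ x.source) {τ : 𝔼}
    (hτ : τ ∉ hH.lattice b₀) : ∀ᶠ q : B × 𝔼 in 𝓝 (b₀, τ), q.2 ∉ hH.lattice q.1 := by
  obtain ⟨z₀, hz₀, hne⟩ : ∃ z₀, π z₀ = b₀ ∧ H τ z₀ ≠ z₀ := by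
    by_contra! h
    exact hτ h
  subst hz₀
  have h1 : ∀ᶠ q : X × 𝔼 in 𝓝 (z₀, τ), H q.2 q.1 ≠ q.1 := by
    have h2 : ContinuousAt (fun q : X × 𝔼 => H q.2 q.1) (z₀, τ) :=
      ContinuousAt.comp (f := Prod.swap) (x := (z₀, τ)) (g := fun q : 𝔼 × X => H q.1 q.2)
        (hH.continuousAt hb₀) continuous_swap.continuousAt
    exact (h2.prodMk continuousAt_fst).eventually_mem
      (isClosed_diagonal.isOpen_compl.mem_nhds (x := (H τ z₀, z₀)) hne)
  have hopen : IsOpenMap (Prod.map π (id : 𝔼 → 𝔼)) := hπ.isOpenMap.prodMap IsOpenMap.id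
  filter_upwards [hopen.image_mem_nhds h1] with q hq
  obtain ⟨⟨z, t⟩, hzt, rfl⟩ := hq
  exact fun h => hzt (h z rfl)

/-- If the period lattices contain a fixed basis, then they are locally constant. -/
theorem IsFibreAction.eventually_lattice_eq [T2Space X] (hπ : IsIntegrableSystem η π)
    (hH : IsFibreAction η π x H) {b₀ : B} (hb₀ : b₀ ∈ x.source)
    (hsingle : ∀ᶠ b in 𝓝 b₀, ∀ j, EuclideanSpace.single j (1 : ℝ) ∈ hH.lattice b) :
    ∀ᶠ b in 𝓝 b₀, hH.lattice b = hH.lattice b₀ := by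
  obtain ⟨ε, hε, hfree⟩ := hH.lattice_discrete hπ
  have hsrc : ∀ᶠ b in 𝓝 b₀, b ∈ x.source := PDiffeo.source_mem_nhds x hb₀
  have hloc : ∀ τ : 𝔼, ∀ᶠ q : B × 𝔼 in 𝓝 (b₀, τ), q.2 ∈ hH.lattice q.1 ↔ q.2 ∈ hH.lattice b₀ := by
    intro τ
    by_cases hτ : τ ∈ hH.lattice b₀
    · obtain ⟨k, hk, hkΛ⟩ := exists_nsmul_mem_of_discrete
        (EuclideanSpace.basisFun (Fin N) ℝ).toBasis hε (hfree b₀ hb₀)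
        (fun j => by simpa using hsingle.self_of_nhds j) hτ
      obtain ⟨g, hg, hg0, hgΛ⟩ := hH.exists_gradient_sub_mem hπ hb₀ hτ
      have hgc : ContinuousAt (fun b => k • g (x b)) b₀ :=
        (ContinuousAt.comp (f := x) (g := g) hg.self_of_nhds.1.continuousAt
          (PDiffeo.continuousAt x hb₀)).const_smul k
      have hgs : ∀ᶠ b in 𝓝 b₀, ‖k • g (x b)‖ < ε := by
        refine hgc.norm.eventually_lt_const ?_
        simpa [hg0] using hε
      -- a multiple of `τ` lies in all the lattices, so the deformation of `τ` is constant
      have hmem : ∀ᶠ b in 𝓝 b₀, τ ∈ hH.lattice b := by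
        filter_upwards [hgΛ, hgs, hsingle, hsrc] with b h1 h2 h3 h4
        have h5 : k • τ ∈ hH.lattice b := hkΛ _ fun j => by simpa using h3 j
        have h6 : k • g (x b) ∈ hH.lattice b := by
          have := (hH.lattice b).sub_mem h5 ((hH.lattice b).nsmul_mem h1 k)
          rwa [nsmul_sub, sub_sub_cancel] at this
        have h7 := hfree b h4 _ h6 h2
        rw [← Nat.cast_smul_eq_nsmul ℝ] at h7
        replace h7 := (smul_eq_zero.1 h7).resolve_left (by exact_mod_cast hk.ne')
        rwa [h7, sub_zero] at h1
      have hnear : ∀ᶠ t : 𝔼 in 𝓝 τ, ‖t - τ‖ < ε := by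
        filter_upwards [Metric.ball_mem_nhds τ hε] with t ht
        rwa [← dist_eq_norm]
      rw [nhds_prod_eq]
      filter_upwards [(hmem.and hsrc).prod_mk hnear] with q hq
      have key : ∀ b ∈ x.source, τ ∈ hH.lattice b → (q.2 ∈ hH.lattice b ↔ q.2 = τ) := by
        intro b hb h1
        refine ⟨fun h2 => ?_, fun h2 => h2 ▸ h1⟩
        exact sub_eq_zero.1 (hfree b hb _ ((hH.lattice b).sub_mem h2 h1) hq.2)
      rw [key _ hq.1.2 hq.1.1, key _ hb₀ hτ]
    · have h1 := hH.eventually_notMem hπ hb₀ hτ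
      have h2 : Tendsto (fun q : B × 𝔼 => (b₀, q.2)) (𝓝 (b₀, τ)) (𝓝 (b₀, τ)) :=
        (continuous_const.prodMk continuous_snd).tendsto (b₀, τ)
      filter_upwards [h1, h2.eventually h1] with q h3 h4
      exact ⟨fun h => absurd h h3, fun h => absurd h h4⟩
  have hcube : IsCompact (WithLp.toLp 2 '' Icc (0 : Fin N → ℝ) 1) :=
    isCompact_Icc.image (PiLp.continuous_toLp 2 _)
  have hall : ∀ᶠ b in 𝓝 b₀, ∀ τ ∈ WithLp.toLp 2 '' Icc (0 : Fin N → ℝ) 1,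
      (τ ∈ hH.lattice b ↔ τ ∈ hH.lattice b₀) :=
    hcube.eventually_forall_of_forall_eventually fun τ _ => hloc τ
  filter_upwards [hall, hsingle] with b h1 h2
  ext t
  -- reduce modulo the standard lattice to a vector of the unit cube
  set τ : 𝔼 := WithLp.toLp 2 fun j => Int.fract (t j) with hτ
  have hτm : τ ∈ WithLp.toLp 2 '' Icc (0 : Fin N → ℝ) 1 :=
    ⟨_, ⟨fun j => Int.fract_nonneg _, fun j => (Int.fract_lt_one _).le⟩, rfl⟩
  have hsum : t = τ + ∑ j, ⌊t j⌋ • EuclideanSpace.single j (1 : ℝ) := by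
    ext i
    simp [hτ, Finset.sum_apply, Pi.single_apply]
  have hred : ∀ Λ : AddSubgroup 𝔼, (∀ j, EuclideanSpace.single j (1 : ℝ) ∈ Λ) →
      (t ∈ Λ ↔ τ ∈ Λ) := by
    intro Λ hΛ
    have : ∑ j, ⌊t j⌋ • EuclideanSpace.single j (1 : ℝ) ∈ Λ :=
      Λ.sum_mem fun j _ => Λ.zsmul_mem (hΛ j) _
    conv_lhs => rw [hsum]
    exact Λ.add_mem_cancel_right this
  rw [hred _ h2, hred _ hsingle.self_of_nhds, h1 τ hτm]

/-- Flat coordinates `x` of the base, over a ball, with the action generated by them, the constant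
period lattice `Λ` and a section `σ` of the fibration. -/
structure IsFlatChart (η : TwoForm (𝓡 (2 * N)) X) (π : X → B)
    (x : PartialDiffeomorph (𝓡 N) 𝓘(ℝ, 𝔼) B 𝔼 ∞) (H : 𝔼 → X → X) (Λ : AddSubgroup 𝔼)
    (σ : B → X) : Prop where
  action : IsFibreAction η π x H
  lattice : ∀ b ∈ x.source, action.lattice b = Λ
  single_mem : ∀ j, EuclideanSpace.single j (1 : ℝ) ∈ Λ
  ball : ∃ c ρ, 0 < ρ ∧ x.target = Metric.ball c ρ
  smooth_section : ∀ b ∈ x.source, ContMDiffAt (𝓡 N) (𝓡 (2 * N)) ∞ σ b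
  proj_section : ∀ b ∈ x.source, π (σ b) = b
  momentum_section : ∃ p, ∀ b ∈ x.source, IsMomentum η π x p (σ b)

omit [IsManifold (𝓡 N) ∞ B] in
/-- Near each point of the base there is a section, given by the points with constant momenta in a
momentum chart. -/
theorem exists_section (hπ : IsIntegrableSystem η π) {b₀ : B} (hb₀ : b₀ ∈ x.source) :
    ∃ σ : B → X, ∃ p, ∀ᶠ b in 𝓝 b₀, ContMDiffAt (𝓡 N) (𝓡 (2 * N)) ∞ σ b ∧ π (σ b) = b ∧
      IsMomentum η π x p (σ b) := by
  obtain ⟨z₀, hz₀⟩ := (hπ.connected_fibre b₀).nonempty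
  have hz₀' : π z₀ = b₀ := hz₀
  subst hz₀'
  obtain ⟨κ, hκz, hκ⟩ := exists_momentumChart hπ x hb₀
  refine ⟨fun b => κ.symm ((κ z₀).1, x b), fun y => (κ y).1, ?_⟩
  have hmem : ∀ᶠ b in 𝓝 (π z₀), ((κ z₀).1, x b) ∈ κ.target := by
    have hc : ContinuousAt (fun b => ((κ z₀).1, x b)) (π z₀) :=
      continuousAt_const.prodMk (PDiffeo.continuousAt x hb₀)
    refine hc.eventually_mem (κ.open_target.mem_nhds ?_)
    rw [← hκ.snd_eq z₀ hκz]
    exact PDiffeo.map_source κ hκz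
  filter_upwards [hmem, PDiffeo.source_mem_nhds x hb₀] with b h1 h2
  have h3 := PDiffeo.map_target κ h1
  refine ⟨ContMDiffAt.comp b (f := fun b => ((κ z₀).1, x b)) (PDiffeo.contMDiffAt_symm κ h1)
    (contMDiffAt_const.prodMk_space (PDiffeo.contMDiffAt x h2)), ?_, hκ.momentum _ h3⟩
  have h4 := hκ.snd_eq _ h3
  rw [PDiffeo.right_inv κ h1] at h4
  rw [← PDiffeo.left_inv x (hκ.mem_source _ h3), ← h4, PDiffeo.left_inv x h2]

omit [IsManifold (𝓡 N) ∞ B] in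
/-- Coordinates may be restricted to arbitrarily small balls. -/
theorem exists_ball_chart {b₀ : B} (hb₀ : b₀ ∈ x.source) {W : Set B} (hW : W ∈ 𝓝 b₀) :
    ∃ x' : PartialDiffeomorph (𝓡 N) 𝓘(ℝ, 𝔼) B 𝔼 ∞, b₀ ∈ x'.source ∧ x'.source ⊆ x.source ∧
      x'.source ⊆ W ∧ (∀ b, x' b = x b) ∧ ∃ c ρ, 0 < ρ ∧ x'.target = Metric.ball c ρ := by
  have h2 : x.target ∩ x.symm ⁻¹' W ∈ 𝓝 (x b₀) := by
    refine Filter.inter_mem (PDiffeo.target_mem_nhds x (PDiffeo.map_source x hb₀)) ?_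
    refine (PDiffeo.continuousAt_symm x (PDiffeo.map_source x hb₀)).preimage_mem_nhds ?_
    rwa [PDiffeo.left_inv x hb₀]
  obtain ⟨ρ, hρ, hρs⟩ := Metric.mem_nhds_iff.1 h2
  refine ⟨PDiffeo.corestr x (Metric.ball (x b₀) ρ) Metric.isOpen_ball, ?_, ?_, ?_, fun b => rfl,
    x b₀, ρ, hρ, PDiffeo.corestr_target _ _ (hρs.trans inter_subset_left)⟩
  · rw [PDiffeo.corestr_source]; exact ⟨hb₀, Metric.mem_ball_self hρ⟩
  · rw [PDiffeo.corestr_source]; exact inter_subset_left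
  · rw [PDiffeo.corestr_source]
    rintro b ⟨hb, hbρ⟩
    have := (hρs hbρ).2
    rwa [mem_preimage, PDiffeo.left_inv x hb] at this

/-- The Arnold-Liouville theorem: flat charts exist near each point of the base. -/
theorem exists_isFlatChart [T2Space X] [T2Space B] (hπ : IsIntegrableSystem η π) (b₀ : B) :
    ∃ (x : PartialDiffeomorph (𝓡 N) 𝓘(ℝ, 𝔼) B 𝔼 ∞) (H : 𝔼 → X → X) (Λ : AddSubgroup 𝔼)
      (σ : B → X), b₀ ∈ x.source ∧ IsFlatChart η π x H Λ σ := by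
  obtain ⟨x, H, hH, hb₀, hsingle⟩ := exists_isFibreAction_single_mem hπ b₀
  have hlat := hH.eventually_lattice_eq hπ hb₀ hsingle
  obtain ⟨σ, p, hσ⟩ := exists_section hπ hb₀
  obtain ⟨x', hb', hs, hsW, hx', hball⟩ := exists_ball_chart hb₀ (Filter.inter_mem hlat hσ)
  refine ⟨x', H, hH.lattice b₀, σ, hb', hH.mono hs hx', fun b hb => (hsW hb).1,
    hsingle.self_of_nhds, hball, fun b hb => (hsW hb).2.1, fun b hb => (hsW hb).2.2.1, p,
    fun b hb => ?_⟩
  rw [show (x' : B → 𝔼) = x from funext hx']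
  exact (hsW hb).2.2.2

end FlatCharts

/-! ### The differentials of the multivalued momenta -/

section MomentumForm

variable {N : ℕ}
  {X : Type*} [TopologicalSpace X] [ChartedSpace (EuclideanSpace ℝ (Fin (2 * N))) X]
  {B : Type*} [TopologicalSpace B] [ChartedSpace (EuclideanSpace ℝ (Fin N)) B]
  {η : TwoForm (𝓡 (2 * N)) X} {π : X → B}
  {x : PartialDiffeomorph (𝓡 N) 𝓘(ℝ, EuclideanSpace ℝ (Fin N)) B (EuclideanSpace ℝ (Fin N)) ∞}
  {H : EuclideanSpace ℝ (Fin N) → X → X} {Λ : AddSubgroup (EuclideanSpace ℝ (Fin N))} {σ : B → X}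
  [IsManifold (𝓡 (2 * N)) ∞ X]

local notation "𝔼" => EuclideanSpace ℝ (Fin N)

/-- The differentials of the momenta glue to closed 1-forms over the domain of a flat chart, since
the momenta are transported by the action from a section, and the period lattice is constant. -/
theorem IsFlatChart.exists_momentumForm (hπ : IsIntegrableSystem η π)
    (h : IsFlatChart η π x H Λ σ) :
    ∃ α : (z : X) → TangentSpace (𝓡 (2 * N)) z →L[ℝ] 𝔼, ∀ z, π z ∈ x.source →
      ∃ f, IsMomentum η π x f z ∧ ∀ᶠ z' in 𝓝 z, α z' = mvfderiv (𝓡 (2 * N)) f z' := by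
  have hH := h.action
  have hex : ∀ z, π z ∈ x.source → ∃ t, H t (σ (π z)) = z := fun z hz =>
    hH.exists_eq hπ (by rwa [h.proj_section _ hz]) (by rw [h.proj_section _ hz])
  choose! τ hτ using hex
  obtain ⟨p, hp⟩ := h.momentum_section
  -- near `z`, the momenta are those near the section, transported by an element of the group
  -- which carries the section to `z`; it is unique up to the period lattice
  refine ⟨fun z => mvfderiv (𝓡 (2 * N)) (fun y => p (H (-τ z) y)) z, fun z₀ hz₀ => ?_⟩
  have hback : H (-τ z₀) z₀ = σ (π z₀) := by
    have := hH.add (-τ z₀) (τ z₀) (σ (π z₀))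
    rwa [neg_add_cancel, hH.zero, hτ z₀ hz₀, eq_comm] at this
  have hf : IsMomentum η π x (fun y => p (H (-τ z₀) y)) z₀ :=
    hH.isMomentum_comp _ _ hz₀ p (by rw [hback]; exact hp _ hz₀)
  refine ⟨fun y => p (H (-τ z₀) y), hf, ?_⟩
  · set m := σ (π z₀) with hm
    have hmx : π m ∈ x.source := by rw [hm, h.proj_section _ hz₀]; exact hz₀
    have hpm : IsMomentum η π x p m := hp _ hz₀
    have hcw : Tendsto (fun y => H (-τ z₀) y) (𝓝 z₀) (𝓝 m) := by
      have := (hH.continuousAt (t := -τ z₀) hz₀).tendsto.comp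
        ((Continuous.prodMk_right (-τ z₀)).tendsto z₀)
      rw [hback] at this
      exact this
    have hcs : Tendsto (fun y => σ (π y)) (𝓝 z₀) (𝓝 m) :=
      (h.smooth_section _ hz₀).continuousAt.tendsto.comp hπ.smooth.continuous.continuousAt
    set s : X → 𝔼 := fun y => p (H (-τ z₀) y) - p (σ (π y)) with hs
    have hs0 : Tendsto s (𝓝 z₀) (𝓝 0) := by
      have := (hpm.continuousAt.tendsto.comp hcw).sub (hpm.continuousAt.tendsto.comp hcs)
      rwa [sub_self] at this
    have hsrc : ∀ᶠ y in 𝓝 z₀, π y ∈ x.source :=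
      hπ.smooth.continuous.continuousAt.eventually_mem (PDiffeo.source_mem_nhds x hz₀)
    have hpair : Tendsto (fun q : X × X => (-s q.1, H (-τ z₀) q.2)) (𝓝 (z₀, z₀)) (𝓝 (0, m)) := by
      have h1 : Tendsto (fun q : X × X => -s q.1) (𝓝 (z₀, z₀)) (𝓝 0) := by
        have := (hs0.comp (continuous_fst.tendsto (z₀, z₀))).neg
        rwa [neg_zero] at this
      exact h1.prodMk_nhds (hcw.comp (continuous_snd.tendsto (z₀, z₀)))
    have hev := (hpair.eventually (hH.momentum m hmx p hpm)).eventually_nhds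
    have hdiag : Tendsto (fun y : X => (y, y)) (𝓝 z₀) (𝓝 (z₀, z₀)) :=
      (continuous_id.prodMk continuous_id).tendsto z₀
    filter_upwards [hdiag.eventually hev, hsrc.eventually_nhds,
      (hcw.prodMk_nhds hcs).eventually (hH.eventually_eq hπ hmx hpm), hf.eventually]
      with z hz1 hz2 hz3 hz4
    have hzx : π z ∈ x.source := hz2.self_of_nhds
    -- the total displacement of `z` from the section, up to the period lattice
    have hw : H (-τ z₀) z = H (s z) (σ (π z)) :=
      hz3 (by rw [hH.proj, h.proj_section _ hzx])
    have hz : H (τ z₀ + s z) (σ (π z)) = z := by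
      rw [hH.add, ← hw, ← hH.add, add_neg_cancel, hH.zero]
    have hlam : τ z - (τ z₀ + s z) ∈ Λ := by
      rw [← h.lattice _ hzx]
      refine hH.mem_lattice_of_eq hπ hzx ?_
      have h1 := hH.sub (τ z) (τ z₀ + s z) (σ (π z))
      rwa [hz, hτ z hzx] at h1
    have hneg : -(τ z - (τ z₀ + s z)) ∈ Λ := Λ.neg_mem hlam
    have hgerm : (fun y => p (H (-τ z) y)) =ᶠ[𝓝 z] fun y => p (H (-τ z₀) y) + -s z := by
      have hin : Tendsto (fun y : X => (z, y)) (𝓝 z) (𝓝 (z, z)) :=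
        (Continuous.prodMk_right z).tendsto z
      filter_upwards [hin.eventually hz1, hz2] with y hy1 hy2
      rw [← hy1]
      rw [← h.lattice _ hy2] at hneg
      have h1 := hH.add (-s z + -τ z₀) (-(τ z - (τ z₀ + s z))) y
      rw [hneg y rfl, show -s z + -τ z₀ + -(τ z - (τ z₀ + s z)) = -τ z by abel, hH.add] at h1
      rw [h1]
    rw [mvfderiv_congr hgerm, mvfderiv_fun_add (hz4.contMDiffAt.mdifferentiableAt (by simp))
      mdifferentiableAt_const, mvfderiv_const, add_zero]

end MomentumForm

/-! ### Coordinates on the tangent bundle of the base -/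

section TangentCoordinates

variable {N : ℕ}
  {B : Type*} [TopologicalSpace B] [ChartedSpace (EuclideanSpace ℝ (Fin N)) B]
  [IsManifold (𝓡 N) ∞ B]

local notation "𝔼" => EuclideanSpace ℝ (Fin N)

theorem contMDiff_tangentBundle_fst {E : Type*} [NormedAddCommGroup E] [NormedSpace ℝ E] :
    ContMDiff 𝓘(ℝ, E).tangent 𝓘(ℝ, E) ∞ (fun V : TangentBundle 𝓘(ℝ, E) E => V.proj) :=
  Bundle.contMDiff_proj (TangentSpace 𝓘(ℝ, E))

/-- The vector part of a tangent vector of a vector space depends smoothly on it. -/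
theorem contMDiff_tangentBundle_snd {E : Type*} [NormedAddCommGroup E] [NormedSpace ℝ E] :
    ContMDiff 𝓘(ℝ, E).tangent 𝓘(ℝ, E) ∞
      (fun V : TangentBundle 𝓘(ℝ, E) E => (V.snd : E)) := by
  have h := contMDiff_tangentBundleModelSpaceHomeomorph (I := 𝓘(ℝ, E)) (n := ∞)
  rw [← modelWithCornersSelf_prod] at h
  exact (contDiff_snd (𝕜 := ℝ) (E := E) (F := E) (n := ∞)).contMDiff.comp h

theorem contMDiff_tangentBundle_mk {E : Type*} [NormedAddCommGroup E] [NormedSpace ℝ E] :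
    ContMDiff 𝓘(ℝ, E × E) 𝓘(ℝ, E).tangent ∞
      (fun q : E × E => (⟨q.1, q.2⟩ : TangentBundle 𝓘(ℝ, E) E)) := by
  have h := contMDiff_tangentBundleModelSpaceHomeomorph_symm (I := 𝓘(ℝ, E)) (n := ∞)
  rw [modelWithCornersSelf_prod]
  exact h

/-- Coordinates of the base induce coordinates of its tangent bundle. -/
noncomputable def tangentPDiffeo (x : PartialDiffeomorph (𝓡 N) 𝓘(ℝ, 𝔼) B 𝔼 ∞) :
    PartialDiffeomorph (𝓡 N).tangent 𝓘(ℝ, 𝔼 × 𝔼) (TangentBundle (𝓡 N) B) (𝔼 × 𝔼) ∞ where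
  toFun V := (x V.proj, baseDeriv x V)
  invFun q := ⟨x.symm q.1, mfderiv 𝓘(ℝ, 𝔼) (𝓡 N) x.symm q.1 q.2⟩
  source := {V | V.proj ∈ x.source}
  target := x.target ×ˢ univ
  map_source' V hV := ⟨PDiffeo.map_source x hV, mem_univ _⟩
  map_target' q hq := PDiffeo.map_target x hq.1
  left_inv' V hV := by
    obtain ⟨b, v⟩ := V
    have hb : b ∈ x.source := hV
    have h1 := PDiffeo.left_inv x hb
    have h2 := PDiffeo.mfderiv_symm_mfderiv x hb v
    exact Bundle.TotalSpace.ext h1 (heq_of_eq h2)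
  right_inv' q hq := by
    refine Prod.ext (PDiffeo.right_inv x hq.1) ?_
    exact PDiffeo.mfderiv_mfderiv_symm x hq.1 q.2
  open_source := x.open_source.preimage (FiberBundle.continuous_proj _ _)
  open_target := x.open_target.prod isOpen_univ
  contMDiffOn_toFun := by
    have h1 := x.contMDiffOn_toFun.contMDiffOn_tangentMapWithin (m := ∞) (by simp)
      x.open_source.uniqueMDiffOn
    have h2 : ContMDiffOn (𝓡 N).tangent 𝓘(ℝ, 𝔼).tangent ∞ (tangentMap (𝓡 N) 𝓘(ℝ, 𝔼) x)
        {V | V.proj ∈ x.source} := by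
      refine h1.congr fun V hV => ?_
      rw [tangentMapWithin, mfderivWithin_of_isOpen x.open_source hV]
      rfl
    exact (contMDiff_tangentBundle_fst.comp_contMDiffOn h2).prodMk_space
      (contMDiff_tangentBundle_snd.comp_contMDiffOn h2)
  contMDiffOn_invFun := by
    have h1 := x.contMDiffOn_invFun.contMDiffOn_tangentMapWithin (m := ∞) (by simp)
      x.open_target.uniqueMDiffOn
    have h2 : ContMDiffOn 𝓘(ℝ, 𝔼).tangent (𝓡 N).tangent ∞ (tangentMap 𝓘(ℝ, 𝔼) (𝓡 N) x.symm)
        {V | V.proj ∈ x.target} := by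
      refine h1.congr fun V hV => ?_
      rw [tangentMapWithin, mfderivWithin_of_isOpen x.open_target hV]
      rfl
    exact h2.comp contMDiff_tangentBundle_mk.contMDiffOn fun q hq => hq.1

theorem contMDiffAt_baseDeriv {x : PartialDiffeomorph (𝓡 N) 𝓘(ℝ, 𝔼) B 𝔼 ∞}
    {V : TangentBundle (𝓡 N) B} (hV : V.proj ∈ x.source) :
    ContMDiffAt (𝓡 N).tangent 𝓘(ℝ, 𝔼) ∞ (fun V => baseDeriv x V) V :=
  ContMDiffAt.comp V (g := (Prod.snd : 𝔼 × 𝔼 → 𝔼)) contDiff_snd.contMDiff.contMDiffAt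
    (PDiffeo.contMDiffAt (tangentPDiffeo x) hV)

theorem IsSmoothNear.contMDiffAt_baseDeriv {x : PartialDiffeomorph (𝓡 N) 𝓘(ℝ, 𝔼) B 𝔼 ∞}
    {v : (b : B) → TangentSpace (𝓡 N) b} {b : B} (hv : IsSmoothNear v b) (hb : b ∈ x.source) :
    ContMDiffAt (𝓡 N) 𝓘(ℝ, 𝔼) ∞ (fun b' => baseDeriv x ⟨b', v b'⟩) b := by
  obtain ⟨O, hO, hbO, h⟩ := hv
  exact ContMDiffAt.comp b (f := fun b' => (⟨b', v b'⟩ : TangentBundle (𝓡 N) B))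
    (IntegrableSystem.contMDiffAt_baseDeriv hb) (h.contMDiffAt (hO.mem_nhds hbO))

/-- The vector field with constant components `a` in the coordinates `x`. -/
noncomputable def coordField (x : PartialDiffeomorph (𝓡 N) 𝓘(ℝ, 𝔼) B 𝔼 ∞) (a : 𝔼) (b : B) :
    TangentSpace (𝓡 N) b :=
  (mfderiv 𝓘(ℝ, 𝔼) (𝓡 N) x.symm (x b) a : 𝔼)

theorem mk_coordField {x : PartialDiffeomorph (𝓡 N) 𝓘(ℝ, 𝔼) B 𝔼 ∞} (a : 𝔼) {b : B}
    (hb : b ∈ x.source) :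
    (⟨b, coordField x a b⟩ : TangentBundle (𝓡 N) B) = (tangentPDiffeo x).symm (x b, a) :=
  Bundle.TotalSpace.ext (PDiffeo.left_inv x hb).symm HEq.rfl

theorem baseDeriv_coordField {x : PartialDiffeomorph (𝓡 N) 𝓘(ℝ, 𝔼) B 𝔼 ∞} (a : 𝔼) {b : B}
    (hb : b ∈ x.source) : baseDeriv x ⟨b, coordField x a b⟩ = a := by
  rw [mk_coordField a hb]
  exact congrArg Prod.snd (PDiffeo.right_inv (tangentPDiffeo x) (w := (x b, a))
    ⟨PDiffeo.map_source x hb, mem_univ _⟩)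

theorem isSmoothNear_coordField {x : PartialDiffeomorph (𝓡 N) 𝓘(ℝ, 𝔼) B 𝔼 ∞} (a : 𝔼) {b : B}
    (hb : b ∈ x.source) : IsSmoothNear (coordField x a) b := by
  refine ⟨x.source, x.open_source, hb, ?_⟩
  have h1 : ContMDiffOn (𝓡 N) 𝓘(ℝ, 𝔼 × 𝔼) ∞ (fun b => (x b, a)) x.source :=
    x.contMDiffOn_toFun.prodMk_space contMDiffOn_const
  refine ((tangentPDiffeo x).symm.contMDiffOn_toFun.comp h1
    fun b hb => ⟨PDiffeo.map_source x hb, mem_univ _⟩).congr fun b hb => mk_coordField a hb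

end TangentCoordinates

/-! ### The Gauss-Manin connection in flat coordinates -/

section GaussManin

variable {N : ℕ}
  {X : Type*} [TopologicalSpace X] [ChartedSpace (EuclideanSpace ℝ (Fin (2 * N))) X]
  {B : Type*} [TopologicalSpace B] [ChartedSpace (EuclideanSpace ℝ (Fin N)) B]
  {η : TwoForm (𝓡 (2 * N)) X} {π : X → B}
  {x : PartialDiffeomorph (𝓡 N) 𝓘(ℝ, EuclideanSpace ℝ (Fin N)) B (EuclideanSpace ℝ (Fin N)) ∞}
  {H : EuclideanSpace ℝ (Fin N) → X → X} {Λ : AddSubgroup (EuclideanSpace ℝ (Fin N))} {σ : B → X}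
  [IsManifold (𝓡 (2 * N)) ∞ X]

local notation "𝔼" => EuclideanSpace ℝ (Fin N)

omit [IsManifold (𝓡 (2 * N)) ∞ X] in
theorem mvfderiv_eq_of_mk_eq {F : Type*} [NormedAddCommGroup F] [NormedSpace ℝ F] (W : B → F)
    {b b' : B} {u : TangentSpace (𝓡 N) b} {u' : TangentSpace (𝓡 N) b'}
    (h : (⟨b, u⟩ : TangentBundle (𝓡 N) B) = ⟨b', u'⟩) :
    mvfderiv (𝓡 N) W b u = mvfderiv (𝓡 N) W b' u' := by
  obtain ⟨rfl, h⟩ := (Bundle.TotalSpace.mk.injEq _ _ _ _).mp h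
  rw [eq_of_heq h]

omit [IsManifold (𝓡 (2 * N)) ∞ X] in
/-- The chain rule along a curve in the base. -/
theorem hasDerivAt_comp_curve {F : Type*} [NormedAddCommGroup F] [NormedSpace ℝ F] {c : ℝ → B}
    {W : B → F} {t : ℝ} (hW : MDifferentiableAt (𝓡 N) 𝓘(ℝ, F) W (c t))
    (hc : MDifferentiableAt 𝓘(ℝ, ℝ) (𝓡 N) c t) :
    HasDerivAt (fun t => W (c t))
      (mvfderiv (𝓡 N) W (c t) (mfderiv 𝓘(ℝ, ℝ) (𝓡 N) c t (1 : ℝ))) t := by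
  have h1 : DifferentiableAt ℝ (fun t => W (c t)) t :=
    mdifferentiableAt_iff_differentiableAt.1 (hW.comp t hc)
  have h2 := h1.hasDerivAt
  have h3 := mvfderiv_comp_mfderiv (f := c) (g := W) (z := t) hW hc (1 : ℝ)
  rw [mvfderiv_eq_fderiv (F := ℝ) (fun t => W (c t)) t 1, fderiv_apply_one_eq_deriv] at h3
  rwa [h3] at h2

omit [IsManifold (𝓡 (2 * N)) ∞ X] in
theorem IsFlatChart.discrete (hπ : IsIntegrableSystem η π) (h : IsFlatChart η π x H Λ σ) :
    ∃ ε > 0, ∀ t ∈ Λ, ‖t‖ < ε → t = 0 := by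
  obtain ⟨ε, hε, hd⟩ := h.action.lattice_discrete hπ
  obtain ⟨c, ρ, hρ, hball⟩ := h.ball
  have hb : x.symm c ∈ x.source := PDiffeo.map_target x (hball ▸ Metric.mem_ball_self hρ)
  exact ⟨ε, hε, fun t ht => hd _ hb t (by rwa [h.lattice _ hb])⟩

/-- Along a family of loops, the periods of a vector field are its pairings with a constant element
of the period lattice. -/
theorem IsFlatChart.exists_period_family [T2Space X] (hπ : IsIntegrableSystem η π)
    (h : IsFlatChart η π x H Λ σ) {Γ : ℝ → ℝ → X} (hΓ : IsFibreLoopFamily (N := N) π Γ)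
    (h0 : π (Γ 0 0) ∈ x.source) :
    ∃ l : 𝔼, ∀ᶠ t in 𝓝 (0 : ℝ), ∀ V : TangentBundle (𝓡 N) B, V.proj = π (Γ t 0) →
      period η π V (Γ t) = 1 / (2 * Real.pi) * inner ℝ l (baseDeriv x V) := by
  obtain ⟨a, ha, hd, hper⟩ := h.action.exists_displacement hπ hΓ.smooth hΓ.vertical
  set D : ℝ → 𝔼 := fun t => ∫ u in (0 : ℝ)..1, a (t, u) with hD
  have hs : ∀ᶠ t in 𝓝 (0 : ℝ), π (Γ t 0) ∈ x.source := by
    have hc : Continuous fun t => π (Γ t 0) :=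
      hπ.smooth.continuous.comp (hΓ.smooth.continuous.comp (Continuous.prodMk_left 0))
    exact hc.continuousAt.eventually_mem (PDiffeo.source_mem_nhds x h0)
  have hcont : ContinuousAt D 0 := by
    refine continuousAt_intervalIntegral_param (f := fun q : ℝ × ℝ => a (q.2, q.1)) fun s _ => ?_
    filter_upwards [(continuous_snd.tendsto (s, (0 : ℝ))).eventually hs] with q hq
    exact ContinuousAt.comp (f := Prod.swap) (g := a) (ha q.2 q.1 hq) continuous_swap.continuousAt
  -- the total displacements are continuous with values in the discrete group `Λ`
  have hmem : ∀ t, π (Γ t 0) ∈ x.source → D t ∈ Λ := by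
    intro t ht
    have h1 := hd t 1 ht
    have h2 : Γ t 1 = Γ t 0 := by simpa using hΓ.periodic t 0
    rw [h2] at h1
    rw [← h.lattice _ ht]
    exact h.action.mem_lattice_of_eq hπ ht h1.symm
  obtain ⟨ε, hε, hdisc⟩ := h.discrete hπ
  refine ⟨D 0, ?_⟩
  filter_upwards [hs, hcont.eventually_mem (Metric.ball_mem_nhds (D 0) hε)] with t ht hlt V hV
  have h3 : D t - D 0 = 0 := hdisc _ (Λ.sub_mem (hmem t ht) (hmem 0 h0)) (by
    rwa [← dist_eq_norm])
  rw [hper t V hV (hV ▸ ht), ← sub_eq_zero.1 h3]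

variable [IsManifold (𝓡 N) ∞ B]

/-- The componentwise derivative of a vector field in flat coordinates satisfies the defining
property of the Gauss-Manin derivative, because the periods are the pairings with constant vectors.
-/
theorem IsFlatChart.isGaussManinDeriv [T2Space X] (hπ : IsIntegrableSystem η π)
    (h : IsFlatChart η π x H Λ σ) {v : (b : B) → TangentSpace (𝓡 N) b} {b : B} (hb : b ∈ x.source)
    (hv : IsSmoothNear v b) {u w : TangentSpace (𝓡 N) b}
    (hw : baseDeriv x ⟨b, w⟩ = mvfderiv (𝓡 N) (fun b' => baseDeriv x ⟨b', v b'⟩) b u) :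
    IsGaussManinDeriv η π v b u w := by
  intro Γ hΓ htan
  set c : ℝ → B := fun t => π (Γ t 0) with hc
  have hcs : ContMDiff 𝓘(ℝ, ℝ) (𝓡 N) ∞ c := by
    have h1 : ContMDiff 𝓘(ℝ, ℝ) 𝓘(ℝ, ℝ × ℝ) ∞ (fun t : ℝ => (t, (0 : ℝ))) :=
      (contDiff_prodMk_left 0).contMDiff
    exact hπ.smooth.comp (hΓ.smooth.comp h1)
  have hcb : c 0 = b := congrArg Bundle.TotalSpace.proj htan
  subst hcb
  have hu : mfderiv 𝓘(ℝ, ℝ) (𝓡 N) c 0 (1 : ℝ) = u := by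
    have h1 := (Bundle.TotalSpace.mk.injEq _ _ _ _).mp htan
    exact eq_of_heq h1.2
  obtain ⟨l, hl⟩ := h.exists_period_family hπ hΓ hb
  set W : B → 𝔼 := fun b' => baseDeriv x ⟨b', v b'⟩ with hW
  have hWc : HasDerivAt (fun t => W (c t)) (baseDeriv x ⟨c 0, w⟩) 0 := by
    have hWd : MDifferentiableAt (𝓡 N) 𝓘(ℝ, 𝔼) W (c 0) :=
      (hv.contMDiffAt_baseDeriv hb).mdifferentiableAt (by simp)
    rw [hw, ← hu]
    exact hasDerivAt_comp_curve hWd (hcs.mdifferentiable (by simp) 0)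
  have h4 : (fun t => period η π ⟨π (Γ t 0), v (π (Γ t 0))⟩ (Γ t)) =ᶠ[𝓝 0]
      fun t => 1 / (2 * Real.pi) * inner ℝ l (W (c t)) := by
    filter_upwards [hl] with t ht using ht _ rfl
  rw [hl.self_of_nhds ⟨c 0, w⟩ rfl]
  refine HasDerivAt.congr_of_eventuallyEq ?_ h4
  have h5 := ((hasDerivAt_const (0 : ℝ) l).inner ℝ hWc).const_mul (1 / (2 * Real.pi))
  simpa using h5

/-- The Gauss-Manin derivative is determined by the families of loops generated by the standard
basis vectors, over curves of the base in arbitrary directions. -/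
theorem IsFlatChart.baseDeriv_of_isGaussManinDeriv [T2Space X] (hπ : IsIntegrableSystem η π)
    (h : IsFlatChart η π x H Λ σ) {v : (b : B) → TangentSpace (𝓡 N) b} {b : B} (hb : b ∈ x.source)
    (hv : IsSmoothNear v b) {u w : TangentSpace (𝓡 N) b} (hw : IsGaussManinDeriv η π v b u w) :
    baseDeriv x ⟨b, w⟩ = mvfderiv (𝓡 N) (fun b' => baseDeriv x ⟨b', v b'⟩) b u := by
  have hH := h.action
  set a : 𝔼 := baseDeriv x ⟨b, u⟩ with ha
  obtain ⟨r, hr, hball⟩ := Metric.isOpen_iff.1 x.open_target _ (PDiffeo.map_source x hb)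
  -- a bounded reparametrization keeps the curve in the domain of the coordinates
  obtain ⟨δ, hδ, hδa⟩ : ∃ δ : ℝ, 0 < δ ∧ δ * ‖a‖ < r := by
    refine ⟨r / (2 * (‖a‖ + 1)), by positivity, ?_⟩
    have := norm_nonneg a
    rw [div_mul_eq_mul_div, div_lt_iff₀ (by positivity)]
    nlinarith
  set ψ : ℝ → ℝ := fun t => δ * Real.sin (t / δ) with hψ
  set y : ℝ → 𝔼 := fun t => x b + ψ t • a with hy
  have hψs : ContDiff ℝ ∞ ψ := contDiff_const.mul (Real.contDiff_sin.comp (contDiff_id.div_const δ))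
  have hys : ContDiff ℝ ∞ y := contDiff_const.add (hψs.smul contDiff_const)
  have hψd : HasDerivAt ψ 1 0 := by
    have h1 : HasDerivAt (fun t : ℝ => t / δ) (1 / δ) 0 := (hasDerivAt_id 0).div_const δ
    have h2 := (h1.sin).const_mul δ
    have h3 : δ * (Real.cos (0 / δ) * (1 / δ)) = 1 := by simp [hδ.ne']
    rwa [h3] at h2
  have hyd : HasDerivAt y a 0 := by
    have := (hψd.smul_const a).const_add (x b)
    rwa [one_smul] at this
  have hy0 : y 0 = x b := by simp [hy, hψ]
  have hyt : ∀ t, y t ∈ x.target := by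
    intro t
    refine hball ?_
    rw [Metric.mem_ball, dist_eq_norm, hy, add_sub_cancel_left, norm_smul]
    refine lt_of_le_of_lt (mul_le_mul_of_nonneg_right ?_ (norm_nonneg a)) hδa
    rw [hψ, Real.norm_eq_abs, abs_mul, abs_of_pos hδ]
    exact mul_le_of_le_one_right hδ.le (Real.abs_sin_le_one _)
  set c : ℝ → B := fun t => x.symm (y t) with hc
  have hcx : ∀ t, c t ∈ x.source := fun t => PDiffeo.map_target x (hyt t)
  have hcs : ∀ t, ContMDiffAt 𝓘(ℝ, ℝ) (𝓡 N) ∞ c t := fun t =>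
    ContMDiffAt.comp t (f := y) (g := x.symm) (PDiffeo.contMDiffAt_symm x (hyt t))
      hys.contMDiff.contMDiffAt
  have hc0 : c 0 = b := by
    change x.symm (y 0) = b
    rw [hy0, PDiffeo.left_inv x hb]
  have hxc : ∀ t, x (c t) = y t := fun t => PDiffeo.right_inv x (hyt t)
  refine PiLp.ext fun j => ?_
  set e : 𝔼 := EuclideanSpace.single j 1 with he
  have heΛ : ∀ b ∈ x.source, e ∈ hH.lattice b := fun b hb => by
    rw [h.lattice b hb]; exact h.single_mem j
  set Γ : ℝ → ℝ → X := fun t s => H (s • e) (σ (c t)) with hΓ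
  have hπσ : ∀ t, π (σ (c t)) = c t := fun t => h.proj_section _ (hcx t)
  have hπΓ : ∀ t s, π (Γ t s) = c t := fun t s => by rw [hΓ, hH.proj, hπσ]
  have hfam : IsFibreLoopFamily (N := N) π Γ := by
    refine ⟨fun q => ?_, fun t s => ?_, fun t s => by rw [hπΓ, hπΓ]⟩
    · have h1 : ContMDiffAt 𝓘(ℝ, ℝ × ℝ) 𝓘(ℝ, 𝔼) ∞ (fun q : ℝ × ℝ => q.2 • e) q :=
        (contDiff_snd.smul contDiff_const).contMDiff.contMDiffAt
      have h2 : ContMDiffAt 𝓘(ℝ, ℝ × ℝ) 𝓘(ℝ, ℝ) ∞ (fun q : ℝ × ℝ => q.1) q :=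
        contDiff_fst.contMDiff.contMDiffAt
      have h3 : ContMDiffAt 𝓘(ℝ, ℝ × ℝ) (𝓡 (2 * N)) ∞ (fun q : ℝ × ℝ => σ (c q.1)) q :=
        ContMDiffAt.comp q (f := fun q : ℝ × ℝ => c q.1) (g := σ) (h.smooth_section _ (hcx q.1))
          (ContMDiffAt.comp q (f := fun q : ℝ × ℝ => q.1) (g := c) (hcs q.1) h2)
      exact ContMDiffAt.comp q (f := fun q : ℝ × ℝ => (q.2 • e, σ (c q.1)))
        (g := fun q : 𝔼 × X => H q.1 q.2)
        (hH.smooth _ _ (by rw [hπσ]; exact hcx q.1)) (h1.prodMk h3)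
    · change H ((s + 1) • e) _ = H (s • e) _
      rw [add_smul, one_smul, hH.add, heΛ _ (hcx t) _ (hπσ t)]
  have hcfun : (fun t => π (Γ t 0)) = c := funext fun t => hπΓ t 0
  have hcd : mfderiv (𝓡 N) 𝓘(ℝ, 𝔼) x (c 0) (mfderiv 𝓘(ℝ, ℝ) (𝓡 N) c 0 (1 : ℝ)) = a := by
    have h3 := mvfderiv_comp_mfderiv (f := c) (g := x) (z := (0 : ℝ))
      (PDiffeo.mdifferentiableAt x (hcx 0)) ((hcs 0).mdifferentiableAt (by simp)) (1 : ℝ)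
    refine h3.symm.trans ?_
    rw [show (fun t => x (c t)) = y from funext hxc]
    refine (mvfderiv_eq_fderiv (F := ℝ) y 0 1).trans ?_
    rw [fderiv_apply_one_eq_deriv, hyd.deriv]
  have htan : tangentMap 𝓘(ℝ, ℝ) (𝓡 N) (fun t => π (Γ t 0))
      (⟨0, (1 : ℝ)⟩ : TangentBundle 𝓘(ℝ, ℝ) ℝ) = (⟨b, u⟩ : TangentBundle (𝓡 N) B) := by
    rw [hcfun]
    have hinj : InjOn (tangentPDiffeo x) (tangentPDiffeo x).source :=
      (tangentPDiffeo x).toPartialEquiv.injOn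
    refine hinj (hcx 0) hb ?_
    refine Prod.ext ?_ hcd
    change x (c 0) = x b
    rw [hc0]
  have hder := hw Γ hfam htan
  have hper : ∀ t (V : TangentBundle (𝓡 N) B), V.proj = c t →
      period η π V (Γ t) = 1 / (2 * Real.pi) * inner ℝ e (baseDeriv x V) := fun t V hV =>
    hH.period_orbit hπ (by rw [hπσ]; exact hcx t) e (by rw [hV, hπσ])
  set W : B → 𝔼 := fun b' => baseDeriv x ⟨b', v b'⟩ with hW
  have hWb : ContMDiffAt (𝓡 N) 𝓘(ℝ, 𝔼) ∞ W (c 0) := by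
    rw [hc0]; exact hv.contMDiffAt_baseDeriv hb
  have hWc : HasDerivAt (fun t => W (c t)) (mvfderiv (𝓡 N) W b u) 0 := by
    have h3 := hasDerivAt_comp_curve (hWb.mdifferentiableAt (by simp))
      ((hcs 0).mdifferentiableAt (by simp))
    rw [hcfun] at htan
    have htan' : (⟨c 0, mfderiv 𝓘(ℝ, ℝ) (𝓡 N) c 0 (1 : ℝ)⟩ : TangentBundle (𝓡 N) B) = ⟨b, u⟩ := htan
    have h5 : mvfderiv (𝓡 N) W (c 0) (mfderiv 𝓘(ℝ, ℝ) (𝓡 N) c 0 (1 : ℝ)) = mvfderiv (𝓡 N) W b u :=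
      mvfderiv_eq_of_mk_eq W htan'
    rwa [h5] at h3
  have h5 := ((hasDerivAt_const (0 : ℝ) e).inner ℝ hWc).const_mul (1 / (2 * Real.pi))
  have h6 : (fun t => period η π ⟨π (Γ t 0), v (π (Γ t 0))⟩ (Γ t)) =
      fun t => 1 / (2 * Real.pi) * inner ℝ e (W (c t)) := funext fun t => by
    have h7 : ∀ b', b' = c t → W b' = W (c t) := by rintro _ rfl; rfl
    exact (hper t ⟨π (Γ t 0), v (π (Γ t 0))⟩ (hπΓ t 0)).trans
      (congrArg (fun w => 1 / (2 * Real.pi) * inner ℝ e w) (h7 _ (hπΓ t 0)))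
  rw [h6, hper 0 ⟨b, w⟩ hc0.symm] at hder
  have h7 := hder.unique h5
  have h8 := mul_left_cancel₀ (by positivity) h7
  rw [inner_zero_left, add_zero, he, EuclideanSpace.inner_single_left,
    EuclideanSpace.inner_single_left, map_one, one_mul, one_mul] at h8
  exact h8

/-- In flat coordinates, the Gauss-Manin connection is the trivial one. -/
theorem IsFlatChart.baseDeriv_gaussManin [T2Space X] (hπ : IsIntegrableSystem η π)
    (h : IsFlatChart η π x H Λ σ) {v : (b : B) → TangentSpace (𝓡 N) b} {b : B} (hb : b ∈ x.source)
    (hv : IsSmoothNear v b) (u : TangentSpace (𝓡 N) b) :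
    baseDeriv x ⟨b, gaussManin η π v b u⟩ =
      mvfderiv (𝓡 N) (fun b' => baseDeriv x ⟨b', v b'⟩) b u := by
  obtain ⟨w, hw⟩ := (PDiffeo.mfderiv_bijective x hb).2
    (mvfderiv (𝓡 N) (fun b' => baseDeriv x ⟨b', v b'⟩) b u)
  have hex : ∃ w, IsGaussManinDeriv η π v b u w := ⟨w, h.isGaussManinDeriv hπ hb hv hw⟩
  rw [gaussManin, dif_pos hex]
  exact h.baseDeriv_of_isGaussManinDeriv hπ hb hv hex.choose_spec

end GaussManin

/-! ### Parallel symplectic forms in flat coordinates -/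

section Darboux

variable {N : ℕ}
  {X : Type*} [TopologicalSpace X] [ChartedSpace (EuclideanSpace ℝ (Fin (2 * N))) X]
  {B : Type*} [TopologicalSpace B] [ChartedSpace (EuclideanSpace ℝ (Fin N)) B]
  {η : TwoForm (𝓡 (2 * N)) X} {π : X → B}
  {x : PartialDiffeomorph (𝓡 N) 𝓘(ℝ, EuclideanSpace ℝ (Fin N)) B (EuclideanSpace ℝ (Fin N)) ∞}
  {H : EuclideanSpace ℝ (Fin N) → X → X} {Λ : AddSubgroup (EuclideanSpace ℝ (Fin N))} {σ : B → X}

local notation "𝔼" => EuclideanSpace ℝ (Fin N)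

theorem mvfderiv_linear_base {F : Type*} [NormedAddCommGroup F] [NormedSpace ℝ F] (l : 𝔼 →L[ℝ] F)
    {b : B} (hb : b ∈ x.source) (u : TangentSpace (𝓡 N) b) :
    mvfderiv (𝓡 N) (fun b' => l (x b')) b u = l (baseDeriv x ⟨b, u⟩) := by
  have h := mvfderiv_comp_fderiv (f := x) (g := l) l.differentiableAt
    (PDiffeo.mdifferentiableAt x hb) u
  rwa [l.fderiv] at h

variable [IsManifold (𝓡 (2 * N)) ∞ X] [IsManifold (𝓡 N) ∞ B]

/-- Linear functions of flat coordinates are flat. -/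
theorem IsFlatChart.isParallelOneFormOn [T2Space X] (hπ : IsIntegrableSystem η π)
    (h : IsFlatChart η π x H Λ σ) (l : 𝔼 →L[ℝ] ℝ) :
    IsParallelOneFormOn η π (fun b => mvfderiv (𝓡 N) (fun b' => l (x b')) b) x.source := by
  intro b hb v hv u
  have h1 : (fun b' => mvfderiv (𝓡 N) (fun b' => l (x b')) b' (v b')) =ᶠ[𝓝 b]
      fun b' => l (baseDeriv x ⟨b', v b'⟩) := by
    filter_upwards [PDiffeo.source_mem_nhds x hb] with b' hb' using mvfderiv_linear_base l hb' _
  have h2 := mvfderiv_comp_fderiv (f := fun b' => baseDeriv x ⟨b', v b'⟩) (g := l)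
    l.differentiableAt ((hv.contMDiffAt_baseDeriv hb).mdifferentiableAt (by simp)) u
  rw [l.fderiv, ← h.baseDeriv_gaussManin hπ hb hv u] at h2
  rw [mvfderiv_congr h1, h2, mvfderiv_linear_base l hb]

/-- Vector fields with constant components in flat coordinates are parallel. -/
theorem IsFlatChart.gaussManin_coordField [T2Space X] (hπ : IsIntegrableSystem η π)
    (h : IsFlatChart η π x H Λ σ) (a : 𝔼) {b : B} (hb : b ∈ x.source) (u : TangentSpace (𝓡 N) b) :
    gaussManin η π (coordField x a) b u = 0 := by
  have h1 := h.baseDeriv_gaussManin hπ hb (isSmoothNear_coordField a hb) u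
  have h2 : (fun b' => baseDeriv x ⟨b', coordField x a b'⟩) =ᶠ[𝓝 b] fun _ => a := by
    filter_upwards [PDiffeo.source_mem_nhds x hb] with b' hb' using baseDeriv_coordField a hb'
  rw [mvfderiv_congr h2, mvfderiv_const] at h1
  refine PDiffeo.mfderiv_injective x hb ?_
  exact h1.trans (map_zero (mfderiv (𝓡 N) 𝓘(ℝ, 𝔼) x b)).symm

omit [IsManifold (𝓡 N) ∞ B] in
theorem eq_coordField {b : B} (hb : b ∈ x.source) (u : TangentSpace (𝓡 N) b) :
    coordField x (baseDeriv x ⟨b, u⟩) b = u :=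
  PDiffeo.mfderiv_symm_mfderiv x hb u

/-- A parallel 2-form has constant coefficients in flat coordinates. -/
theorem IsFlatChart.exists_const [T2Space X] (hπ : IsIntegrableSystem η π)
    (h : IsFlatChart η π x H Λ σ) {Ω : TwoForm (𝓡 N) B} (hΩ : Ω.IsSymplecticOn univ)
    (hpar : IsParallelTwoForm η π Ω) (b₀ : B) (hb₀ : b₀ ∈ x.source) :
    ∀ b ∈ x.source, ∀ u v : TangentSpace (𝓡 N) b, Ω b ![u, v] =
      Ω.pullback x.symm (x b₀) ![baseDeriv x ⟨b, u⟩, baseDeriv x ⟨b, v⟩] := by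
  obtain ⟨hsm, -⟩ := TwoForm.pullback_smooth_closed hΩ x.open_target x.contMDiffOn_invFun
  obtain ⟨c, ρ, hρ, hball⟩ := h.ball
  have hxs : ∀ b ∈ x.source, ∀ a d : 𝔼, Ω.pullback x.symm (x b) ![a, d] =
      Ω b ![coordField x a b, coordField x d b] := by
    intro b hb a d
    rw [TwoForm.pullback_apply]
    have gen : ∀ (b' : B) (_ : b' = b) (u v : 𝔼),
        Ω b' ![(u : TangentSpace (𝓡 N) b'), v] = Ω b ![(u : TangentSpace (𝓡 N) b), v] := by
      rintro _ rfl u v; rfl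
    exact gen _ (PDiffeo.left_inv x hb) _ _
  have hconst : ∀ a d : 𝔼, ∀ y ∈ x.target, ∀ y' ∈ x.target,
      Ω.pullback x.symm y ![a, d] = Ω.pullback x.symm y' ![a, d] := by
    intro a d
    have hFs : ContDiffOn ℝ ∞ (fun y => Ω.pullback x.symm y ![a, d]) x.target := by
      have := ((contDiffOn_toBilin hsm).clm_apply (contDiffOn_const (c := a))).clm_apply
        (contDiffOn_const (c := d))
      exact this.congr fun y _ => (toBilin_apply _ _ _).symm
    have hFd : ∀ y ∈ x.target, fderiv ℝ (fun y => Ω.pullback x.symm y ![a, d]) y = 0 := by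
      intro y hy
      have hb := PDiffeo.map_target x hy
      have hxb : x (x.symm y) = y := PDiffeo.right_inv x hy
      set b := x.symm y with hbdef
      have hFy : DifferentiableAt ℝ (fun y => Ω.pullback x.symm y ![a, d]) (x b) := by
        rw [hxb]
        exact (hFs.contDiffAt (x.open_target.mem_nhds hy)).differentiableAt (by simp)
      ext k
      obtain ⟨u, hu⟩ := (PDiffeo.mfderiv_bijective x hb).2 k
      have h1 := hpar b (coordField x a) (coordField x d) (isSmoothNear_coordField a hb)
        (isSmoothNear_coordField d hb) u
      rw [h.gaussManin_coordField hπ a hb, h.gaussManin_coordField hπ d hb] at h1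
      have h2 : (fun b' => Ω b' ![coordField x a b', coordField x d b']) =ᶠ[𝓝 b]
          fun b' => Ω.pullback x.symm (x b') ![a, d] := by
        filter_upwards [PDiffeo.source_mem_nhds x hb] with b' hb' using (hxs b' hb' a d).symm
      rw [mvfderiv_congr h2] at h1
      have h3 := mvfderiv_comp_fderiv (f := x) (g := fun y => Ω.pullback x.symm y ![a, d]) hFy
        (PDiffeo.mdifferentiableAt x hb) u
      have h4 : mvfderiv (𝓡 N) x b u = k := hu
      rw [h4, hxb] at h3
      rw [← h3, h1]
      have z1 : Ω b ![(0 : TangentSpace (𝓡 N) b), coordField x d b] = 0 :=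
        (Ω b).toMultilinearMap.map_coord_zero (0 : Fin 2) rfl
      have z2 : Ω b ![coordField x a b, (0 : TangentSpace (𝓡 N) b)] = 0 :=
        (Ω b).toMultilinearMap.map_coord_zero (1 : Fin 2) rfl
      rw [z1, z2]
      simp
    intro y hy y' hy'
    rw [hball] at hy hy' hFs hFd
    exact Metric.isOpen_ball.is_const_of_fderiv_eq_zero (convex_ball c ρ).isPreconnected
      (hFs.differentiableOn (by simp)) (fun y hy => hFd y hy) hy hy'
  intro b hb u v
  rw [hconst _ _ _ (PDiffeo.map_source x hb₀) _ (PDiffeo.map_source x hb), hxs b hb,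
    eq_coordField hb, eq_coordField hb]

/-- A parallel symplectic form is the standard one in suitable flat linear coordinates. -/
theorem IsFlatChart.exists_darboux [T2Space X] (hπ : IsIntegrableSystem η π)
    (h : IsFlatChart η π x H Λ σ) {Ω : TwoForm (𝓡 N) B} (hΩ : Ω.IsSymplecticOn univ)
    (hpar : IsParallelTwoForm η π Ω) :
    ∃ (n : ℕ) (e : Module.Basis (Fin n ⊕ Fin n) ℝ 𝔼), ∀ b ∈ x.source, ∀ u v : TangentSpace (𝓡 N) b,
      Ω b ![u, v] = ∑ i, (e.coord (Sum.inl i) (baseDeriv x ⟨b, u⟩) *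
        e.coord (Sum.inr i) (baseDeriv x ⟨b, v⟩) - e.coord (Sum.inl i) (baseDeriv x ⟨b, v⟩) *
        e.coord (Sum.inr i) (baseDeriv x ⟨b, u⟩)) := by
  obtain ⟨c, ρ, hρ, hball⟩ := h.ball
  have hc : c ∈ x.target := hball ▸ Metric.mem_ball_self hρ
  have hb₀ := PDiffeo.map_target x hc
  have hconst := h.exists_const hπ hΩ hpar _ hb₀
  set ω₀ := Ω.pullback x.symm (x (x.symm c)) with hω₀
  obtain ⟨n, e, he⟩ := exists_symplectic_basis
    ((ContinuousLinearMap.coeLM ℝ).comp (toBilin ω₀ : 𝔼 →ₗ[ℝ] 𝔼 →L[ℝ] ℝ)) (fun a => by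
      change toBilin ω₀ a a = 0
      have := toBilin_swap ω₀ a a
      linarith) (fun a ha => by
      obtain ⟨u, rfl⟩ := (PDiffeo.mfderiv_bijective x hb₀).2 a
      have hu : u = 0 := hΩ.nondegenerate _ (mem_univ _) u fun v => by
        rw [hconst _ hb₀, ← toBilin_apply]
        exact ha _
      rw [hu]
      exact map_zero (mfderiv (𝓡 N) 𝓘(ℝ, 𝔼) x (x.symm c)))
  refine ⟨n, e, fun b hb u v => ?_⟩
  rw [hconst b hb, ← toBilin_apply]
  exact he _ _

end Darboux

/-! ### 2-forms with constant coefficients -/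

section ConstantForms

variable {E : Type*} [NormedAddCommGroup E] [NormedSpace ℝ E] [FiniteDimensional ℝ E]
  {H : Type*} [TopologicalSpace H] {I : ModelWithCorners ℝ E H} [I.Boundaryless]
  {M : Type*} [TopologicalSpace M] [ChartedSpace H M] [IsManifold I ∞ M]
  {V : Type*} [NormedAddCommGroup V] [NormedSpace ℝ V] [FiniteDimensional ℝ V]

/-- A 2-form which is locally the pull-back of a constant form is smooth and closed. -/
theorem smooth_closed_of_eventually_eq_const {θ : TwoForm I M} {W : Set M}
    (c : V [⋀^Fin 2]→L[ℝ] ℝ)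
    (hloc : ∀ z ∈ W, ∃ Φ : M → V, ∀ᶠ z' in 𝓝 z, ContMDiffAt I 𝓘(ℝ, V) ∞ Φ z' ∧
      ∀ u v : TangentSpace I z', θ z' ![u, v] = c ![mvfderiv I Φ z' u, mvfderiv I Φ z' v]) (x₀ : M) :
    ContDiffOn ℝ ∞ (θ.chartRep x₀) (chartDomain I W x₀) ∧
      ∀ y ∈ chartDomain I W x₀, extDeriv (θ.chartRep x₀) y = 0 := by
  set κ := chartPDiffeo I x₀ with hκ
  have key : ∀ y₀ ∈ chartDomain I W x₀, ContDiffAt ℝ ∞ (θ.chartRep x₀) y₀ ∧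
      extDeriv (θ.chartRep x₀) y₀ = 0 := by
    rintro y₀ ⟨hy₀, hyW⟩
    have hy₀' : y₀ ∈ κ.target := hy₀
    obtain ⟨Φ, hΦ⟩ := hloc (κ.symm y₀) hyW
    have hev : ∀ᶠ y in 𝓝 y₀, y ∈ κ.target ∧ (ContMDiffAt I 𝓘(ℝ, V) ∞ Φ (κ.symm y) ∧
        ∀ u v : TangentSpace I (κ.symm y), θ (κ.symm y) ![u, v] =
          c ![mvfderiv I Φ (κ.symm y) u, mvfderiv I Φ (κ.symm y) v]) :=
      (show ∀ᶠ y in 𝓝 y₀, y ∈ κ.target from PDiffeo.target_mem_nhds κ hy₀').and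
        ((PDiffeo.continuousAt_symm κ hy₀').eventually hΦ)
    obtain ⟨s, hs, hso, hys⟩ := eventually_nhds_iff.1 hev
    set f : E → V := fun y => Φ (κ.symm y) with hf
    have hfs : ∀ y ∈ s, ContDiffAt ℝ ∞ f y := fun y hy =>
      contMDiffAt_iff_contDiffAt.1 ((hs y hy).2.1.comp y (PDiffeo.contMDiffAt_symm κ (hs y hy).1))
    have hEq : ∀ y ∈ s, θ.chartRep x₀ y = c.compContinuousLinearMap (fderiv ℝ f y) := by
      intro y hy
      have hd : ∀ a : E, fderiv ℝ f y a =
          mvfderiv I Φ (κ.symm y) (mfderiv 𝓘(ℝ, E) I κ.symm y a) := fun a =>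
        (mvfderiv_eq_fderiv f y a).symm.trans
          (mvfderiv_comp_mfderiv (f := κ.symm) ((hs y hy).2.1.mdifferentiableAt (by simp))
            (PDiffeo.mdifferentiableAt_symm κ (hs y hy).1) a)
      ext w
      have h1 := (hs y hy).2.2 (mfderiv 𝓘(ℝ, E) I κ.symm y (w 0)) (mfderiv 𝓘(ℝ, E) I κ.symm y (w 1))
      rw [← hd, ← hd] at h1
      refine Eq.trans (congrArg (θ (κ.symm y)) (funext fun i => ?_))
        (h1.trans (congrArg c (funext fun i => ?_)))
      · fin_cases i <;> rfl
      · fin_cases i <;> rfl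
    have hEq' : θ.chartRep x₀ =ᶠ[𝓝 y₀] fun y => c.compContinuousLinearMap (fderiv ℝ f y) := by
      filter_upwards [hso.mem_nhds hys] with y hy using hEq y hy
    refine ⟨?_, ?_⟩
    · refine ContDiffAt.congr_of_eventuallyEq ?_ hEq'
      have hfo : ContDiffOn ℝ ∞ f s := fun y hy => (hfs y hy).contDiffWithinAt
      have h6 : ContDiffOn ℝ ∞ (fun y => c.compContinuousLinearMap (fderiv ℝ f y)) s := by
        refine contDiffOn_of_apply fun a b => ?_
        have h8 := ((contDiffOn_infty_iff_fderiv_of_isOpen hso).1 hfo).2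
        refine (((toBilin c).contDiff.comp_contDiffOn
          (h8.clm_apply (contDiffOn_const (c := a)))).clm_apply
          (h8.clm_apply (contDiffOn_const (c := b)))).congr fun w _ => ?_
        rw [ContinuousAlternatingMap.compContinuousLinearMap_apply, Function.comp_apply,
          toBilin_apply]
        congr 1
        ext i; fin_cases i <;> rfl
      exact h6.contDiffAt (hso.mem_nhds hys)
    · have h := extDeriv_pullback (f := f) (x := y₀)
        (differentiableAt_const c : DifferentiableAt ℝ (fun _ : V => c) (f y₀)) (hfs y₀ hys)
        (by simpa using two_le_infty)
      rw [hEq'.extDeriv_eq, h]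
      have h0 : extDeriv (fun _ : V => c) (f y₀) = 0 := by
        ext w
        simp [extDeriv, ContinuousAlternatingMap.alternatizeUncurryFin_apply]
      rw [h0]
      rfl
  exact ⟨fun y hy => (key y hy).1.contDiffWithinAt, fun y hy => (key y hy).2⟩

end ConstantForms

/-! ### The linear model of a hyper-symplectic structure -/

section HyperSymplecticModel

variable {n : ℕ}

/-- The coordinate space of `(x, y, p, q)`, the four blocks being indexed by `0, 1, 2, 3`. -/
abbrev QuaternionicSpace (n : ℕ) : Type := Fin 4 → Fin n → ℝ

/-- The coordinates of `QuaternionicSpace n`, as linear functionals. -/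
def QuaternionicSpace.coord (k : Fin 4) (i : Fin n) : QuaternionicSpace n →L[ℝ] ℝ :=
  (ContinuousLinearMap.proj i).comp
    (ContinuousLinearMap.proj (R := ℝ) (φ := fun _ : Fin 4 => Fin n → ℝ) k)

open QuaternionicSpace in
/-- The standard hyper-symplectic structure: `∑ dp ∧ dx + dq ∧ dy`, `∑ -dp ∧ dq + dx ∧ dy` and
`∑ dq ∧ dx + dy ∧ dp`. -/
def hyperSymplecticModel (n : ℕ) : Fin 3 → QuaternionicSpace n [⋀^Fin 2]→L[ℝ] ℝ :=
  ![∑ i, (wedge (coord 2 i) (coord 0 i) + wedge (coord 3 i) (coord 1 i)),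
    ∑ i, (-wedge (coord 2 i) (coord 3 i) + wedge (coord 0 i) (coord 1 i)),
    ∑ i, (wedge (coord 3 i) (coord 0 i) + wedge (coord 1 i) (coord 2 i))]

theorem hyperSymplecticModel_zero (u v : QuaternionicSpace n) :
    hyperSymplecticModel n 0 ![u, v] =
      ∑ i, ((u 2 i * v 0 i - v 2 i * u 0 i) + (u 3 i * v 1 i - v 3 i * u 1 i)) := by
  simp [hyperSymplecticModel, wedge_apply, QuaternionicSpace.coord]

theorem hyperSymplecticModel_one (u v : QuaternionicSpace n) :
    hyperSymplecticModel n 1 ![u, v] =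
      ∑ i, (-(u 2 i * v 3 i - v 2 i * u 3 i) + (u 0 i * v 1 i - v 0 i * u 1 i)) := by
  simp [hyperSymplecticModel, wedge_apply, QuaternionicSpace.coord]

theorem hyperSymplecticModel_two (u v : QuaternionicSpace n) :
    hyperSymplecticModel n 2 ![u, v] =
      ∑ i, ((u 3 i * v 0 i - v 3 i * u 0 i) + (u 1 i * v 2 i - v 1 i * u 2 i)) := by
  simp [hyperSymplecticModel, wedge_apply, QuaternionicSpace.coord]

/-- The linear map which permutes the four blocks of coordinates and multiplies them by `c`. -/
def blockMap (c : Fin 4 → ℝ) (τ : Fin 4 → Fin 4) : QuaternionicSpace n →L[ℝ] QuaternionicSpace n :=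
  ContinuousLinearMap.pi fun k => c k • ContinuousLinearMap.proj (τ k)

theorem blockMap_apply (c : Fin 4 → ℝ) (τ : Fin 4 → Fin 4) (u : QuaternionicSpace n) (k : Fin 4)
    (i : Fin n) : blockMap c τ u k i = c k * u (τ k) i := rfl

/-- The recursion operators of the model are signed permutations of the four blocks. -/
theorem hyperSymplecticModel_recursion {i j : Fin 3} (hij : i ≠ j) :
    ∃ A : QuaternionicSpace n →L[ℝ] QuaternionicSpace n,
      (∀ u v, hyperSymplecticModel n i ![A u, v] = hyperSymplecticModel n j ![u, v]) ∧
        ∀ u, A (A u) = -u := by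
  have key : ∀ (c : Fin 4 → ℝ) (τ : Fin 4 → Fin 4) (i j : Fin 3),
      (∀ u v, hyperSymplecticModel n i ![blockMap c τ u, v] = hyperSymplecticModel n j ![u, v]) →
      (∀ k, τ (τ k) = k ∧ c k * c (τ k) = -1) →
      ∃ A : QuaternionicSpace n →L[ℝ] QuaternionicSpace n,
        (∀ u v, hyperSymplecticModel n i ![A u, v] = hyperSymplecticModel n j ![u, v]) ∧
          ∀ u, A (A u) = -u := by
    intro c τ i j h1 h2
    refine ⟨blockMap c τ, h1, fun u => ?_⟩
    ext k l
    rw [blockMap_apply, blockMap_apply, ← mul_assoc, (h2 k).1, (h2 k).2]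
    simp
  fin_cases i <;> fin_cases j <;> first | exact absurd rfl hij | skip
  · refine key ![-1, 1, -1, 1] ![3, 2, 1, 0] 0 1 (fun u v => ?_) (by
      intro k; fin_cases k <;> simp)
    simp only [hyperSymplecticModel_zero, hyperSymplecticModel_one, blockMap_apply]
    exact Finset.sum_congr rfl fun i _ => by simp; ring
  · refine key ![-1, 1, 1, -1] ![1, 0, 3, 2] 0 2 (fun u v => ?_) (by
      intro k; fin_cases k <;> simp)
    simp only [hyperSymplecticModel_zero, hyperSymplecticModel_two, blockMap_apply]
    exact Finset.sum_congr rfl fun i _ => by simp; ring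
  · refine key ![1, -1, 1, -1] ![3, 2, 1, 0] 1 0 (fun u v => ?_) (by
      intro k; fin_cases k <;> simp)
    simp only [hyperSymplecticModel_zero, hyperSymplecticModel_one, blockMap_apply]
    exact Finset.sum_congr rfl fun i _ => by simp; ring
  · refine key ![-1, -1, 1, 1] ![2, 3, 0, 1] 1 2 (fun u v => ?_) (by
      intro k; fin_cases k <;> simp)
    simp only [hyperSymplecticModel_one, hyperSymplecticModel_two, blockMap_apply]
    exact Finset.sum_congr rfl fun i _ => by simp; ring
  · refine key ![1, -1, -1, 1] ![1, 0, 3, 2] 2 0 (fun u v => ?_) (by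
      intro k; fin_cases k <;> simp)
    simp only [hyperSymplecticModel_zero, hyperSymplecticModel_two, blockMap_apply]
    exact Finset.sum_congr rfl fun i _ => by simp; ring
  · refine key ![1, 1, -1, -1] ![2, 3, 0, 1] 2 1 (fun u v => ?_) (by
      intro k; fin_cases k <;> simp)
    simp only [hyperSymplecticModel_one, hyperSymplecticModel_two, blockMap_apply]
    exact Finset.sum_congr rfl fun i _ => by simp; ring

theorem hyperSymplecticModel_nondegenerate (j : Fin 3) {u : QuaternionicSpace n}
    (hu : ∀ v, hyperSymplecticModel n j ![u, v] = 0) : u = 0 := by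
  -- pairing `u` with a suitable rotation of itself gives the sum of the squares of its coordinates
  have key : ∀ (f : Fin n → ℝ), (∀ i, f i = u 0 i ^ 2 + u 1 i ^ 2 + u 2 i ^ 2 + u 3 i ^ 2) →
      ∑ i, f i = 0 → u = 0 := by
    intro f hf hs
    rw [Finset.sum_eq_zero_iff_of_nonneg (fun i _ => by rw [hf]; positivity)] at hs
    ext k i
    have h := (hf i).symm.trans (hs i (Finset.mem_univ i))
    have h2 : u k i ^ 2 = 0 := by
      fin_cases k <;> simp only [Fin.zero_eta, Fin.mk_one, Fin.reduceFinMk] <;>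
        nlinarith [sq_nonneg (u 0 i), sq_nonneg (u 1 i), sq_nonneg (u 2 i), sq_nonneg (u 3 i)]
    simpa using h2
  fin_cases j
  · refine key _ (fun i => ?_) ((hyperSymplecticModel_zero u ![u 2, u 3, -u 0, -u 1]).symm.trans
      (hu _))
    simp; ring
  · refine key _ (fun i => ?_) ((hyperSymplecticModel_one u ![-u 1, u 0, u 3, -u 2]).symm.trans
      (hu _))
    simp; ring
  · refine key _ (fun i => ?_) ((hyperSymplecticModel_two u ![u 3, -u 2, u 1, -u 0]).symm.trans
      (hu _))
    simp; ring

variable {E : Type*} [NormedAddCommGroup E] [NormedSpace ℝ E] [FiniteDimensional ℝ E]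
  {H : Type*} [TopologicalSpace H] {I : ModelWithCorners ℝ E H} [I.Boundaryless]
  {M : Type*} [TopologicalSpace M] [ChartedSpace H M] [IsManifold I ∞ M]

/-- Three 2-forms which in suitable coordinates are the standard ones constitute a hyper-symplectic
structure. -/
theorem isHyperSymplecticOn_of_model {θ : Fin 3 → TwoForm I M} {W : Set M}
    (hloc : ∀ z ∈ W, ∃ Φ : M → QuaternionicSpace n, Function.Bijective (mvfderiv I Φ z) ∧
      ∀ᶠ z' in 𝓝 z, ContMDiffAt I 𝓘(ℝ, QuaternionicSpace n) ∞ Φ z' ∧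
        ∀ (j : Fin 3) (u v : TangentSpace I z'), θ j z' ![u, v] =
          hyperSymplecticModel n j ![mvfderiv I Φ z' u, mvfderiv I Φ z' v]) :
    IsHyperSymplecticOn θ W where
  symplectic j :=
    have h := smooth_closed_of_eventually_eq_const (θ := θ j) (W := W) (hyperSymplecticModel n j)
      (fun z hz => by
        obtain ⟨Φ, -, hΦ⟩ := hloc z hz
        exact ⟨Φ, hΦ.mono fun z' hz' => ⟨hz'.1, hz'.2 j⟩⟩)
    { smooth := fun x₀ => (h x₀).1
      closed := fun x₀ => (h x₀).2
      nondegenerate := by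
        intro z hz u hu
        obtain ⟨Φ, hb, hΦ⟩ := hloc z hz
        have h1 : mvfderiv I Φ z u = 0 := hyperSymplecticModel_nondegenerate j fun w => by
          obtain ⟨v, rfl⟩ := hb.2 w
          rw [← hΦ.self_of_nhds.2 j u v, hu]
        exact hb.1 (h1.trans (map_zero _).symm) }
  recursion := by
    intro i j hij z hz
    obtain ⟨Φ, hb, hΦ⟩ := hloc z hz
    obtain ⟨A, hA, hAA⟩ := hyperSymplecticModel_recursion (n := n) hij
    have : FiniteDimensional ℝ (TangentSpace I z) := inferInstanceAs (FiniteDimensional ℝ E)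
    have : T2Space (TangentSpace I z) := inferInstanceAs (T2Space E)
    set L := LinearEquiv.ofBijective (mvfderiv I Φ z).toLinearMap hb with hL
    have hLa : ∀ u, mvfderiv I Φ z u = L u := fun u => rfl
    refine ⟨(L.symm.toLinearMap ∘ₗ A.toLinearMap ∘ₗ L.toLinearMap).toContinuousLinearMap,
      fun u v => ?_, fun u => ?_⟩
    · rw [hΦ.self_of_nhds.2 i, hΦ.self_of_nhds.2 j, ← hA]
      simp [hLa]
    · simp [hAA]

end HyperSymplecticModel

/-! ### The hyper-symplectic structure of an integrable system -/

section HyperSymplecticSystem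

variable {N n : ℕ}
  {X : Type*} [TopologicalSpace X] [ChartedSpace (EuclideanSpace ℝ (Fin (2 * N))) X]
  {B : Type*} [TopologicalSpace B] [ChartedSpace (EuclideanSpace ℝ (Fin N)) B]
  {η : TwoForm (𝓡 (2 * N)) X} {π : X → B}
  {x : PartialDiffeomorph (𝓡 N) 𝓘(ℝ, EuclideanSpace ℝ (Fin N)) B (EuclideanSpace ℝ (Fin N)) ∞}
  {H : EuclideanSpace ℝ (Fin N) → X → X} {Λ : AddSubgroup (EuclideanSpace ℝ (Fin N))} {σ : B → X}

local notation "𝔼" => EuclideanSpace ℝ (Fin N)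

/-- The coordinates with respect to a basis, as continuous linear functionals. -/
noncomputable def basisCoord (e : Module.Basis (Fin n ⊕ Fin n) ℝ 𝔼) (k : Fin n ⊕ Fin n) :
    𝔼 →L[ℝ] ℝ :=
  (e.coord k).toContinuousLinearMap

theorem basisCoord_apply (e : Module.Basis (Fin n ⊕ Fin n) ℝ 𝔼) (k : Fin n ⊕ Fin n) (a : 𝔼) :
    basisCoord e k a = e.repr a k := rfl

/-- Two families of functionals on `𝔼`, each consisting of two blocks, put together to a map from
`𝔼 × 𝔼` to the space with four blocks of coordinates. -/
noncomputable def fourBlocks (f g : Fin n ⊕ Fin n → 𝔼 →L[ℝ] ℝ) :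
    𝔼 × 𝔼 →L[ℝ] QuaternionicSpace n :=
  ContinuousLinearMap.pi
    ![ContinuousLinearMap.pi fun i => (f (Sum.inl i)).comp (ContinuousLinearMap.fst ℝ 𝔼 𝔼),
      ContinuousLinearMap.pi fun i => (f (Sum.inr i)).comp (ContinuousLinearMap.fst ℝ 𝔼 𝔼),
      ContinuousLinearMap.pi fun i => (g (Sum.inl i)).comp (ContinuousLinearMap.snd ℝ 𝔼 𝔼),
      ContinuousLinearMap.pi fun i => (g (Sum.inr i)).comp (ContinuousLinearMap.snd ℝ 𝔼 𝔼)]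

theorem fourBlocks_apply (f g : Fin n ⊕ Fin n → 𝔼 →L[ℝ] ℝ) (w : 𝔼 × 𝔼) (i : Fin n) :
    fourBlocks f g w 0 i = f (Sum.inl i) w.1 ∧ fourBlocks f g w 1 i = f (Sum.inr i) w.1 ∧
      fourBlocks f g w 2 i = g (Sum.inl i) w.2 ∧ fourBlocks f g w 3 i = g (Sum.inr i) w.2 :=
  ⟨rfl, rfl, rfl, rfl⟩

theorem fourBlocks_injective {f g : Fin n ⊕ Fin n → 𝔼 →L[ℝ] ℝ}
    (hf : ∀ a, (∀ k, f k a = 0) → a = 0) (hg : ∀ a, (∀ k, g k a = 0) → a = 0) :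
    Function.Injective (fourBlocks f g) := by
  refine (injective_iff_map_eq_zero (fourBlocks f g)).2 fun w hw => ?_
  have h : ∀ k i, fourBlocks f g w k i = 0 := fun k i => by rw [hw]; rfl
  refine Prod.ext (hf _ ?_) (hg _ ?_)
  · rintro (i | i)
    exacts [h 0 i, h 1 i]
  · rintro (i | i)
    exacts [h 2 i, h 3 i]

/-- The coordinate functionals separate points. -/
theorem basisCoord_separating (e : Module.Basis (Fin n ⊕ Fin n) ℝ 𝔼) (a : 𝔼)
    (h : ∀ k, basisCoord e k a = 0) : a = 0 :=
  e.repr.injective (Finsupp.ext fun k => by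
    rw [map_zero]; exact h k)

/-- The functionals `⟪eₖ, ·⟫` separate points; they are the coordinates for the basis dual to `e`.
-/
theorem innerSL_separating (e : Module.Basis (Fin n ⊕ Fin n) ℝ 𝔼) (a : 𝔼)
    (h : ∀ k, innerSL ℝ (e k) a = 0) : a = 0 :=
  InnerProductSpace.ext_inner_left_basis e fun k => by simpa using h k

/-- The inner product pairs the coordinates `⟪eₖ, a⟫` for the dual basis with those for the basis
itself. Hence a linear change of the coordinates of the base, together with the contragredient
change of the momenta, preserves the form `∑ dp ∧ dx`. -/
theorem inner_eq_sum_basis (e : Module.Basis (Fin n ⊕ Fin n) ℝ 𝔼) (a b : 𝔼) :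
    inner ℝ a b = ∑ i, (innerSL ℝ (e (Sum.inl i)) a * basisCoord e (Sum.inl i) b +
      innerSL ℝ (e (Sum.inr i)) a * basisCoord e (Sum.inr i) b) := by
  conv_lhs => rw [← e.sum_repr b]
  rw [inner_sum, Fintype.sum_sum_type, ← Finset.sum_add_distrib]
  simp only [inner_smul_right, innerSL_apply_apply, basisCoord_apply]
  refine Finset.sum_congr rfl fun i _ => ?_
  rw [real_inner_comm a, real_inner_comm a]
  ring

theorem finrank_eq_of_basis (e : Module.Basis (Fin n ⊕ Fin n) ℝ 𝔼) : N = 2 * n := by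
  have h := Module.finrank_eq_card_basis e
  simp at h
  omega

variable [IsManifold (𝓡 (2 * N)) ∞ X] [IsManifold (𝓡 N) ∞ B]

omit [IsManifold (𝓡 N) ∞ B] in
/-- The hyper-symplectic structure over the domain of a flat chart. It exists in any linear
coordinates `(x, y)` deduced from the flat ones; the forms `dp`, `dq` are the components of the
differential of the momenta in the dual basis. -/
theorem IsFlatChart.exists_hyperSymplectic (hπ : IsIntegrableSystem η π)
    (h : IsFlatChart η π x H Λ σ) (e : Module.Basis (Fin n ⊕ Fin n) ℝ 𝔼) :
    let ξ : Fin n → B → ℝ := fun i b => basisCoord e (Sum.inl i) (x b)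
    let υ : Fin n → B → ℝ := fun i b => basisCoord e (Sum.inr i) (x b)
    ∃ dp dq : Fin n → OneForm (𝓡 (2 * N)) X,
      (∀ i, (dp i).IsLocallyExactOn (π ⁻¹' x.source)) ∧
      (∀ i, (dq i).IsLocallyExactOn (π ⁻¹' x.source)) ∧
      (∀ z ∈ π ⁻¹' x.source, η z = omegaForm π ξ υ dp dq z) ∧
      IsHyperSymplecticOn ![η, chiForm π ξ υ dp dq, sigmaForm π ξ υ dp dq] (π ⁻¹' x.source) := by
  intro ξ υ
  obtain ⟨α, hα⟩ := h.exists_momentumForm hπ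
  have hopen : IsOpen (π ⁻¹' x.source) := x.open_source.preimage hπ.smooth.continuous
  have hdx : ∀ z, π z ∈ x.source → ∀ (l : 𝔼 →L[ℝ] ℝ) (u : TangentSpace (𝓡 (2 * N)) z),
      pullbackX π (fun b => l (x b)) z u = l (mvfderiv (𝓡 (2 * N)) (fun y => x (π y)) z u) := by
    intro z hz l u
    have h1 := mvfderiv_comp_fderiv (f := fun y => x (π y)) (g := l) l.differentiableAt
      ((contMDiffAt_base hπ hz).mdifferentiableAt (by simp)) u
    rwa [l.fderiv] at h1
  have hexact : ∀ l : 𝔼 →L[ℝ] ℝ,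
      OneForm.IsLocallyExactOn (I := 𝓡 (2 * N)) (fun z => l.comp (α z)) (π ⁻¹' x.source) := by
    intro l z hz
    obtain ⟨f, hf, hαf⟩ := hα z hz
    obtain ⟨O, hO, hOo, hzO⟩ := eventually_nhds_iff.1 (hf.and hαf)
    refine ⟨O, hOo, hzO, fun y => l (f y), fun y hy => ?_, fun y hy => ?_⟩
    · exact (l.contDiff.contMDiff.contMDiffAt.comp y (hO y hy).1.1).contMDiffWithinAt
    · ext u
      have h1 := mvfderiv_comp_fderiv (f := f) (g := l) (z := y) l.differentiableAt
        ((hO y hy).1.1.mdifferentiableAt (by simp)) u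
      rw [l.fderiv] at h1
      rw [h1, ← (hO y hy).2]
      rfl
  have hη : ∀ z, π z ∈ x.source → ∀ u v : TangentSpace (𝓡 (2 * N)) z, η z ![u, v] =
      inner ℝ (α z u) (mvfderiv (𝓡 (2 * N)) (fun y => x (π y)) z v) -
      inner ℝ (α z v) (mvfderiv (𝓡 (2 * N)) (fun y => x (π y)) z u) := by
    intro z hz u v
    obtain ⟨f, hf, hαf⟩ := hα z hz
    rw [hf.self_of_nhds.2, hαf.self_of_nhds]
  set dp : Fin n → OneForm (𝓡 (2 * N)) X := fun i z => (innerSL ℝ (e (Sum.inl i))).comp (α z)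
  set dq : Fin n → OneForm (𝓡 (2 * N)) X := fun i z => (innerSL ℝ (e (Sum.inr i))).comp (α z)
  have hωX : ∀ z ∈ π ⁻¹' x.source, η z = omegaForm π ξ υ dp dq z := by
    intro z hz
    ext w
    have hw : w = ![w 0, w 1] := by ext i; fin_cases i <;> rfl
    rw [hw, hη z hz, inner_eq_sum_basis e, inner_eq_sum_basis e, omegaForm]
    simp only [ContinuousAlternatingMap.sum_apply, ContinuousAlternatingMap.add_apply, wedge_apply]
    rw [← Finset.sum_sub_distrib]
    refine Finset.sum_congr rfl fun i _ => ?_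
    have h1 := hdx z hz (basisCoord e (Sum.inl i))
    have h2 := hdx z hz (basisCoord e (Sum.inr i))
    simp only [Matrix.cons_val_zero, Matrix.cons_val_one]
    rw [← h1, ← h1, ← h2, ← h2]
    change _ = (dp i z (w 0) * _ - dp i z (w 1) * _) + (dq i z (w 0) * _ - dq i z (w 1) * _)
    simp only [dp, dq, ξ, υ, ContinuousLinearMap.comp_apply]
    ring
  refine ⟨dp, dq, fun i => hexact _, fun i => hexact _, hωX, isHyperSymplecticOn_of_model (n := n) ?_⟩
  intro z hz
  obtain ⟨f, hf, hαf⟩ := hα z hz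
  set T := fourBlocks (basisCoord e) fun k => innerSL ℝ (e k) with hT
  have hN := finrank_eq_of_basis e
  have hpair : ∀ᶠ z' in 𝓝 z, π z' ∈ x.source ∧ ContMDiffAt (𝓡 (2 * N)) 𝓘(ℝ, 𝔼 × 𝔼) ∞
      (fun y => (x (π y), f y)) z' ∧ ∀ u, mvfderiv (𝓡 (2 * N)) (fun y => T (x (π y), f y)) z' u =
        T (mvfderiv (𝓡 (2 * N)) (fun y => x (π y)) z' u, α z' u) := by
    filter_upwards [hf, hαf, hopen.mem_nhds hz] with z' h1 h2 h3
    have h4 : ContMDiffAt (𝓡 (2 * N)) 𝓘(ℝ, 𝔼 × 𝔼) ∞ (fun y => (x (π y), f y)) z' :=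
      (contMDiffAt_base hπ h3).prodMk_space h1.1
    refine ⟨h3, h4, fun u => ?_⟩
    have h5 := mvfderiv_comp_fderiv (f := fun y => (x (π y), f y)) (g := T) (z := z')
      T.differentiableAt (h4.mdifferentiableAt (by simp)) u
    rw [T.fderiv] at h5
    obtain ⟨h6, h7⟩ := mvfderiv_fst_snd (h4.mdifferentiableAt (by simp)) u
    rw [h5, h2]
    exact congrArg T (Prod.ext h6.symm h7.symm)
  refine ⟨fun y => T (x (π y), f y), ?_, ?_⟩
  · have hinj : Function.Injective (mvfderiv (𝓡 (2 * N)) (fun y => T (x (π y), f y)) z) := by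
      refine (injective_iff_map_eq_zero _).2 fun u hu => ?_
      rw [hpair.self_of_nhds.2.2 u] at hu
      have h0 := fourBlocks_injective (basisCoord_separating e) (innerSL_separating e)
        (hu.trans (map_zero T).symm)
      refine hπ.symplectic.nondegenerate z (mem_univ z) u fun v => ?_
      have h01 : mvfderiv (𝓡 (2 * N)) (fun y => x (π y)) z u = 0 := (Prod.ext_iff.1 h0).1
      have h02 : α z u = 0 := (Prod.ext_iff.1 h0).2
      rw [hη z hz, h01, h02]
      simp
    have hfd : FiniteDimensional ℝ (TangentSpace (𝓡 (2 * N)) z) :=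
      inferInstanceAs (FiniteDimensional ℝ (EuclideanSpace ℝ (Fin (2 * N))))
    have hrank : Module.finrank ℝ (TangentSpace (𝓡 (2 * N)) z) =
        Module.finrank ℝ (QuaternionicSpace n) := by
      have h1 : Module.finrank ℝ (TangentSpace (𝓡 (2 * N)) z) = 2 * N :=
        finrank_euclideanSpace_fin (𝕜 := ℝ) (n := 2 * N)
      have h2 : Module.finrank ℝ (QuaternionicSpace n) = 4 * n := by
        rw [Module.finrank_pi_fintype]
        simp
      rw [h1, h2]
      omega
    exact ⟨hinj, (LinearMap.injective_iff_surjective_of_finrank_eq_finrank hrank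
      (f := (mvfderiv (𝓡 (2 * N)) (fun y => T (x (π y), f y)) z).toLinearMap)).1 hinj⟩
  · filter_upwards [hpair] with z' ⟨h1, h2, h3⟩
    refine ⟨T.contDiff.contMDiff.contMDiffAt.comp z' h2, fun j u v => ?_⟩
    rw [h3 u, h3 v]
    have hcoord : ∀ (l : 𝔼 →L[ℝ] ℝ) (u : TangentSpace (𝓡 (2 * N)) z'),
      l (mvfderiv (𝓡 (2 * N)) (fun y => x (π y)) z' u) = pullbackX π (fun b => l (x b)) z' u :=
      fun l u => (hdx z' h1 l u).symm
    fin_cases j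
    · change η z' ![u, v] = _
      rw [hωX z' h1]
      refine Eq.trans ?_ (hyperSymplecticModel_zero _ _).symm
      simp only [omegaForm, ContinuousAlternatingMap.sum_apply, ContinuousAlternatingMap.add_apply,
        wedge_apply, hT, (fourBlocks_apply _ _ _ _).1, (fourBlocks_apply _ _ _ _).2.1,
        (fourBlocks_apply _ _ _ _).2.2.1, (fourBlocks_apply _ _ _ _).2.2.2, hcoord]
      rfl
    · refine Eq.trans ?_ (hyperSymplecticModel_one _ _).symm
      change chiForm π ξ υ dp dq z' ![u, v] = _
      simp only [chiForm, ContinuousAlternatingMap.sum_apply, ContinuousAlternatingMap.add_apply,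
        ContinuousAlternatingMap.neg_apply,
        wedge_apply, hT, (fourBlocks_apply _ _ _ _).1, (fourBlocks_apply _ _ _ _).2.1,
        (fourBlocks_apply _ _ _ _).2.2.1, (fourBlocks_apply _ _ _ _).2.2.2, hcoord]
      rfl
    · refine Eq.trans ?_ (hyperSymplecticModel_two _ _).symm
      change sigmaForm π ξ υ dp dq z' ![u, v] = _
      simp only [sigmaForm, ContinuousAlternatingMap.sum_apply, ContinuousAlternatingMap.add_apply,
        wedge_apply, hT, (fourBlocks_apply _ _ _ _).1, (fourBlocks_apply _ _ _ _).2.1,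
        (fourBlocks_apply _ _ _ _).2.2.1, (fourBlocks_apply _ _ _ _).2.2.2, hcoord]
      rfl

/-- The coordinates in a symplectic basis are flat Darboux coordinates. -/
theorem IsFlatChart.isFlatDarbouxOn [T2Space X] (hπ : IsIntegrableSystem η π)
    (h : IsFlatChart η π x H Λ σ) {Ω : TwoForm (𝓡 N) B}
    (e : Module.Basis (Fin n ⊕ Fin n) ℝ 𝔼)
    (he : ∀ b ∈ x.source, ∀ u v : TangentSpace (𝓡 N) b,
      Ω b ![u, v] = ∑ i, (e.coord (Sum.inl i) (baseDeriv x ⟨b, u⟩) *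
        e.coord (Sum.inr i) (baseDeriv x ⟨b, v⟩) - e.coord (Sum.inl i) (baseDeriv x ⟨b, v⟩) *
        e.coord (Sum.inr i) (baseDeriv x ⟨b, u⟩))) :
    IsFlatDarbouxOn η π Ω x.source (fun i b => basisCoord e (Sum.inl i) (x b))
      (fun i b => basisCoord e (Sum.inr i) (x b)) where
  smooth_x i b hb := ((basisCoord e (Sum.inl i)).contDiff.contMDiff.contMDiffAt.comp b
    (PDiffeo.contMDiffAt x hb)).contMDiffWithinAt
  smooth_y i b hb := ((basisCoord e (Sum.inr i)).contDiff.contMDiff.contMDiffAt.comp b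
    (PDiffeo.contMDiffAt x hb)).contMDiffWithinAt
  injOn b hb b' hb' hbb := by
    have h1 := Prod.ext_iff.1 hbb
    refine x.toPartialEquiv.injOn hb hb' (e.repr.injective (Finsupp.ext ?_))
    rintro (i | i)
    · exact congrFun h1.1 i
    · exact congrFun h1.2 i
  flat_x i := h.isParallelOneFormOn hπ _
  flat_y i := h.isParallelOneFormOn hπ _
  darboux b hb := by
    ext w
    have hw : w = ![w 0, w 1] := by ext i; fin_cases i <;> rfl
    rw [hw, he b hb]
    simp only [ContinuousAlternatingMap.sum_apply, wedge_apply]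
    refine Finset.sum_congr rfl fun i _ => ?_
    simp only [Matrix.cons_val_zero, Matrix.cons_val_one]
    rw [mvfderiv_linear_base _ hb, mvfderiv_linear_base _ hb, mvfderiv_linear_base _ hb,
      mvfderiv_linear_base _ hb]
    rfl

end HyperSymplecticSystem

/-! ### Smooth structures on quotients -/

section QuotientManifold

variable {E : Type*} [NormedAddCommGroup E] [NormedSpace ℝ E]
  {H : Type*} [TopologicalSpace H] {I : ModelWithCorners ℝ E H}
  {M : Type*} [TopologicalSpace M] [ChartedSpace H M] [IsManifold I ∞ M]
  {Q : Type*} [TopologicalSpace Q]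

theorem isLocalHomeomorph_of_isOpenMap {q : M → Q} (hc : Continuous q) (ho : IsOpenMap q)
    (hinj : ∀ m, ∃ O ∈ 𝓝 m, InjOn q O) : IsLocalHomeomorph q := by
  rw [isLocalHomeomorph_iff_isOpenEmbedding_restrict]
  intro m
  obtain ⟨O, hO, hi⟩ := hinj m
  refine ⟨interior O, isOpen_interior.mem_nhds (mem_interior_iff_mem_nhds.2 hO),
    IsOpenEmbedding.of_continuous_injective_isOpenMap (hc.comp continuous_subtype_val)
      (injOn_iff_injective.1 (hi.mono interior_subset)) (ho.domRestrict isOpen_interior)⟩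

/-- The smooth structure on the target of a surjective local homeomorphism whose fibres are
permuted transitively by local diffeomorphisms that commute with the projection. -/
theorem exists_manifold_of_isLocalHomeomorph {q : M → Q} (hq : IsLocalHomeomorph q)
    (hs : Function.Surjective q)
    (hdeck : ∀ m m', q m = q m' → ∃ τ : M → M, ContMDiffAt I I ∞ τ m ∧ τ m = m' ∧
      ∀ᶠ a in 𝓝 m, q (τ a) = q a) :
    ∃ _ : ChartedSpace H Q, IsManifold I ∞ Q ∧ IsLocalDiffeomorph I I ∞ q := by
  have hloc : ∀ m : M, ∃ e : OpenPartialHomeomorph M Q, m ∈ e.source ∧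
      (∀ a, e a = q a) ∧ e.source ⊆ (chartAt H m).source := by
    intro m
    obtain ⟨e, hme, rfl⟩ := hq m
    refine ⟨e.restrOpen _ (chartAt H m).open_source, ⟨hme, mem_chart_source H m⟩, fun a => rfl,
      fun a ha => ha.2⟩
  choose e hme hea hes using hloc
  set φ : M → OpenPartialHomeomorph Q H := fun m => (e m).symm.trans (chartAt H m) with hφ
  have htgt : ∀ m, (φ m).source = (e m).target := by
    intro m
    rw [hφ, OpenPartialHomeomorph.trans_source]
    exact inter_eq_left.2 fun y hy => hes m ((e m).map_target hy)
  let cs : ChartedSpace H Q :=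
    { atlas := range φ
      chartAt := fun y => φ (hs y).choose
      mem_chart_source := fun y => by
        rw [htgt]
        have h := (e (hs y).choose).map_source (hme _)
        rwa [hea, (hs y).choose_spec] at h
      chart_mem_atlas := fun y => mem_range_self _ }
  -- changes of charts are, locally, given by deck transformations
  have htrans : ∀ m m' : M, ContMDiffOn I I ∞ (fun a => (e m').symm (q a))
      {a | a ∈ (e m).source ∧ q a ∈ (e m').target} := by
    rintro m m' a ⟨ha, ha'⟩
    obtain ⟨τ, hτ, hτa, hqτ⟩ := hdeck a ((e m').symm (q a))
      (((e m').right_inv ha').symm.trans (hea m' _))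
    refine (hτ.congr_of_eventuallyEq ?_).contMDiffWithinAt
    have h1 : ∀ᶠ b in 𝓝 a, τ b ∈ (e m').source :=
      hτ.continuousAt.eventually_mem (by
        rw [hτa]
        exact (e m').open_source.mem_nhds ((e m').map_target ha'))
    filter_upwards [h1, hqτ] with b hb1 hb2
    rw [← hb2, ← hea m', (e m').left_inv hb1]
  have hman : IsManifold I ∞ Q := by
    refine isManifold_of_contDiffOn I ∞ Q ?_
    rintro _ _ ⟨m, rfl⟩ ⟨m', rfl⟩
    rw [← contMDiffOn_iff_contDiffOn]
    have h1 : ContMDiffOn I I ∞ (chartAt H m' ∘ (fun a => (e m').symm (q a)) ∘ (chartAt H m).symm)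
        ((φ m).symm.trans (φ m')).source := by
      refine (contMDiffOn_chart (x := m')).comp ((htrans m m').comp
        ((contMDiffOn_chart_symm (x := m)).mono fun c hc => ?_) fun c hc => ?_) fun c hc => ?_
      · simp only [hφ, mfld_simps] at hc
        exact hc.1.1
      · simp only [hφ, mfld_simps, hea] at hc
        exact ⟨hc.1.2, hc.2.1⟩
      · simp only [hφ, mfld_simps, hea] at hc
        exact hc.2.2
    have h0 : ContMDiffOn 𝓘(ℝ, E) I ∞ I.symm
        (I.symm ⁻¹' ((φ m).symm.trans (φ m')).source ∩ range I) :=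
      (I.contMDiffOn_symm (n := ∞)).mono inter_subset_right
    have h2 := (I.contMDiff (n := ∞)).comp_contMDiffOn (h1.comp h0 fun c hc => hc.1)
    refine h2.congr fun c hc => ?_
    simp [hφ, hea]
  refine ⟨cs, hman, fun m => ?_⟩
  have hφm : φ m ∈ IsManifold.maximalAtlas I ∞ Q :=
    IsManifold.subset_maximalAtlas (mem_range_self m)
  refine ⟨{ toPartialEquiv := (e m).toPartialEquiv
            open_source := (e m).open_source
            open_target := (e m).open_target
            contMDiffOn_toFun := ?_
            contMDiffOn_invFun := ?_ }, hme m, fun a _ => (hea m a).symm⟩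
  · refine ((contMDiffOn_symm_of_mem_maximalAtlas hφm).comp
      ((contMDiffOn_chart (x := m)).mono (hes m)) fun a ha => ?_).congr fun a ha => ?_
    · simp only [hφ, mfld_simps]
      exact ⟨(chartAt H m).map_source (hes m ha), by rw [(chartAt H m).left_inv (hes m ha)]; exact ha⟩
    · simp only [hφ, mfld_simps]
      rw [(chartAt H m).left_inv (hes m ha)]
  · refine ((contMDiffOn_chart_symm (x := m)).comp
      ((contMDiffOn_of_mem_maximalAtlas hφm).mono (htgt m).ge) fun y hy => ?_).congr
      fun y hy => ?_
    · exact (chartAt H m).map_source (hes m ((e m).map_target hy))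
    · exact ((chartAt H m).left_inv (hes m ((e m).map_target hy))).symm

end QuotientManifold

/-! ### The smooth structure of the dual fibration -/

section DualTranslations

variable {N : ℕ}
  {X : Type*} [TopologicalSpace X] [ChartedSpace (EuclideanSpace ℝ (Fin (2 * N))) X]
  {B : Type*} [TopologicalSpace B] [ChartedSpace (EuclideanSpace ℝ (Fin N)) B]
  {η : TwoForm (𝓡 (2 * N)) X} {π : X → B}
  {x : PartialDiffeomorph (𝓡 N) 𝓘(ℝ, EuclideanSpace ℝ (Fin N)) B (EuclideanSpace ℝ (Fin N)) ∞}
  {H : EuclideanSpace ℝ (Fin N) → X → X} {Λ : AddSubgroup (EuclideanSpace ℝ (Fin N))} {σ : B → X}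
  [IsManifold (𝓡 (2 * N)) ∞ X] [IsManifold (𝓡 N) ∞ B]

local notation "𝔼" => EuclideanSpace ℝ (Fin N)

omit [IsManifold (𝓡 N) ∞ B] in
/-- In a flat chart, tangent vectors are identified in the dual fibration if the difference of
their components, divided by `2π`, is in the dual of the period lattice. -/
theorem IsFlatChart.mk_eq_iff [T2Space X] (hπ : IsIntegrableSystem η π)
    (h : IsFlatChart η π x H Λ σ) {V V' : TangentBundle (𝓡 N) B} (hV : V.proj ∈ x.source) :
    DualFibration.mk η π V = DualFibration.mk η π V' ↔ V.proj = V'.proj ∧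
      ∀ t ∈ Λ, ∃ k : ℤ, 1 / (2 * Real.pi) * inner ℝ t (baseDeriv x V - baseDeriv x V') = k := by
  refine (Quotient.eq (r := integralSetoid η π)).trans ?_
  refine and_congr_right fun hVV => ⟨fun hr t ht => ?_, fun hr γ hγ => ?_⟩
  · have hz := h.proj_section _ hV
    have ht' : t ∈ h.action.lattice V.proj := by rwa [h.lattice _ hV]
    obtain ⟨k, hk⟩ := hr _ (h.action.isFibreLoop hV ht' hz)
    refine ⟨k, ?_⟩
    rw [h.action.period_orbit hπ (by rwa [hz]) t hz.symm,
      h.action.period_orbit hπ (by rwa [hz]) t (hVV.symm.trans hz.symm)] at hk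
    rw [inner_sub_right, mul_sub, hk]
  · obtain ⟨t, ht, hper⟩ := h.action.exists_period_eq hπ hV hγ
    rw [h.lattice _ hV] at ht
    obtain ⟨k, hk⟩ := hr t ht
    refine ⟨k, ?_⟩
    rw [hper V rfl, hper V' hVV.symm, ← mul_sub, ← inner_sub_right, hk]

/-- The translation by `w` in the fibres of the tangent bundle, in the coordinates `x`. -/
noncomputable def fibreTranslation (x : PartialDiffeomorph (𝓡 N) 𝓘(ℝ, 𝔼) B 𝔼 ∞) (w : 𝔼)
    (W : TangentBundle (𝓡 N) B) : TangentBundle (𝓡 N) B :=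
  (tangentPDiffeo x).symm (tangentPDiffeo x W + (0, w))

theorem tangentPDiffeo_fibreTranslation {W : TangentBundle (𝓡 N) B} (hW : W.proj ∈ x.source)
    (w : 𝔼) : (fibreTranslation x w W).proj = W.proj ∧
      tangentPDiffeo x (fibreTranslation x w W) = tangentPDiffeo x W + (0, w) := by
  refine ⟨?_, PDiffeo.right_inv _ ⟨?_, mem_univ _⟩⟩
  · change x.symm (x W.proj + 0) = W.proj
    rw [add_zero, PDiffeo.left_inv x hW]
  · change x W.proj + 0 ∈ x.target
    rw [add_zero]
    exact PDiffeo.map_source x hW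

theorem contMDiffAt_fibreTranslation {W : TangentBundle (𝓡 N) B} (hW : W.proj ∈ x.source) (w : 𝔼) :
    ContMDiffAt (𝓡 N).tangent (𝓡 N).tangent ∞ (fibreTranslation x w) W := by
  have h1 : ContMDiffAt (𝓡 N).tangent 𝓘(ℝ, 𝔼 × 𝔼) ∞ (fun W => tangentPDiffeo x W + (0, w)) W :=
    (PDiffeo.contMDiffAt (tangentPDiffeo x) hW).add contMDiffAt_const
  refine (PDiffeo.contMDiffAt_symm (tangentPDiffeo x) ⟨?_, mem_univ _⟩).comp W h1
  change x W.proj + 0 ∈ x.target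
  rw [add_zero]
  exact PDiffeo.map_source x hW

theorem baseDeriv_fibreTranslation {W : TangentBundle (𝓡 N) B} (hW : W.proj ∈ x.source)
    (w : 𝔼) : baseDeriv x (fibreTranslation x w W) = baseDeriv x W + w :=
  congrArg Prod.snd (tangentPDiffeo_fibreTranslation hW w).2

theorem tangent_ext {V V' : TangentBundle (𝓡 N) B} (hV : V.proj ∈ x.source)
    (h1 : V.proj = V'.proj) (h2 : baseDeriv x V = baseDeriv x V') : V = V' :=
  (tangentPDiffeo x).toPartialEquiv.injOn hV (show V'.proj ∈ x.source from h1 ▸ hV)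
    (Prod.ext (congrArg x h1) h2)

/-- The translations of the fibres by elements of the dual lattice are deck transformations of the
projection to the dual fibration. -/
theorem IsFlatChart.fibreTranslation_mk [T2Space X] (hπ : IsIntegrableSystem η π)
    (h : IsFlatChart η π x H Λ σ) {V V' : TangentBundle (𝓡 N) B} (hV : V.proj ∈ x.source)
    (hVV : DualFibration.mk η π V = DualFibration.mk η π V') :
    fibreTranslation x (baseDeriv x V' - baseDeriv x V) V = V' ∧
      ∀ W : TangentBundle (𝓡 N) B, W.proj ∈ x.source → DualFibration.mk η π
        (fibreTranslation x (baseDeriv x V' - baseDeriv x V) W) = DualFibration.mk η π W := by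
  obtain ⟨h1, h2⟩ := (h.mk_eq_iff hπ hV).1 hVV
  refine ⟨?_, fun W hW => ?_⟩
  · have h3 := (tangentPDiffeo_fibreTranslation hV (baseDeriv x V' - baseDeriv x V)).1
    refine tangent_ext (x := x) (by rwa [h3]) (h3.trans h1) ?_
    rw [baseDeriv_fibreTranslation hV]
    abel
  · refine ((h.mk_eq_iff hπ hW).2 ⟨(tangentPDiffeo_fibreTranslation hW _).1.symm,
      fun t ht => ?_⟩).symm
    obtain ⟨k, hk⟩ := h2 t ht
    refine ⟨k, ?_⟩
    rw [baseDeriv_fibreTranslation hW, ← hk]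
    congr 2
    abel

theorem eventually_proj_mem {V : TangentBundle (𝓡 N) B} (hV : V.proj ∈ x.source) :
    ∀ᶠ W in 𝓝 V, W.proj ∈ x.source :=
  PDiffeo.source_mem_nhds (tangentPDiffeo x) hV

omit [IsManifold (𝓡 (2 * N)) ∞ X] in
theorem DualFibration.continuous_mk : Continuous (DualFibration.mk η π) := continuous_quotient_mk'

omit [IsManifold (𝓡 (2 * N)) ∞ X] [IsManifold (𝓡 N) ∞ B] in
theorem DualFibration.mk_surjective : Function.Surjective (DualFibration.mk η π) :=
  Quotient.mk_surjective

variable [T2Space X] [T2Space B]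

/-- The projection to the dual fibration is open, because the points of its fibres are permuted by
the translations by dual lattices. -/
theorem DualFibration.isOpenMap_mk (hπ : IsIntegrableSystem η π) :
    IsOpenMap (DualFibration.mk η π) := by
  intro O hO
  change IsOpen (DualFibration.mk η π ⁻¹' (DualFibration.mk η π '' O))
  rw [isOpen_iff_mem_nhds]
  rintro V' ⟨V, hV, hVV⟩
  obtain ⟨x, H, Λ, σ, hb, h⟩ := exists_isFlatChart hπ V'.proj
  obtain ⟨h1, h2⟩ := h.fibreTranslation_mk hπ hb hVV.symm
  have h3 := (contMDiffAt_fibreTranslation hb (baseDeriv x V - baseDeriv x V')).continuousAt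
  filter_upwards [h3.eventually_mem (hO.mem_nhds (by rwa [h1])), eventually_proj_mem hb] with W hW hWx
  exact ⟨_, hW, h2 W hWx⟩

/-- The projection to the dual fibration is locally injective, because the dual lattices are
discrete. -/
theorem DualFibration.exists_injOn (hπ : IsIntegrableSystem η π) (V : TangentBundle (𝓡 N) B) :
    ∃ O ∈ 𝓝 V, InjOn (DualFibration.mk η π) O := by
  obtain ⟨x, H, Λ, σ, hb, h⟩ := exists_isFlatChart hπ V.proj
  refine ⟨{W | W.proj ∈ x.source ∧ baseDeriv x W ∈ Metric.ball (baseDeriv x V) 1}, ?_, ?_⟩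
  · filter_upwards [eventually_proj_mem hb, (contMDiffAt_baseDeriv hb).continuousAt.eventually_mem
      (Metric.ball_mem_nhds _ one_pos)] with W h1 h2 using ⟨h1, h2⟩
  · rintro W ⟨hW, hWb⟩ W' ⟨hW', hWb'⟩ hq
    obtain ⟨h1, h2⟩ := (h.mk_eq_iff hπ hW).1 hq
    refine tangent_ext hW h1 (sub_eq_zero.1 ?_)
    -- the components of the difference are multiples of `2π` and smaller than `2`
    ext j
    obtain ⟨k, hk⟩ := h2 _ (h.single_mem j)
    set d := baseDeriv x W - baseDeriv x W' with hd
    have hdj : d j = 2 * Real.pi * k := by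
      rw [← hk, EuclideanSpace.inner_single_left]
      simp
      field_simp
    have hlt : |d j| < 2 := by
      refine lt_of_le_of_lt (PiLp.norm_apply_le d j) ?_
      rw [hd, ← dist_eq_norm]
      have := dist_triangle_right (baseDeriv x W) (baseDeriv x W') (baseDeriv x V)
      rw [Metric.mem_ball] at hWb hWb'
      linarith
    have hk0 : k = 0 := by
      by_contra hk0
      have h3 : (1 : ℝ) ≤ |(k : ℝ)| := by exact_mod_cast Int.one_le_abs hk0
      rw [hdj, abs_mul, abs_of_pos Real.two_pi_pos] at hlt
      nlinarith [Real.pi_gt_three]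
    rw [hdj, hk0]
    simp

/-- The dual fibration is a manifold, locally diffeomorphic to the tangent bundle of the base. -/
theorem DualFibration.exists_manifold (hπ : IsIntegrableSystem η π) :
    ∃ _ : ChartedSpace (ModelProd (EuclideanSpace ℝ (Fin N)) (EuclideanSpace ℝ (Fin N)))
      (DualFibration η π), IsManifold (𝓡 N).tangent ∞ (DualFibration η π) ∧
        IsLocalDiffeomorph (𝓡 N).tangent (𝓡 N).tangent ∞ (DualFibration.mk η π) := by
  refine exists_manifold_of_isLocalHomeomorph
    (isLocalHomeomorph_of_isOpenMap DualFibration.continuous_mk (DualFibration.isOpenMap_mk hπ)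
      (DualFibration.exists_injOn hπ)) DualFibration.mk_surjective fun V V' hVV => ?_
  obtain ⟨x, H, Λ, σ, hb, h⟩ := exists_isFlatChart hπ V.proj
  obtain ⟨h1, h2⟩ := h.fibreTranslation_mk hπ hb hVV
  exact ⟨_, contMDiffAt_fibreTranslation hb _, h1, (eventually_proj_mem hb).mono h2⟩

end DualTranslations

/-! ### The linear model of a complex structure -/

section ComplexModel

variable {n : ℕ}

theorem blockMap_comp_self {c : Fin 4 → ℝ} {τ : Fin 4 → Fin 4}
    (hc : ∀ k, τ (τ k) = k ∧ c k * c (τ k) = -1) (u : QuaternionicSpace n) :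
    blockMap c τ (blockMap c τ u) = -u := by
  ext k l
  rw [blockMap_apply, blockMap_apply, ← mul_assoc, (hc k).1, (hc k).2]
  simp

/-- The complex coordinates `u_k - i c_k u_{τ k}` for `k = a` and `k = b`; they are holomorphic for
the complex structure `blockMap c τ`. -/
noncomputable def complexCoord (c : Fin 4 → ℝ) (τ : Fin 4 → Fin 4) (a b : Fin 4) :
    QuaternionicSpace n →L[ℝ] (Fin (n + n) → ℂ) :=
  LinearMap.toContinuousLinearMap
    { toFun := fun u j => Sum.elim
        (fun i => (u a i : ℂ) - Complex.I * (c a * u (τ a) i))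
        (fun i => (u b i : ℂ) - Complex.I * (c b * u (τ b) i)) (finSumFinEquiv.symm j)
      map_add' := fun u v => by
        ext j
        simp only [Pi.add_apply]
        rcases finSumFinEquiv.symm j with i | i <;> simp <;> ring
      map_smul' := fun r u => by
        ext j
        simp only [Pi.smul_apply]
        rcases finSumFinEquiv.symm j with i | i <;> simp <;> ring }

theorem complexCoord_apply (c : Fin 4 → ℝ) (τ : Fin 4 → Fin 4) (a b : Fin 4)
    (u : QuaternionicSpace n) (j : Fin n ⊕ Fin n) :
    complexCoord c τ a b u (finSumFinEquiv j) = Sum.elim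
        (fun i => (u a i : ℂ) - Complex.I * (c a * u (τ a) i))
        (fun i => (u b i : ℂ) - Complex.I * (c b * u (τ b) i)) j := by
  change Sum.elim _ _ (finSumFinEquiv.symm (finSumFinEquiv j)) = _
  rw [Equiv.symm_apply_apply]

/-- The complex coordinates carry the model complex structure to the multiplication by `i`. -/
theorem complexCoord_blockMap {c : Fin 4 → ℝ} {τ : Fin 4 → Fin 4}
    (hc : ∀ k, τ (τ k) = k ∧ c k * c (τ k) = -1) (a b : Fin 4) (u : QuaternionicSpace n) :
    complexCoord c τ a b (blockMap c τ u) = Complex.I • complexCoord c τ a b u := by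
  have key : ∀ (k : Fin 4) (i : Fin n), ((blockMap c τ u k i : ℝ) : ℂ) -
      Complex.I * (c k * (blockMap c τ u (τ k) i : ℝ)) =
        Complex.I * ((u k i : ℂ) - Complex.I * (c k * u (τ k) i)) := by
    intro k i
    have h2 : (c k : ℂ) * c (τ k) = -1 := by exact_mod_cast (hc k).2
    rw [blockMap_apply, blockMap_apply, (hc k).1]
    push_cast
    linear_combination (-Complex.I * u k i) * h2 + (c k * u (τ k) i : ℂ) * Complex.I_mul_I
  ext j
  obtain ⟨j, rfl⟩ := finSumFinEquiv.surjective j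
  rw [Pi.smul_apply, complexCoord_apply, complexCoord_apply, smul_eq_mul]
  rcases j with i | i
  · exact key a i
  · exact key b i

/-- Two of the complex coordinates, one for each orbit of `τ` on the four blocks, form a coordinate
system. -/
theorem complexCoord_bijective {c : Fin 4 → ℝ} {τ : Fin 4 → Fin 4}
    (hc : ∀ k, τ (τ k) = k ∧ c k * c (τ k) = -1) {a b : Fin 4}
    (hab : ∀ k, k = a ∨ k = τ a ∨ k = b ∨ k = τ b) :
    Function.Bijective (complexCoord (n := n) c τ a b) := by
  have hinj : Function.Injective (complexCoord (n := n) c τ a b) := by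
    refine (injective_iff_map_eq_zero _).2 fun u hu => ?_
    have key : ∀ (k : Fin 4) (i : Fin n), (u k i : ℂ) - Complex.I * (c k * u (τ k) i) = 0 →
        u k i = 0 ∧ u (τ k) i = 0 := by
      intro k i h
      have h1 := congrArg Complex.re h
      have h2 := congrArg Complex.im h
      simp at h1 h2
      have h3 : c k ≠ 0 := fun h0 => by
        have := (hc k).2
        rw [h0] at this
        simp at this
      exact ⟨h1, h2.resolve_left h3⟩
    have h1 : ∀ i, _ := fun i => key a i (by
      have := congrFun hu (finSumFinEquiv (Sum.inl i))
      rwa [complexCoord_apply] at this)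
    have h2 : ∀ i, _ := fun i => key b i (by
      have := congrFun hu (finSumFinEquiv (Sum.inr i))
      rwa [complexCoord_apply] at this)
    ext k i
    rcases hab k with rfl | rfl | rfl | rfl
    exacts [(h1 i).1, (h1 i).2, (h2 i).1, (h2 i).2]
  have hrank : Module.finrank ℝ (QuaternionicSpace n) = Module.finrank ℝ (Fin (n + n) → ℂ) := by
    have h1 : Module.finrank ℝ (QuaternionicSpace n) = 4 * n := by
      rw [Module.finrank_pi_fintype]
      simp
    have h2 : Module.finrank ℝ (Fin (n + n) → ℂ) = 2 * (n + n) := by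
      rw [Module.finrank_pi_fintype]
      simp [Complex.finrank_real_complex, mul_comm]
    omega
  exact ⟨hinj, (LinearMap.injective_iff_surjective_of_finrank_eq_finrank hrank
    (f := (complexCoord (n := n) c τ a b).toLinearMap)).1 hinj⟩

variable {E : Type*} [NormedAddCommGroup E] [NormedSpace ℝ E]
  {H : Type*} [TopologicalSpace H] {I : ModelWithCorners ℝ E H}
  {M : Type*} [TopologicalSpace M] [ChartedSpace H M]

/-- An endomorphism field which in suitable coordinates is a constant complex structure is an
integrable complex structure. -/
theorem isComplexStructureOn_of_model {J : EndField I M} {W : Set M} {c : Fin 4 → ℝ}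
    {τ : Fin 4 → Fin 4} (hc : ∀ k, τ (τ k) = k ∧ c k * c (τ k) = -1) (a b : Fin 4)
    (hab : ∀ k, k = a ∨ k = τ a ∨ k = b ∨ k = τ b)
    (hloc : ∀ z ∈ W, ∃ Φ : M → QuaternionicSpace n, ∀ᶠ z' in 𝓝 z,
      ContMDiffAt I 𝓘(ℝ, QuaternionicSpace n) ∞ Φ z' ∧ Function.Bijective (mvfderiv I Φ z') ∧
        ∀ u, mvfderiv I Φ z' (J z' u) = blockMap c τ (mvfderiv I Φ z' u)) :
    J.IsComplexStructureOn W where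
  sq z hz u := by
    obtain ⟨Φ, hΦ⟩ := hloc z hz
    obtain ⟨-, h2, h3⟩ := hΦ.self_of_nhds
    refine h2.1 ?_
    rw [h3, h3, blockMap_comp_self hc]
    exact (map_neg (mvfderiv I Φ z) u).symm
  integrable z hz := by
    obtain ⟨Φ, hΦ⟩ := hloc z hz
    obtain ⟨O, hO, hOo, hzO⟩ := eventually_nhds_iff.1 hΦ
    set C := complexCoord (n := n) c τ a b with hC
    refine ⟨O, hOo, hzO, n + n, fun y => C (Φ y), fun y hy =>
      (C.contDiff.contMDiff.contMDiffAt.comp y (hO y hy).1).contMDiffWithinAt, fun y hy => ?_⟩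
    obtain ⟨h1, h2, h3⟩ := hO y hy
    have hd : ∀ u, mvfderiv I (fun y => C (Φ y)) y u = C (mvfderiv I Φ y u) := fun u => by
      have h := mvfderiv_comp_fderiv (f := Φ) (g := C) C.differentiableAt
        (h1.mdifferentiableAt (by simp)) u
      rwa [C.fderiv] at h
    refine ⟨?_, fun u => ?_⟩
    · rw [show ⇑(mvfderiv I (fun y => C (Φ y)) y) = C ∘ mvfderiv I Φ y from funext hd]
      exact (complexCoord_bijective hc hab).comp h2
    · rw [hd, hd, h3, hC, complexCoord_blockMap hc]

end ComplexModel

/-! ### The hypercomplex structure of the dual fibration -/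

section DualCoordinates

variable {N n : ℕ}
  {X : Type*} [TopologicalSpace X] [ChartedSpace (EuclideanSpace ℝ (Fin (2 * N))) X]
  {B : Type*} [TopologicalSpace B] [ChartedSpace (EuclideanSpace ℝ (Fin N)) B]
  {η : TwoForm (𝓡 (2 * N)) X} {π : X → B}
  {x : PartialDiffeomorph (𝓡 N) 𝓘(ℝ, EuclideanSpace ℝ (Fin N)) B (EuclideanSpace ℝ (Fin N)) ∞}
  {H : EuclideanSpace ℝ (Fin N) → X → X} {Λ : AddSubgroup (EuclideanSpace ℝ (Fin N))} {σ : B → X}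
  [IsManifold (𝓡 (2 * N)) ∞ X] [IsManifold (𝓡 N) ∞ B]
  [ChartedSpace (ModelProd (EuclideanSpace ℝ (Fin N)) (EuclideanSpace ℝ (Fin N)))
    (DualFibration η π)]

local notation "𝔼" => EuclideanSpace ℝ (Fin N)

/-- Over the domain of a flat chart, the differentials of the (multivalued) coordinates of the dual
fibration induced by the coordinates of the tangent bundle. -/
theorem IsFlatChart.exists_dualCoordinates [T2Space X] (hπ : IsIntegrableSystem η π)
    (h : IsFlatChart η π x H Λ σ)
    (hmk : IsLocalDiffeomorph (𝓡 N).tangent (𝓡 N).tangent ∞ (DualFibration.mk η π)) :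
    ∃ β : (z : DualFibration η π) → TangentSpace (𝓡 N).tangent z →L[ℝ] 𝔼 × 𝔼,
      ∀ V : TangentBundle (𝓡 N) B, V.proj ∈ x.source →
        (∀ u, β (DualFibration.mk η π V)
          (mfderiv (𝓡 N).tangent (𝓡 N).tangent (DualFibration.mk η π) V u) =
            mvfderiv (𝓡 N).tangent (tangentPDiffeo x) V u) ∧
        ∃ Ψ : DualFibration η π → 𝔼 × 𝔼, ∀ᶠ y in 𝓝 (DualFibration.mk η π V),
          ContMDiffAt (𝓡 N).tangent 𝓘(ℝ, 𝔼 × 𝔼) ∞ Ψ y ∧ β y = mvfderiv (𝓡 N).tangent Ψ y ∧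
          Function.Bijective (β y) ∧ (Ψ y).1 = x (DualFibration.proj η π y) := by
  set q := DualFibration.mk η π with hq
  set Θ := tangentPDiffeo x with hΘ
  have hmk' := hmk
  choose Φ hΦmem hΦeq using hmk'
  have hqd : ∀ V, MDifferentiableAt (𝓡 N).tangent (𝓡 N).tangent q V := fun V =>
    hmk.mdifferentiable (by simp) V
  have hqb : ∀ V, Function.Bijective (mfderiv (𝓡 N).tangent (𝓡 N).tangent q V) := fun V => by
    rw [← hmk.mfderivToContinuousLinearEquiv_coe (by simp) V]
    exact (hmk.mfderivToContinuousLinearEquiv (by simp) V).bijective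
  set s : DualFibration η π → TangentBundle (𝓡 N) B := Function.surjInv DualFibration.mk_surjective
  have hs : ∀ z, q (s z) = z := Function.surjInv_eq _
  have hleft : ∀ V, ∀ W ∈ (Φ V).source, (Φ V).symm (q W) = W := fun V W hW => by
    rw [hΦeq V hW]
    exact PDiffeo.left_inv (Φ V) hW
  set β : (z : DualFibration η π) → TangentSpace (𝓡 N).tangent z →L[ℝ] 𝔼 × 𝔼 := fun z =>
    mvfderiv (𝓡 N).tangent (fun y => Θ ((Φ (s z)).symm y)) z with hβ
  have hsymm : ∀ V W, W ∈ (Φ V).source → W.proj ∈ x.source →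
      ContMDiffAt (𝓡 N).tangent 𝓘(ℝ, 𝔼 × 𝔼) ∞ (fun y => Θ ((Φ V).symm y)) (q W) := by
    intro V W hW hWx
    have h1 : q W ∈ (Φ V).target := by
      rw [hΦeq V hW]
      exact PDiffeo.map_source (Φ V) hW
    refine ContMDiffAt.comp (q W) ?_ (PDiffeo.contMDiffAt_symm (Φ V) h1)
    rw [hleft V W hW]
    exact PDiffeo.contMDiffAt Θ hWx
  have hβq : ∀ V : TangentBundle (𝓡 N) B, V.proj ∈ x.source → ∀ u,
      β (q V) (mfderiv (𝓡 N).tangent (𝓡 N).tangent q V u) = mvfderiv (𝓡 N).tangent Θ V u := by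
    intro V hV u
    set V' := s (q V) with hV'
    obtain ⟨h1, h2⟩ := h.fibreTranslation_mk hπ hV (hs (q V)).symm
    set w := baseDeriv x V' - baseDeriv x V
    have hV'x : V'.proj ∈ x.source := by
      rw [show V' = _ from h1.symm, (tangentPDiffeo_fibreTranslation hV w).1]
      exact hV
    have hev : (fun W => Θ ((Φ V').symm (q W))) =ᶠ[𝓝 V] fun W => Θ W + (0, w) := by
      have h3 := (contMDiffAt_fibreTranslation hV w).continuousAt.eventually_mem
        (s := (Φ V').source) ((Φ V').open_source.mem_nhds (by rw [h1]; exact hΦmem V'))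
      filter_upwards [h3, eventually_proj_mem hV] with W hW hWx
      rw [← (tangentPDiffeo_fibreTranslation hWx w).2, hq, ← h2 W hWx]
      exact congrArg Θ (hleft V' _ hW)
    have hdiff : MDifferentiableAt (𝓡 N).tangent 𝓘(ℝ, 𝔼 × 𝔼) (fun y => Θ ((Φ V').symm y)) (q V) := by
      have h4 := (hsymm V' V' (hΦmem V') hV'x).mdifferentiableAt (by simp)
      rwa [hs] at h4
    have h5 := mvfderiv_comp_mfderiv (f := q) hdiff (hqd V) u
    have h6 := mvfderiv_comp_fderiv (f := Θ) (g := fun a : 𝔼 × 𝔼 => a + (0, w)) (z := V)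
      (by fun_prop) (PDiffeo.mdifferentiableAt Θ hV) u
    rw [fderiv_add_const, fderiv_fun_id] at h6
    exact h5.symm.trans ((DFunLike.congr_fun (mvfderiv_congr hev) u).trans h6)
  refine ⟨β, fun V hV => ⟨hβq V hV, fun y => Θ ((Φ V).symm y), ?_⟩⟩
  have hnhds : ∀ᶠ y in 𝓝 (q V), ∃ W ∈ (Φ V).source, W.proj ∈ x.source ∧ q W = y := by
    have hto : (Φ V).target ∈ 𝓝 (q V) := by
      rw [hΦeq V (hΦmem V)]
      exact PDiffeo.target_mem_nhds (Φ V) (PDiffeo.map_source (Φ V) (hΦmem V))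
    have hmem : q V ∈ (Φ V).target := mem_of_mem_nhds hto
    filter_upwards [hto, (PDiffeo.continuousAt_symm (Φ V) hmem).eventually
      (by rw [hleft V V (hΦmem V)]; exact eventually_proj_mem hV)] with y hy hyx
    refine ⟨(Φ V).symm y, PDiffeo.map_target (Φ V) hy, hyx, ?_⟩
    rw [hΦeq V (PDiffeo.map_target (Φ V) hy)]
    exact PDiffeo.right_inv (Φ V) hy
  filter_upwards [hnhds] with y hy
  obtain ⟨W, hW, hWx, rfl⟩ := hy
  have hsm := hsymm V W hW hWx
  have hev : (fun W => Θ ((Φ V).symm (q W))) =ᶠ[𝓝 W] Θ := by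
    filter_upwards [(Φ V).open_source.mem_nhds hW] with W' hW'
    rw [hleft V W' hW']
  have hd : ∀ u, mvfderiv (𝓡 N).tangent (fun y => Θ ((Φ V).symm y)) (q W)
      (mfderiv (𝓡 N).tangent (𝓡 N).tangent q W u) = mvfderiv (𝓡 N).tangent Θ W u := fun u =>
    (mvfderiv_comp_mfderiv (f := q) (hsm.mdifferentiableAt (by simp)) (hqd W) u).symm.trans
      (DFunLike.congr_fun (mvfderiv_congr hev) u)
  refine ⟨hsm, ?_, ?_, ?_⟩
  · ext1 u
    obtain ⟨u, rfl⟩ := (hqb W).2 u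
    rw [hd, hβq W hWx]
  · have h1 : ⇑(β (q W)) ∘ mfderiv (𝓡 N).tangent (𝓡 N).tangent q W =
        mvfderiv (𝓡 N).tangent Θ W := funext (hβq W hWx)
    refine (Function.Bijective.of_comp_iff (β (q W)) (hqb W)).1 ?_
    rw [h1]
    exact PDiffeo.mfderiv_bijective Θ hWx
  · rw [hleft V W hW]
    rfl

/-- The hypercomplex structure of the dual fibration over the domain of a flat chart. -/
theorem IsFlatChart.exists_hypercomplex [T2Space X] (hπ : IsIntegrableSystem η π)
    (h : IsFlatChart η π x H Λ σ)
    (hmk : IsLocalDiffeomorph (𝓡 N).tangent (𝓡 N).tangent ∞ (DualFibration.mk η π))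
    (e : Module.Basis (Fin n ⊕ Fin n) ℝ 𝔼) :
    let ξ : Fin n → B → ℝ := fun i b => basisCoord e (Sum.inl i) (x b)
    let υ : Fin n → B → ℝ := fun i b => basisCoord e (Sum.inr i) (x b)
    ∃ dP dQ : Fin n → OneForm (𝓡 N).tangent (DualFibration η π),
      (∀ i, IsDualFibreDifferential η π x.source (ξ i) (dP i)) ∧
      (∀ i, IsDualFibreDifferential η π x.source (υ i) (dQ i)) ∧
      ∃ J₁ J₂ : EndField (𝓡 N).tangent (DualFibration η π),
        IsJOmegaOn η π x.source ξ υ dP dQ J₁ ∧ IsJChiOn η π x.source ξ υ dP dQ J₂ ∧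
        IsHypercomplexOn J₁ J₂ (fun z => (J₁ z).comp (J₂ z))
          (DualFibration.proj η π ⁻¹' x.source) := by
  intro ξ υ
  obtain ⟨β, hβ⟩ := h.exists_dualCoordinates hπ hmk
  set T := fourBlocks (basisCoord e) (basisCoord e) with hT
  have hTb : Function.Bijective T := by
    have hinj : Function.Injective T :=
      fourBlocks_injective (basisCoord_separating e) (basisCoord_separating e)
    have hrank : Module.finrank ℝ (𝔼 × 𝔼) = Module.finrank ℝ (QuaternionicSpace n) := by
      have h1 : Module.finrank ℝ (QuaternionicSpace n) = 4 * n := by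
        rw [Module.finrank_pi_fintype]
        simp
      have h2 := finrank_eq_of_basis e
      rw [h1, Module.finrank_prod, finrank_euclideanSpace_fin]
      omega
    exact ⟨hinj, (LinearMap.injective_iff_surjective_of_finrank_eq_finrank hrank
      (f := T.toLinearMap)).1 hinj⟩
  have hcoord : ∀ z, DualFibration.proj η π z ∈ x.source → ∃ Ψ : DualFibration η π → 𝔼 × 𝔼,
      ∀ᶠ y in 𝓝 z, ContMDiffAt (𝓡 N).tangent 𝓘(ℝ, 𝔼 × 𝔼) ∞ Ψ y ∧
        β y = mvfderiv (𝓡 N).tangent Ψ y ∧ Function.Bijective (β y) ∧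
        (Ψ y).1 = x (DualFibration.proj η π y) := by
    intro z hz
    obtain ⟨V, rfl⟩ := DualFibration.mk_surjective z
    exact (hβ V hz).2
  have hbij : ∀ z, DualFibration.proj η π z ∈ x.source → Function.Bijective fun u => T (β z u) := by
    intro z hz
    obtain ⟨Ψ, hΨ⟩ := hcoord z hz
    exact hTb.comp hΨ.self_of_nhds.2.2.1
  have hpull : ∀ (l : 𝔼 →L[ℝ] ℝ) z, DualFibration.proj η π z ∈ x.source →
      ∀ u, pullbackDual η π (fun b => l (x b)) z u = l (β z u).1 := by
    intro l z hz u
    obtain ⟨Ψ, hΨ⟩ := hcoord z hz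
    obtain ⟨h1, h2, -, -⟩ := hΨ.self_of_nhds
    have h3 : (fun y => l (x (DualFibration.proj η π y))) =ᶠ[𝓝 z]
        fun y => (l.comp (ContinuousLinearMap.fst ℝ 𝔼 𝔼)) (Ψ y) := by
      filter_upwards [hΨ] with y hy
      rw [← hy.2.2.2]
      rfl
    have h4 := mvfderiv_comp_fderiv (f := Ψ) (g := l.comp (ContinuousLinearMap.fst ℝ 𝔼 𝔼))
      (ContinuousLinearMap.differentiableAt _) (h1.mdifferentiableAt (by simp)) u
    rw [ContinuousLinearMap.fderiv, ← h2] at h4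
    exact (DFunLike.congr_fun (mvfderiv_congr h3) u).trans h4
  have hJ : ∀ (c : Fin 4 → ℝ) (τ : Fin 4 → Fin 4), ∃ J : EndField (𝓡 N).tangent (DualFibration η π),
      ∀ z, DualFibration.proj η π z ∈ x.source → ∀ u,
        T (β z (J z u)) = blockMap c τ (T (β z u)) := by
    intro c τ
    have h1 : ∀ z : DualFibration η π, ∃ J : TangentSpace (𝓡 N).tangent z →L[ℝ]
        TangentSpace (𝓡 N).tangent z, DualFibration.proj η π z ∈ x.source → ∀ u,
          T (β z (J u)) = blockMap c τ (T (β z u)) := by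
      intro z
      by_cases hz : DualFibration.proj η π z ∈ x.source
      · have : FiniteDimensional ℝ (TangentSpace (𝓡 N).tangent z) :=
          inferInstanceAs (FiniteDimensional ℝ (𝔼 × 𝔼))
        have : T2Space (TangentSpace (𝓡 N).tangent z) := inferInstanceAs (T2Space (𝔼 × 𝔼))
        set L := LinearEquiv.ofBijective (T.comp (β z)).toLinearMap (hbij z hz) with hL
        have hLa : ∀ u, T (β z u) = L u := fun u => rfl
        refine ⟨(L.symm.toLinearMap ∘ₗ (blockMap c τ).toLinearMap ∘ₗ
          L.toLinearMap).toContinuousLinearMap, fun _ u => ?_⟩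
        simp [hLa]
      · exact ⟨0, fun hz' => absurd hz' hz⟩
    choose J hJ using h1
    exact ⟨J, hJ⟩
  -- the blocks `0, 1, 2, 3` are the coordinates `x, y, P, Q`
  obtain ⟨J₁, hJ₁⟩ := hJ ![-1, -1, 1, 1] ![2, 3, 0, 1]
  obtain ⟨J₂, hJ₂⟩ := hJ ![-1, 1, 1, -1] ![1, 0, 3, 2]
  have hJ₃ : ∀ z, DualFibration.proj η π z ∈ x.source → ∀ u,
      T (β z (J₁ z (J₂ z u))) = blockMap ![-1, 1, -1, 1] ![3, 2, 1, 0] (T (β z u)) := by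
    intro z hz u
    rw [hJ₁ z hz, hJ₂ z hz]
    ext k i
    fin_cases k <;> simp [blockMap_apply]
  have hdual : ∀ l : 𝔼 →L[ℝ] ℝ, IsDualFibreDifferential η π x.source (fun b => l (x b))
      (fun z => l.comp ((ContinuousLinearMap.snd ℝ 𝔼 𝔼).comp (β z))) := by
    intro l V hV
    ext u
    have h1 : (fun V' : TangentBundle (𝓡 N) B =>
        mvfderiv (𝓡 N) (fun b => l (x b)) V'.proj V'.snd) =ᶠ[𝓝 V]
          fun V' => (l.comp (ContinuousLinearMap.snd ℝ 𝔼 𝔼)) (tangentPDiffeo x V') := by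
      filter_upwards [eventually_proj_mem hV] with V' hV'
      exact mvfderiv_linear_base l hV' V'.snd
    have h2 := mvfderiv_comp_fderiv (f := tangentPDiffeo x)
      (g := l.comp (ContinuousLinearMap.snd ℝ 𝔼 𝔼)) (ContinuousLinearMap.differentiableAt _)
      (PDiffeo.mdifferentiableAt (tangentPDiffeo x) hV) u
    rw [ContinuousLinearMap.fderiv, ← (hβ V hV).1 u] at h2
    exact ((DFunLike.congr_fun (mvfderiv_congr h1) u).trans h2).symm
  have hmodel : ∀ (J : EndField (𝓡 N).tangent (DualFibration η π)) (c : Fin 4 → ℝ)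
      (τ : Fin 4 → Fin 4), (∀ z, DualFibration.proj η π z ∈ x.source → ∀ u,
        T (β z (J z u)) = blockMap c τ (T (β z u))) →
      ∀ z ∈ DualFibration.proj η π ⁻¹' x.source, ∃ Φ : DualFibration η π → QuaternionicSpace n,
        ∀ᶠ z' in 𝓝 z, ContMDiffAt (𝓡 N).tangent 𝓘(ℝ, QuaternionicSpace n) ∞ Φ z' ∧
          Function.Bijective (mvfderiv (𝓡 N).tangent Φ z') ∧
          ∀ u, mvfderiv (𝓡 N).tangent Φ z' (J z' u) =
            blockMap c τ (mvfderiv (𝓡 N).tangent Φ z' u) := by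
    intro J c τ hJ z hz
    obtain ⟨Ψ, hΨ⟩ := hcoord z hz
    obtain ⟨V, rfl⟩ := DualFibration.mk_surjective z
    have hproj : ∀ᶠ y in 𝓝 (DualFibration.mk η π V), DualFibration.proj η π y ∈ x.source := by
      filter_upwards [hmk.isOpenMap.image_mem_nhds (eventually_proj_mem (V := V) hz)] with y hy
      obtain ⟨W, hW, rfl⟩ := hy
      exact hW
    refine ⟨fun y => T (Ψ y), ?_⟩
    filter_upwards [hΨ, hproj] with y ⟨h1, h2, h3, _⟩ hy
    have hd : ∀ u, mvfderiv (𝓡 N).tangent (fun y => T (Ψ y)) y u = T (β y u) := fun u => by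
      have h := mvfderiv_comp_fderiv (f := Ψ) (g := T) T.differentiableAt
        (h1.mdifferentiableAt (by simp)) u
      rwa [T.fderiv, ← h2] at h
    refine ⟨T.contDiff.contMDiff.contMDiffAt.comp y h1, ?_, fun u => ?_⟩
    · rw [show ⇑(mvfderiv (𝓡 N).tangent (fun y => T (Ψ y)) y) = T ∘ β y from funext hd]
      exact hTb.comp h3
    · rw [hd, hd, hJ y hy]
  have hx : ∀ z, DualFibration.proj η π z ∈ x.source → ∀ i u,
      pullbackDual η π (ξ i) z u = T (β z u) 0 i := fun z hz i u => hpull _ z hz u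
  have hy : ∀ z, DualFibration.proj η π z ∈ x.source → ∀ i u,
      pullbackDual η π (υ i) z u = T (β z u) 1 i := fun z hz i u => hpull _ z hz u
  refine ⟨_, _, fun i => hdual (basisCoord e (Sum.inl i)), fun i => hdual (basisCoord e (Sum.inr i)),
    J₁, J₂, fun z hz i => ?_, fun z hz i => ?_, ?_⟩
  · refine ⟨ContinuousLinearMap.ext fun u => ?_, ContinuousLinearMap.ext fun u => ?_,
      ContinuousLinearMap.ext fun u => ?_, ContinuousLinearMap.ext fun u => ?_⟩
    · refine (hx z hz i (J₁ z u)).trans ?_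
      rw [hJ₁ z hz, blockMap_apply]
      exact neg_one_mul _
    · change T (β z (J₁ z u)) 2 i = _
      rw [hx z hz, hJ₁ z hz, blockMap_apply]
      exact one_mul _
    · refine (hy z hz i (J₁ z u)).trans ?_
      rw [hJ₁ z hz, blockMap_apply]
      exact neg_one_mul _
    · change T (β z (J₁ z u)) 3 i = _
      rw [hy z hz, hJ₁ z hz, blockMap_apply]
      exact one_mul _
  · refine ⟨ContinuousLinearMap.ext fun u => ?_, ContinuousLinearMap.ext fun u => ?_,
      ContinuousLinearMap.ext fun u => ?_, ContinuousLinearMap.ext fun u => ?_⟩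
    · change T (β z (J₂ z u)) 3 i = _
      rw [hJ₂ z hz, blockMap_apply]
      exact neg_one_mul _
    · change T (β z (J₂ z u)) 2 i = _
      rw [hJ₂ z hz, blockMap_apply]
      exact one_mul _
    · refine (hy z hz i (J₂ z u)).trans ?_
      rw [hx z hz, hJ₂ z hz, blockMap_apply]
      exact one_mul _
    · refine (hx z hz i (J₂ z u)).trans ?_
      rw [hJ₂ z hz, blockMap_apply]
      refine (neg_one_mul _).trans (congrArg Neg.neg (hy z hz i u).symm)
  · exact
    { complex₁ := isComplexStructureOn_of_model (n := n) (c := ![-1, -1, 1, 1]) (τ := ![2, 3, 0, 1])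
        (fun k => by fin_cases k <;> simp) 0 1 (by decide) (hmodel _ _ _ hJ₁)
      complex₂ := isComplexStructureOn_of_model (n := n) (c := ![-1, 1, 1, -1]) (τ := ![1, 0, 3, 2])
        (fun k => by fin_cases k <;> simp) 0 2 (by decide) (hmodel _ _ _ hJ₂)
      complex₃ := isComplexStructureOn_of_model (n := n) (c := ![-1, 1, -1, 1]) (τ := ![3, 2, 1, 0])
        (fun k => by fin_cases k <;> simp) 0 1 (by decide) (hmodel _ _ _ hJ₃)
      mul := fun z _ u => rfl
      anticomm := by
        intro z hz u
        refine (hbij z hz).1 ?_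
        change T (β z (J₂ z (J₁ z u))) = T (β z (-(J₁ z (J₂ z u))))
        rw [map_neg, map_neg, hJ₃ z hz, hJ₂ z hz, hJ₁ z hz]
        ext k i
        fin_cases k <;> simp [blockMap_apply] }

end DualCoordinates

end IntegrableSystem

open IntegrableSystem in
theorem theorem2p2 {N : ℕ}
    {X : Type*} [TopologicalSpace X] [T2Space X] [SecondCountableTopology X] [ConnectedSpace X]
    [ChartedSpace (EuclideanSpace ℝ (Fin (2 * N))) X] [IsManifold (𝓡 (2 * N)) ∞ X]
    {B : Type*} [TopologicalSpace B] [T2Space B] [SecondCountableTopology B]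
    [ChartedSpace (EuclideanSpace ℝ (Fin N)) B] [IsManifold (𝓡 N) ∞ B]
    (ωX : TwoForm (𝓡 (2 * N)) X) (π : X → B) (hπ : IsIntegrableSystem ωX π)
    (Ω : TwoForm (𝓡 N) B) (hΩ : Ω.IsSymplecticOn Set.univ) (hΩ_parallel : IsParallelTwoForm ωX π Ω) :
    -- the dual fibration is a manifold, with the smooth structure of a quotient of `TB`
    ∃ _ : ChartedSpace (ModelProd (EuclideanSpace ℝ (Fin N)) (EuclideanSpace ℝ (Fin N)))
        (DualFibration ωX π),
      IsManifold (𝓡 N).tangent ∞ (DualFibration ωX π) ∧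
      IsLocalDiffeomorph (𝓡 N).tangent (𝓡 N).tangent ∞ (DualFibration.mk ωX π) ∧
      ∃ n : ℕ, N = 2 * n ∧
        ∀ b₀ : B, ∃ U : Set B, IsOpen U ∧ b₀ ∈ U ∧
          ∃ x y : Fin n → B → ℝ, IsFlatDarbouxOn ωX π Ω U x y ∧
            -- the hyper-symplectic structure on `X` over `U`
            (∃ dp dq : Fin n → OneForm (𝓡 (2 * N)) X,
              (∀ i, (dp i).IsLocallyExactOn (π ⁻¹' U)) ∧
              (∀ i, (dq i).IsLocallyExactOn (π ⁻¹' U)) ∧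
              (∀ z ∈ π ⁻¹' U, ωX z = omegaForm π x y dp dq z) ∧
              IsHyperSymplecticOn ![ωX, chiForm π x y dp dq, sigmaForm π x y dp dq] (π ⁻¹' U)) ∧
            -- the hypercomplex structure on the dual fibration over `U`
            (∃ dP dQ : Fin n → OneForm (𝓡 N).tangent (DualFibration ωX π),
              (∀ i, IsDualFibreDifferential ωX π U (x i) (dP i)) ∧
              (∀ i, IsDualFibreDifferential ωX π U (y i) (dQ i)) ∧
              ∃ J_ω J_χ : EndField (𝓡 N).tangent (DualFibration ωX π),
                IsJOmegaOn ωX π U x y dP dQ J_ω ∧ IsJChiOn ωX π U x y dP dQ J_χ ∧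
                IsHypercomplexOn J_ω J_χ (fun z => (J_ω z).comp (J_χ z))
                  (DualFibration.proj ωX π ⁻¹' U)) := by
  obtain ⟨cs, hman, hmk⟩ := DualFibration.exists_manifold hπ
  obtain ⟨z₀⟩ : Nonempty X := inferInstance
  obtain ⟨x, H, Λ, σ, -, h⟩ := exists_isFlatChart hπ (π z₀)
  obtain ⟨n, e, -⟩ := h.exists_darboux hπ hΩ hΩ_parallel
  refine ⟨cs, hman, hmk, n, finrank_eq_of_basis e, fun b₀ => ?_⟩
  obtain ⟨x, H, Λ, σ, hb₀, h⟩ := exists_isFlatChart hπ b₀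
  -- the charts give the same `n`, which is half the dimension of the base
  obtain ⟨m, e', he'⟩ := h.exists_darboux hπ hΩ hΩ_parallel
  obtain rfl : m = n := by
    have h1 := finrank_eq_of_basis e
    have h2 := finrank_eq_of_basis e'
    omega
  exact ⟨x.source, x.open_source, hb₀, _, _, h.isFlatDarbouxOn hπ e' he',
    h.exists_hyperSymplectic hπ e', h.exists_hypercomplex hπ hmk e'⟩
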